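/- Let $R$ be a (not necessarily commutative) local ring with maximal ideal $\mathfrak m$ and residue skew field $d=R/\mathfrak m$, such that $\mathfrak m^2=0$ and $\mathfrak m=Rx=xR$ for all $x\in\mathfrak m\setminus\{0\}$. For $x\in\mathfrak m\setminus\{0\}$ let $\sigma_x$ be the automorphism of $d$ with $x\tilde t=\widetilde{\sigma_x(t)}\,x$ for all $t\in d$, where $\tilde t\in R$ denotes a lift of $t$; let $Z(d)$ be the center of $d$, $Z(d)^{\sigma_x}$ the subfield of elements of $Z(d)$ fixed by $\sigma_x$, and $d'$ the residue field of the (local) center $Z(R)$, which embeds in $Z(d)^{\sigma_x}\subseteq Z(d)$. Let $\mathcal P$ be the category of projective left $R$-modules, or the category of finitely generated projective left $R$-modules. A triangulation means a triangulated structure on $\mathcal P$ with translation functor $\Sigma=\mathrm{Id}$. Two triangulations are called equivalent if there is a natural isomorphism $\eta:\mathrm{Id}\to\mathrm{Id}$ such that $(\mathrm{Id},\eta)$ is an isomorphism of triangulated categories between them, i.e. $X\xrightarrow{u}Y\xrightarrow{v}Z\xrightarrow{w}X$ is distinguished for the first if and only if $X\xrightarrow{u}Y\xrightarrow{v}Z\xrightarrow{\eta_X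 w}X$ is distinguished for the second. For $x\in\mathfrak m\setminus\{0\}$ and $r\in d^\times$ let $\bigtriangleup^{r}$ be the class of triangles isomorphic to a direct sum of a contractible triangle and copies (finitely many in the finitely generated case) of $R\xrightarrow{\cdot x}R\xrightarrow{\cdot x}R\xrightarrow{\cdot\tilde r x}R$; write $[\bigtriangleup^r]$ for its equivalence class when it is a triangulation. 1. (Mixed characteristic.) Suppose $\mathfrak m=2R\neq0$, and take $x=2$. Then $\bigtriangleup^{r}$ is a triangulation for every $r\in Z(d)^\times$, every triangulation equals $\bigtriangleup^{r}$ for a unique $r\in Z(d)^\times$, and $[\bigtriangleup^{r}]\mapsto[r]$ is a well-defined bijection from the set of equivalence classes of triangulations of $\mathcal P$ to $Z(d)^\times/d'^\times$. 2. (Equicharacteristic.) Suppose $2=0$ in $R$, let $x\in\mathfrak m\setminus\{0\}$, and suppose $r_x\in d^\times$ satisfies $\sigma_x(r_x)=r_x$ and $\sigma_x^3(t)=r_x^{-1}tr_x$ for all $t\in d$. Then $\bigtriangleup^{r'_x}$ is a triangulation for every $r'_x\in d^\times$ satisfying these same two conditions (in particular for $r'_x=r_x$), every triangulation equals $\bigtriangleup^{r'_x}$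 for a unique such $r'_x$, and $[\bigtriangleup^{r'_x}]\mapsto[r_x^{-1}r'_x]$ is a well-defined bijection from the set of equivalence classes of triangulations of $\mathcal P$ to $(Z(d)^{\sigma_x})^\times/d'^\times$. 3. If $R$ is commutative, then any two triangulations of $\mathcal P$ are equivalent. -/

import Mathlib

open CategoryTheory CategoryTheory.Limits
open scoped ZeroObject

universe v u

noncomputable section

/-! ## Triangulations with the identity as translation functor -/

section Triangles

/-- A triangle `X ⟶ Y ⟶ Z ⟶ X` with respect to the translation functor `Σ = Id`: consecutive
composites, including `w ≫ u`, vanish. -/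
structure Tri (C : Type u) [Category.{v} C] [Preadditive C] where
  X : C
  Y : C
  Z : C
  u : X ⟶ Y
  v : Y ⟶ Z
  w : Z ⟶ X
  uv : u ≫ v = 0
  vw : v ≫ w = 0
  wu : w ≫ u = 0

namespace Tri

variable {C : Type u} [Category.{v} C] [Preadditive C]

/-- Morphisms of triangles. -/
structure Mor (A B : Tri C) where
  f : A.X ⟶ B.X
  g : A.Y ⟶ B.Y
  h : A.Z ⟶ B.Z
  comm_u : A.u ≫ g = f ≫ B.u
  comm_v : A.v ≫ h = g ≫ B.v
  comm_w : A.w ≫ f = h ≫ B.w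

/-- Two triangles are isomorphic if there is a morphism of triangles between them whose three
components are isomorphisms. -/
def Isomorphic (A B : Tri C) : Prop :=
  ∃ φ : Mor A B, IsIso φ.f ∧ IsIso φ.g ∧ IsIso φ.h

/-- The triangle `X = X ⟶ 0 ⟶ X`. -/
def ofId [HasZeroObject C] (X : C) : Tri C where
  X := X
  Y := X
  Z := 0
  u := 𝟙 X
  v := 0
  w := 0
  uv := by simp
  vw := by simp
  wu := by simp

/-- The translate `(v, w, -u)` of `(u, v, w)`. -/
def translate (A : Tri C) : Tri C where
  X := A.Y
  Y := A.Z
  Z := A.X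
  u := A.v
  v := A.w
  w := -A.u
  uv := A.vw
  vw := by simp [A.wu]
  wu := by simp [A.uv]

/-- The mapping cone of a morphism of triangles. In matrix form its three maps are
`(-v 0; g u')`, `(-w 0; h v')` and `(-u 0; f w')`. -/
def cone [HasBinaryBiproducts C] {A B : Tri C} (φ : Mor A B) : Tri C where
  X := A.Y ⊞ B.X
  Y := A.Z ⊞ B.Y
  Z := A.X ⊞ B.Z
  u := biprod.desc (biprod.lift (-A.v) φ.g) (biprod.lift 0 B.u)
  v := biprod.desc (biprod.lift (-A.w) φ.h) (biprod.lift 0 B.v)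
  w := biprod.desc (biprod.lift (-A.u) φ.f) (biprod.lift 0 B.w)
  uv := by
    ext <;> simp [biprod.lift_desc, A.vw, B.uv, φ.comm_v]
  vw := by
    ext <;> simp [biprod.lift_desc, A.wu, B.vw, φ.comm_w]
  wu := by
    ext <;> simp [biprod.lift_desc, A.uv, B.wu, φ.comm_u]

/-- The direct sum of two triangles. -/
def sum [HasBinaryBiproducts C] (A B : Tri C) : Tri C where
  X := A.X ⊞ B.X
  Y := A.Y ⊞ B.Y
  Z := A.Z ⊞ B.Z
  u := biprod.map A.u B.u
  v := biprod.map A.v B.v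
  w := biprod.map A.w B.w
  uv := by ext <;> simp [A.uv, B.uv]
  vw := by ext <;> simp [A.vw, B.vw]
  wu := by ext <;> simp [A.wu, B.wu]

/-- A triangle is contractible if its identity is homotopic to zero. -/
def Contractible (A : Tri C) : Prop :=
  ∃ (Θ : A.Y ⟶ A.X) (Φ : A.Z ⟶ A.Y) (Ψ : A.X ⟶ A.Z),
    𝟙 A.Y = A.v ≫ Φ + Θ ≫ A.u ∧
    𝟙 A.Z = A.w ≫ Ψ + Φ ≫ A.v ∧
    𝟙 A.X = A.u ≫ Θ + Ψ ≫ A.w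

/-- The image `(u, v, η_X ∘ w)` of the triangle `(u, v, w)` under `(Id, η)`, for a natural
transformation `η : Id ∘ Σ ⟶ Σ ∘ Id`, where `Σ = Id`. -/
def twist (η : 𝟭 C ⟶ 𝟭 C) (A : Tri C) : Tri C where
  X := A.X
  Y := A.Y
  Z := A.Z
  u := A.u
  v := A.v
  w := A.w ≫ η.app A.X
  uv := A.uv
  vw := by
    have := A.vw
    rw [← Category.assoc, this, zero_comp]
  wu := by
    have h := η.naturality A.u
    simp only [Functor.id_map, Functor.id_obj] at h
    have := A.wu
    rw [Category.assoc, ← h, ← Category.assoc, this, zero_comp]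

theorem twist_twist (η θ : 𝟭 C ⟶ 𝟭 C) (A : Tri C) :
    (A.twist η).twist θ = A.twist (η ≫ θ) := by
  simp [twist]

theorem twist_id (A : Tri C) : A.twist (𝟙 (𝟭 C)) = A := by
  cases A
  simp only [twist, NatTrans.id_app]
  congr 1
  exact Category.comp_id _

end Tri

/-- A triangulation with translation functor `Σ = Id` of an additive category: a class of
distinguished triangles such that
* (A.1) it is closed under isomorphism, contains all `X = X ⟶ 0 ⟶ X`, and every morphism is the
  first map of a distinguished triangle;
* (A.2) a triangle is distinguished iff its translate is;
* (A.3) a commutative square between the first maps of two distinguished triangles extends to a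
  morphism of triangles whose mapping cone is distinguished.
By a theorem of Neeman this axiom system is equivalent to the one with the octahedral axiom. -/
@[ext]
structure Triangulation (C : Type u) [Category.{v} C] [Preadditive C] [HasZeroObject C]
    [HasBinaryBiproducts C] where
  dist : Set (Tri C)
  iso_mem : ∀ A B : Tri C, A.Isomorphic B → A ∈ dist → B ∈ dist
  id_mem : ∀ X : C, Tri.ofId X ∈ dist
  exists_mem : ∀ {X Y : C} (u : X ⟶ Y), ∃ (Z : C) (v : Y ⟶ Z) (w : Z ⟶ X)
    (uv : u ≫ v = 0) (vw : v ≫ w = 0) (wu : w ≫ u = 0),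
    (⟨X, Y, Z, u, v, w, uv, vw, wu⟩ : Tri C) ∈ dist
  translate_mem_iff : ∀ A : Tri C, A ∈ dist ↔ A.translate ∈ dist
  exists_mor : ∀ A B : Tri C, A ∈ dist → B ∈ dist →
    ∀ (f : A.X ⟶ B.X) (g : A.Y ⟶ B.Y), A.u ≫ g = f ≫ B.u →
      ∃ φ : Tri.Mor A B, φ.f = f ∧ φ.g = g ∧ Tri.cone φ ∈ dist

namespace Triangulation

variable {C : Type u} [Category.{v} C] [Preadditive C] [HasZeroObject C] [HasBinaryBiproducts C]

/-- `T` and `T'` are equivalent if, for some natural isomorphism `η : Id ∘ Σ ≅ Σ ∘ Id`, the pair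
`(Id, η)` is an isomorphism of triangulated categories from `(C, T)` to `(C, T')`: a triangle is
distinguished in `T` if and only if its image is distinguished in `T'`. -/
def Equivalent (T T' : Triangulation C) : Prop :=
  ∃ η : 𝟭 C ≅ 𝟭 C, ∀ A : Tri C, A ∈ T.dist ↔ A.twist η.hom ∈ T'.dist

/-- Equivalence of triangulations is an equivalence relation. -/
instance setoid : Setoid (Triangulation C) where
  r := Equivalent
  iseqv :=
    { refl := fun T => ⟨Iso.refl _, fun A => by
        rw [Iso.refl_hom, Tri.twist_id]⟩
      symm := by
        rintro T T' ⟨η, h⟩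
        refine ⟨η.symm, fun A => ?_⟩
        rw [h, Tri.twist_twist, Iso.symm_hom, Iso.inv_hom_id, Tri.twist_id]
      trans := by
        rintro T T' T'' ⟨η, h⟩ ⟨θ, h'⟩
        refine ⟨η ≪≫ θ, fun A => ?_⟩
        rw [h, h', Tri.twist_twist, Iso.trans_hom] }

end Triangulation

/-- The equivalence classes of triangulations of `C` with `Σ = Id`. -/
abbrev TriangulationClasses (C : Type u) [Category.{v} C] [Preadditive C] [HasZeroObject C]
    [HasBinaryBiproducts C] : Type _ :=
  Quotient (Triangulation.setoid (C := C))

end Triangles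

/-! ## Projective modules -/

section ProjectiveModules

variable (R : Type u) [Ring R]

/-- Index for the two categories considered: all projective left modules, or the finitely
generated ones. -/
inductive ProjKind
  | all
  | finitelyGenerated

/-- The property of a left `R`-module to be projective, resp. finitely generated projective. -/
def projProperty : ProjKind → ObjectProperty (ModuleCat.{u} R)
  | .all => fun M => Module.Projective R M
  | .finitelyGenerated => fun M => Module.Projective R M ∧ Module.Finite R M

/-- The category of (finitely generated) projective left `R`-modules. -/
abbrev ProjCat (k : ProjKind) : Type _ := (projProperty R k).FullSubcategory

theorem projProperty_punit (k : ProjKind) :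
    projProperty R k (ModuleCat.of R PUnit.{u + 1}) := by
  have h₁ : Module.Projective R PUnit.{u + 1} := inferInstance
  cases k with
  | all => exact h₁
  | finitelyGenerated => exact ⟨h₁, (inferInstance : Module.Finite R PUnit.{u + 1})⟩

theorem projProperty_prod (k : ProjKind) (M N : ModuleCat.{u} R)
    (hM : projProperty R k M) (hN : projProperty R k N) :
    projProperty R k (ModuleCat.of R (M × N)) := by
  cases k with
  | all =>
    have : Module.Projective R M := hM
    have : Module.Projective R N := hN
    exact (inferInstance : Module.Projective R (M × N))
  | finitelyGenerated =>
    obtain ⟨h₁, h₂⟩ := hM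
    obtain ⟨h₃, h₄⟩ := hN
    exact ⟨(inferInstance : Module.Projective R (M × N)),
      (inferInstance : Module.Finite R (M × N))⟩

instance (k : ProjKind) : (projProperty R k).ContainsZero where
  exists_zero := ⟨ModuleCat.of R PUnit.{u + 1}, ModuleCat.isZero_of_subsingleton _,
    projProperty_punit R k⟩

instance (k : ProjKind) : HasBinaryBiproducts (ProjCat R k) where
  has_binary_biproduct M N := by
    let P : ProjCat R k :=
      ⟨ModuleCat.of R (M.obj × N.obj), projProperty_prod R k _ _ M.property N.property⟩
    refine hasBinaryBiproduct_of_total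
      { pt := P
        fst := ObjectProperty.homMk (ModuleCat.ofHom (LinearMap.fst R M.obj N.obj))
        snd := ObjectProperty.homMk (ModuleCat.ofHom (LinearMap.snd R M.obj N.obj))
        inl := ObjectProperty.homMk (ModuleCat.ofHom (LinearMap.inl R M.obj N.obj))
        inr := ObjectProperty.homMk (ModuleCat.ofHom (LinearMap.inr R M.obj N.obj))
        inl_fst := by ext; rfl
        inl_snd := by ext; rfl
        inr_fst := by ext; rfl
        inr_snd := by ext; rfl } ?_
    apply ObjectProperty.hom_ext
    apply ModuleCat.hom_ext
    refine LinearMap.ext fun (x : M.obj × N.obj) => ?_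
    change ((x.1, 0) + (0, x.2) : M.obj × N.obj) = x
    simp

end ProjectiveModules

/-! ## Local rings -/

section LocalRings

variable (R : Type u) [Ring R]

/-- The maximal ideal `𝔪` of a (not necessarily commutative) local ring, as the Jacobson radical,
i.e. the intersection of all maximal left ideals. -/
abbrev maxIdeal : Ideal R := Ring.jacobson R

/-- The residue skew field `d = R / 𝔪`. -/
abbrev ResidueSkewField : Type u := R ⧸ maxIdeal R

/-- The residue class `[r]` in `d`. -/
abbrev toResidue : R →+* ResidueSkewField R := Ideal.Quotient.mk (maxIdeal R)

variable {R}

/-- In a local ring, `𝔪` is the set of nonunits. -/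
theorem mem_maxIdeal_iff [IsLocalRing R] (a : R) : a ∈ maxIdeal R ↔ ¬ IsUnit a := by
  constructor
  · intro ha hu
    have h1 : maxIdeal R = ⊤ := Ideal.eq_top_of_isUnit_mem _ ha hu
    exact (Ring.jacobson_lt_top R).ne h1
  · intro ha
    have key : ∀ b : R, ¬ IsUnit (b * a) := by
      rintro b ⟨c, hc⟩
      have hl : ((c⁻¹ : Rˣ) : R) * b * a = 1 := by
        rw [mul_assoc, ← hc, Units.inv_mul]
      set e : R := (c⁻¹ : Rˣ) * b with he
      have hi : (a * e) * (a * e) = a * e := by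
        rw [mul_assoc, ← mul_assoc e, hl, one_mul]
      rcases IsLocalRing.isUnit_or_isUnit_of_add_one
        (show a * e + (1 - a * e) = 1 by abel) with h | h
      · have h1 : a * e = 1 := h.mul_left_cancel (by rw [hi, mul_one])
        exact ha ⟨⟨a, e, h1, hl⟩, rfl⟩
      · have h1 : a * e = 0 := h.mul_left_cancel (by
          rw [mul_zero, sub_mul, one_mul, hi, sub_self])
        have h2 : a = 0 := by
          calc a = a * (e * a) := by rw [hl, mul_one]
            _ = 0 := by rw [← mul_assoc, h1, zero_mul]
        rw [h2, mul_zero] at hl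
        exact zero_ne_one hl
    rw [maxIdeal, ← Ideal.jacobson_bot, Ideal.mem_jacobson_iff]
    intro y
    rcases IsLocalRing.isUnit_or_isUnit_of_add_one
        (show -y * a + (1 + y * a) = 1 by rw [neg_mul]; abel) with h | h
    · exact absurd h (key _)
    · obtain ⟨c, hc⟩ := h
      refine ⟨((c⁻¹ : Rˣ) : R), ?_⟩
      have : ((c⁻¹ : Rˣ) : R) * (1 + y * a) = 1 := by rw [← hc, Units.inv_mul]
      rw [mul_add, mul_one] at this
      rw [Ideal.mem_bot, mul_assoc, add_comm, this, sub_self]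

/-- `𝔪` is the unique maximal left ideal of a local ring. -/
theorem isMaximal_iff_eq_maxIdeal [IsLocalRing R] (I : Ideal R) :
    I.IsMaximal ↔ I = maxIdeal R := by
  have hne : maxIdeal R ≠ ⊤ := (Ring.jacobson_lt_top R).ne
  have hle : ∀ J : Ideal R, J ≠ ⊤ → J ≤ maxIdeal R := fun J hJ a ha =>
    (mem_maxIdeal_iff a).2 fun hu => hJ (Ideal.eq_top_of_isUnit_mem _ ha hu)
  constructor
  · intro hI
    exact hI.eq_of_le hne (hle I hI.ne_top)
  · rintro rfl
    exact ⟨hne, fun J hJ => by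
      by_contra h
      exact absurd (hle J h) (not_le_of_gt hJ)⟩

variable (R)

/-- The conditions `𝔪² = 0`, and `𝔪 = Rx = xR` for all `x ∈ 𝔪 \ {0}`. -/
structure RadicalConditions : Prop where
  mul_eq_zero : ∀ a ∈ maxIdeal R, ∀ b ∈ maxIdeal R, a * b = 0
  eq_left : ∀ x ∈ maxIdeal R, x ≠ 0 → (maxIdeal R : Set R) = Set.range fun r : R => r * x
  eq_right : ∀ x ∈ maxIdeal R, x ≠ 0 → (maxIdeal R : Set R) = Set.range fun r : R => x * r

variable {R}

namespace RadicalConditions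

theorem exists_mul_eq (hR : RadicalConditions R) {x : R} (hx : x ∈ maxIdeal R) (hx0 : x ≠ 0)
    (t : R) : ∃ s : R, s * x = x * t := by
  have h : x * t ∈ (maxIdeal R : Set R) := Ideal.mul_mem_right t _ hx
  rw [hR.eq_left x hx hx0] at h
  exact h

theorem exists_mul_eq' (hR : RadicalConditions R) {x : R} (hx : x ∈ maxIdeal R) (hx0 : x ≠ 0)
    (s : R) : ∃ t : R, x * t = s * x := by
  have h : s * x ∈ (maxIdeal R : Set R) := Ideal.mul_mem_left _ s hx
  rw [hR.eq_right x hx hx0] at h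
  exact h

theorem mul_right_eq_zero_iff [IsLocalRing R] (hR : RadicalConditions R) {x : R}
    (hx : x ∈ maxIdeal R) (hx0 : x ≠ 0) (t : R) : x * t = 0 ↔ toResidue R t = 0 := by
  rw [Ideal.Quotient.eq_zero_iff_mem]
  refine ⟨fun h => ?_, fun h => hR.mul_eq_zero x hx t h⟩
  rw [mem_maxIdeal_iff]
  intro hu
  exact hx0 (hu.mul_left_eq_zero.1 h)

theorem mul_left_eq_zero_iff [IsLocalRing R] (hR : RadicalConditions R) {x : R}
    (hx : x ∈ maxIdeal R) (hx0 : x ≠ 0) (t : R) : t * x = 0 ↔ toResidue R t = 0 := by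
  rw [Ideal.Quotient.eq_zero_iff_mem]
  refine ⟨fun h => ?_, fun h => hR.mul_eq_zero t h x hx⟩
  rw [mem_maxIdeal_iff]
  intro hu
  exact hx0 (hu.mul_right_eq_zero.1 h)

theorem mul_left_eq_iff [IsLocalRing R] (hR : RadicalConditions R) {x : R}
    (hx : x ∈ maxIdeal R) (hx0 : x ≠ 0) (s t : R) :
    s * x = t * x ↔ toResidue R s = toResidue R t := by
  rw [← sub_eq_zero, ← sub_mul, hR.mul_left_eq_zero_iff hx hx0, map_sub, sub_eq_zero]

theorem mul_right_eq_iff [IsLocalRing R] (hR : RadicalConditions R) {x : R}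
    (hx : x ∈ maxIdeal R) (hx0 : x ≠ 0) (s t : R) :
    x * s = x * t ↔ toResidue R s = toResidue R t := by
  rw [← sub_eq_zero, ← mul_sub, hR.mul_right_eq_zero_iff hx hx0, map_sub, sub_eq_zero]

/-- For `x ∈ 𝔪 \ {0}`, the ring homomorphism `R → d` sending `t` to the class of any `s` with
`s x = x t`. -/
def sigmaLift [IsLocalRing R] (hR : RadicalConditions R) {x : R} (hx : x ∈ maxIdeal R)
    (hx0 : x ≠ 0) : R →+* ResidueSkewField R where
  toFun t := toResidue R (hR.exists_mul_eq hx hx0 t).choose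
  map_one' := by
    rw [← map_one (toResidue R), ← hR.mul_left_eq_iff hx hx0,
      (hR.exists_mul_eq hx hx0 1).choose_spec, mul_one, one_mul]
  map_zero' := by
    rw [← map_zero (toResidue R), ← hR.mul_left_eq_iff hx hx0,
      (hR.exists_mul_eq hx hx0 0).choose_spec, mul_zero, zero_mul]
  map_mul' a b := by
    rw [← map_mul, ← hR.mul_left_eq_iff hx hx0, (hR.exists_mul_eq hx hx0 (a * b)).choose_spec,
      mul_assoc, (hR.exists_mul_eq hx hx0 b).choose_spec, ← mul_assoc, ← mul_assoc,
      (hR.exists_mul_eq hx hx0 a).choose_spec]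
  map_add' a b := by
    rw [← map_add, ← hR.mul_left_eq_iff hx hx0, (hR.exists_mul_eq hx hx0 (a + b)).choose_spec,
      add_mul, (hR.exists_mul_eq hx hx0 b).choose_spec,
      (hR.exists_mul_eq hx hx0 a).choose_spec, mul_add]

theorem sigmaLift_eq_iff [IsLocalRing R] (hR : RadicalConditions R) {x : R}
    (hx : x ∈ maxIdeal R) (hx0 : x ≠ 0) (s t : R) :
    hR.sigmaLift hx hx0 t = toResidue R s ↔ x * t = s * x := by
  change toResidue R (hR.exists_mul_eq hx hx0 t).choose = _ ↔ _
  rw [← hR.mul_left_eq_iff hx hx0, (hR.exists_mul_eq hx hx0 t).choose_spec]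

/-- The automorphism `σ_x` of the residue skew field `d`, for `x ∈ 𝔪 \ {0}`. It is determined by
`x t = s x` for `t, s` lifts of `τ, σ_x(τ)`; see `sigma_eq_iff`. -/
def sigma [IsLocalRing R] (hR : RadicalConditions R) {x : R} (hx : x ∈ maxIdeal R)
    (hx0 : x ≠ 0) : ResidueSkewField R ≃+* ResidueSkewField R :=
  RingEquiv.ofBijective
    (Ideal.Quotient.lift (maxIdeal R) (hR.sigmaLift hx hx0) (fun a ha => by
      rw [← map_zero (toResidue R), hR.sigmaLift_eq_iff hx hx0, zero_mul,
        hR.mul_eq_zero x hx a ha]))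
    (by
      constructor
      · rw [injective_iff_map_eq_zero]
        intro τ hτ
        obtain ⟨t, rfl⟩ := Ideal.Quotient.mk_surjective τ
        rw [Ideal.Quotient.lift_mk, ← map_zero (toResidue R), hR.sigmaLift_eq_iff hx hx0,
          zero_mul, hR.mul_right_eq_zero_iff hx hx0] at hτ
        exact hτ
      · intro τ
        obtain ⟨s, rfl⟩ := Ideal.Quotient.mk_surjective τ
        obtain ⟨t, ht⟩ := hR.exists_mul_eq' hx hx0 s
        exact ⟨toResidue R t, by
          rw [Ideal.Quotient.lift_mk, hR.sigmaLift_eq_iff hx hx0, ht]⟩)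

theorem sigma_eq_iff [IsLocalRing R] (hR : RadicalConditions R) {x : R}
    (hx : x ∈ maxIdeal R) (hx0 : x ≠ 0) (s t : R) :
    hR.sigma hx hx0 (toResidue R t) = toResidue R s ↔ x * t = s * x :=
  hR.sigmaLift_eq_iff hx hx0 s t

/-- The subfield `Z(d)^{σ_x}` of fixed points of `σ_x` in the center of `d`. -/
def fixedCenter [IsLocalRing R] (hR : RadicalConditions R) {x : R} (hx : x ∈ maxIdeal R)
    (hx0 : x ≠ 0) : Subring (Subring.center (ResidueSkewField R)) :=
  RingHom.eqLocus
    ((hR.sigma hx hx0 : ResidueSkewField R →+* ResidueSkewField R).comp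
      (Subring.center (ResidueSkewField R)).subtype)
    (Subring.center (ResidueSkewField R)).subtype

end RadicalConditions

/-! ### The residue field of the center -/

theorem isUnit_center_of_isUnit (a : Subring.center R) (h : IsUnit (a : R)) : IsUnit a := by
  obtain ⟨c, hc⟩ := h
  have hmem : ((c⁻¹ : Rˣ) : R) ∈ Subring.center R := by
    rw [Subring.mem_center_iff]
    intro g
    have ha := Subring.mem_center_iff.1 a.2 g
    rw [← hc] at ha
    rw [Units.eq_inv_mul_iff_mul_eq, ← mul_assoc, ← ha, mul_assoc, Units.mul_inv, mul_one]
  refine IsUnit.of_mul_eq_one ⟨_, hmem⟩ ?_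
  ext
  change (a : R) * ((c⁻¹ : Rˣ) : R) = 1
  rw [← hc, Units.mul_inv]

/-- The center of a local ring is local. -/
instance center_isLocalRing [IsLocalRing R] : IsLocalRing (Subring.center R) where
  isUnit_or_isUnit_of_add_one {a b} h := by
    have h' : (a : R) + (b : R) = 1 := congrArg Subtype.val h
    exact (IsLocalRing.isUnit_or_isUnit_of_add_one h').imp
      (isUnit_center_of_isUnit a) (isUnit_center_of_isUnit b)

variable (R)

/-- The residue field `d'` of the center `Z(R)` of a local ring `R`. -/
abbrev CenterResidueField [IsLocalRing R] : Type u :=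
  IsLocalRing.ResidueField (Subring.center R)

/-- The embedding `d' → Z(d)` induced by the inclusion `Z(R) → R`. -/
def centerResidueMap [IsLocalRing R] :
    CenterResidueField R →+* Subring.center (ResidueSkewField R) :=
  Ideal.Quotient.lift (IsLocalRing.maximalIdeal (Subring.center R))
    (((toResidue R).comp (Subring.center R).subtype).codRestrict
      (Subring.center (ResidueSkewField R)) (fun c => by
        rw [Subring.mem_center_iff]
        intro g
        obtain ⟨t, rfl⟩ := Ideal.Quotient.mk_surjective g
        have := Subring.mem_center_iff.1 c.2 t
        change toResidue R t * toResidue R c = toResidue R c * toResidue R t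
        rw [← map_mul, ← map_mul, this]))
    (fun c hc => by
      ext
      change toResidue R c = 0
      rw [Ideal.Quotient.eq_zero_iff_mem, mem_maxIdeal_iff]
      exact fun h => hc (isUnit_center_of_isUnit c h))

variable {R}

/-- The embedding `d' → Z(d)^{σ_x}` induced by the inclusion `Z(R) → R`. -/
def RadicalConditions.centerResidueMapFixed [IsLocalRing R] (hR : RadicalConditions R) {x : R}
    (hx : x ∈ maxIdeal R) (hx0 : x ≠ 0) :
    CenterResidueField R →+* hR.fixedCenter hx hx0 :=
  (centerResidueMap R).codRestrict (hR.fixedCenter hx hx0) (fun c => by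
    obtain ⟨c, rfl⟩ := Ideal.Quotient.mk_surjective c
    change hR.sigma hx hx0 (toResidue R c) = toResidue R c
    rw [hR.sigma_eq_iff hx hx0]
    exact Subring.mem_center_iff.1 c.2 x)

variable (R)

/-- The group `Z(d)^× / d'^×`. -/
abbrev CenterUnitsQuotient [IsLocalRing R] : Type u :=
  (Subring.center (ResidueSkewField R))ˣ ⧸
    (Units.map (centerResidueMap R : CenterResidueField R →* _)).range

variable {R}

/-- The group `(Z(d)^{σ_x})^× / d'^×`. -/
abbrev RadicalConditions.FixedCenterUnitsQuotient [IsLocalRing R] (hR : RadicalConditions R)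
    {x : R} (hx : x ∈ maxIdeal R) (hx0 : x ≠ 0) : Type u :=
  (hR.fixedCenter hx hx0)ˣ ⧸
    (Units.map (hR.centerResidueMapFixed hx hx0 : CenterResidueField R →* _)).range

end LocalRings

/-! ## The triangulations `Δ^r` -/

section Delta

variable {R : Type u} [Ring R]

/-- Right multiplication by `a` on the free left module `R^(ι)`. -/
def mulRightFree (ι : Type u) (a : R) : (ι →₀ R) →ₗ[R] (ι →₀ R) :=
  Finsupp.mapRange.linearMap (LinearMap.toSpanSingleton R R a)

theorem mulRightFree_apply (ι : Type u) (a : R) (m : ι →₀ R) (i : ι) :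
    mulRightFree ι a m i = m i * a := rfl

theorem mulRightFree_comp (ι : Type u) (a b : R) :
    mulRightFree ι b ∘ₗ mulRightFree ι a = mulRightFree ι (a * b) := by
  ext
  simp [mulRightFree]

theorem mulRightFree_zero (ι : Type u) : mulRightFree ι (0 : R) = 0 := by
  ext
  simp [mulRightFree]

/-- The triangle `M ⟶ M ⟶ M ⟶ M` on the free module `M = R^(ι)` whose maps are right
multiplication by `x`, `x` and `ρ x`, i.e. a direct sum of copies of
`R ⟶ R ⟶ R ⟶ R`. -/
def deltaTri (hR : RadicalConditions R) (k : ProjKind) {x : R} (hx : x ∈ maxIdeal R) (ρ : R)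
    (ι : Type u) (hι : projProperty R k (ModuleCat.of R (ι →₀ R))) : Tri (ProjCat R k) where
  X := ⟨ModuleCat.of R (ι →₀ R), hι⟩
  Y := ⟨ModuleCat.of R (ι →₀ R), hι⟩
  Z := ⟨ModuleCat.of R (ι →₀ R), hι⟩
  u := ObjectProperty.homMk (ModuleCat.ofHom (mulRightFree ι x))
  v := ObjectProperty.homMk (ModuleCat.ofHom (mulRightFree ι x))
  w := ObjectProperty.homMk (ModuleCat.ofHom (mulRightFree ι (ρ * x)))
  uv := by
    apply ObjectProperty.hom_ext
    apply ModuleCat.hom_ext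
    change mulRightFree ι x ∘ₗ mulRightFree ι x = 0
    rw [mulRightFree_comp, hR.mul_eq_zero x hx x hx, mulRightFree_zero]
  vw := by
    apply ObjectProperty.hom_ext
    apply ModuleCat.hom_ext
    change mulRightFree ι (ρ * x) ∘ₗ mulRightFree ι x = 0
    rw [mulRightFree_comp, hR.mul_eq_zero x hx _ (Ideal.mul_mem_left _ ρ hx), mulRightFree_zero]
  wu := by
    apply ObjectProperty.hom_ext
    apply ModuleCat.hom_ext
    change mulRightFree ι x ∘ₗ mulRightFree ι (ρ * x) = 0
    rw [mulRightFree_comp, hR.mul_eq_zero _ (Ideal.mul_mem_left _ ρ hx) x hx, mulRightFree_zero]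

/-- The class of triangles isomorphic to a direct sum of a contractible triangle and copies of
the triangle `R ⟶ R ⟶ R ⟶ R` with maps right multiplication by `x`, `x`, `ρ x` (finitely many
copies if only finitely generated modules are considered). -/
def deltaClass (hR : RadicalConditions R) (k : ProjKind) {x : R} (hx : x ∈ maxIdeal R) (ρ : R) :
    Set (Tri (ProjCat R k)) :=
  {A | ∃ (B : Tri (ProjCat R k)) (ι : Type u)
    (hι : projProperty R k (ModuleCat.of R (ι →₀ R))),
    B.Contractible ∧ (B.sum (deltaTri hR k hx ρ ι hι)).Isomorphic A}

/-- `T` is the triangulation `Δ^r`, `r ∈ d`, with respect to `x ∈ 𝔪`: its distinguished triangles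
are those generated by `R ⟶ R ⟶ R ⟶ R`, with maps right multiplication by `x`, `x`, `ρ x`, where
`ρ` is a lift of `r`. (Since `𝔪 x = 0`, the choice of the lift is irrelevant.) -/
def IsDelta (hR : RadicalConditions R) (k : ProjKind) {x : R} (hx : x ∈ maxIdeal R)
    (r : ResidueSkewField R) (T : Triangulation (ProjCat R k)) : Prop :=
  ∃ ρ : R, toResidue R ρ = r ∧ T.dist = deltaClass hR k hx ρ

/-- The mixed-characteristic case: `𝔪 = 2R` and `𝔪 ≠ 0`. -/
structure MixedCharacteristic (R : Type u) [Ring R] : Prop where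
  eq_two_mul : (maxIdeal R : Set R) = Set.range fun r : R => 2 * r
  ne_bot : maxIdeal R ≠ ⊥

theorem MixedCharacteristic.two_mem (h : MixedCharacteristic R) : (2 : R) ∈ maxIdeal R := by
  have : (2 : R) ∈ (maxIdeal R : Set R) := by
    rw [h.eq_two_mul]
    exact ⟨1, mul_one 2⟩
  exact this

/-- The conditions `r ≠ 0`, `σ_x(r) = r` and `σ_x³(t) = r⁻¹ t r` for all `t ∈ d`, on a unit `r` of
the skew field `d`. -/
structure RadicalConditions.IsAdmissible [IsLocalRing R] (hR : RadicalConditions R) {x : R}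
    (hx : x ∈ maxIdeal R) (hx0 : x ≠ 0) (r : (ResidueSkewField R)ˣ) : Prop where
  fixed : hR.sigma hx hx0 (r : ResidueSkewField R) = r
  cube : ∀ t : ResidueSkewField R,
    hR.sigma hx hx0 (hR.sigma hx hx0 (hR.sigma hx hx0 t)) = (r⁻¹ : (ResidueSkewField R)ˣ) * t * r

end Delta

end

/-!
The triangulations `Δ^r` are defined by generators. The proof replaces this definition by an
intrinsic one, in terms of elements. Fix `x ∈ 𝔪 \ {0}` and a lift `ρ` of `r`. On a projective
module `𝔪 M = x M` is the annihilator of `x` (`IsRadicalGenerator.mem_of_smul_eq_zero`), so in an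
exact triangle `X ⟶ Y ⟶ Z ⟶ X` any `p` with `u p ∈ 𝔪 Y` can be continued to a chain `u p = x q`,
`v q = x s`, `w s = x p'`, in which `p'` is determined by `p` modulo `𝔪 X` and the image of `w`. In
the triangle `(x, x, ρ x)` on `R`, the element `1` leads to `ρ`. A triangle is called distinguished
(`IsDistinguished`) if it is exact and every chain from `p` leads to `ρ p`. The conditions
`σ_x(r) = r` and `σ_x³(t) = r⁻¹ t r` (`IsAdmissiblePair`) say that this requirement is compatible
with rotation and with scalar multiplication.

*These triangles form a triangulation.* Projective modules are injective, since `R` has only one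
proper nonzero left ideal (`IsRadicalGenerator.baer`). Hence a commutative square between the first
maps of two triangles extends to a map `h₁` of their third objects satisfying one of the two
compatibilities, and the chain condition is exactly what allows `h₁` to be corrected to satisfy
the other (`IsDistinguished.exists_fill`). The fill-in is unique only up to maps `ε ∘ w` with
`w' ∘ ε = κ ∘ u`; such a change alters the chain condition of the mapping cone by `ρ κ`, and as `ρ`
is a unit, a suitable `κ` makes the cone distinguished (`IsDistinguished.exists_fill_cone`).
Invariance under rotation involves the sign `-1`, which is harmless because `2 ∈ 𝔪`. Every map of
projective modules is isomorphic to a sum of a split map and a multiplication by `x`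
(`IsRadicalGenerator.exists_normal_form`). This gives the existence of cones, and, as the fill-in
makes the cone of a map unique, also that the distinguished triangles are those generated by
`(x, x, ρ x)` (`deltaClass_eq`).

*Every triangulation arises in this way.* Since `R` corepresents the underlying set, distinguished
triangles are exact, so the cone of `x : R ⟶ R` is `R` and the triangle on it is `(x, x, ρ x)` for a
unit `ρ` (`Triangulation.exists_regTri_mem`). Comparing this triangle with its translate gives
`x ρ = -ρ x`, and comparing it with itself along the square given by `t` and `σ_x(t)` gives the
condition on `σ_x³`. Mapping `(x, x, ρ x)` into a distinguished triangle proves the chain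
condition, and uniqueness of cones proves equality (`Triangulation.dist_eq_distinguishedClass`).

*Equivalence.* The endomorphisms of the identity functor are the multiplications by central
elements, and twisting by a central unit `c` replaces `ρ` by `c ρ`. So `Δ^r` and `Δ^{r'}` are
equivalent iff `r' = c r` for the class `c ∈ d'` of a central unit (`Triangulation.equivalent_iff`).
What remains is to describe the admissible `r`: for `x = 2` they are the elements of `Z(d)^×`, and
in equal characteristic they form a coset of `(Z(d)^{σ_x})^×`.

In the commutative case with `𝔪 ≠ 0` the relation `x ρ = -ρ x` forces `2 ∈ 𝔪`, so that the criterion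
for equivalence applies, and the central unit `ρ' ρ⁻¹` relates any two triangulations. If `𝔪 = 0`,
then `R` is a field and exactness determines the distinguished triangles.
-/


/-! ### The radical of a module -/

section Radical

variable {R : Type u} [Ring R]

/-- A nonzero element `x` of the maximal ideal of a ring satisfying `RadicalConditions`; it
generates the maximal ideal from both sides. -/
structure IsRadicalGenerator (x : R) : Prop where
  cond : RadicalConditions R
  mem : x ∈ maxIdeal R
  ne_zero : x ≠ 0

/-- The submodule `𝔪 M` of a left module `M`. -/
abbrev radSubmodule (R : Type u) [Ring R] (M : Type*) [AddCommGroup M] [Module R M] :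
    Submodule R M :=
  maxIdeal R • (⊤ : Submodule R M)

namespace IsRadicalGenerator

variable {x : R} (hx : IsRadicalGenerator x)
include hx

theorem mul_self : x * x = 0 := hx.cond.mul_eq_zero x hx.mem x hx.mem

theorem exists_eq_mul {a : R} (ha : a ∈ maxIdeal R) : ∃ r, a = x * r := by
  have h : a ∈ (maxIdeal R : Set R) := ha
  rw [hx.cond.eq_right x hx.mem hx.ne_zero] at h
  obtain ⟨r, hr⟩ := h
  exact ⟨r, hr.symm⟩

theorem exists_mul_comm (t : R) : ∃ t', t * x = x * t' := by
  obtain ⟨t', h⟩ := hx.cond.exists_mul_eq' hx.mem hx.ne_zero t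
  exact ⟨t', h.symm⟩

theorem exists_comm_mul (t : R) : ∃ t', t' * x = x * t :=
  hx.cond.exists_mul_eq hx.mem hx.ne_zero t

theorem mul_eq_zero_iff [IsLocalRing R] (t : R) : x * t = 0 ↔ t ∈ maxIdeal R := by
  rw [hx.cond.mul_right_eq_zero_iff hx.mem hx.ne_zero, Ideal.Quotient.eq_zero_iff_mem]

theorem eq_zero_mul_iff [IsLocalRing R] (t : R) : t * x = 0 ↔ t ∈ maxIdeal R := by
  rw [hx.cond.mul_left_eq_zero_iff hx.mem hx.ne_zero, Ideal.Quotient.eq_zero_iff_mem]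

variable {M : Type*} [AddCommGroup M] [Module R M]

theorem smul_smul (y : M) : x • x • y = 0 := by
  rw [← mul_smul, hx.mul_self, zero_smul]

theorem exists_smul_comm (t : R) : ∃ t' : R, ∀ y : M, t • x • y = x • t' • y := by
  obtain ⟨t', h⟩ := hx.exists_mul_comm t
  exact ⟨t', fun y => by rw [← mul_smul, h, mul_smul]⟩

theorem mem_radSubmodule_iff {a : M} : a ∈ radSubmodule R M ↔ ∃ y, a = x • y := by
  constructor
  · intro h
    refine Submodule.smul_induction_on h ?_ ?_
    · intro r hr n _
      obtain ⟨s, rfl⟩ := hx.exists_eq_mul hr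
      exact ⟨s • n, mul_smul _ _ _⟩
    · rintro _ _ ⟨y, rfl⟩ ⟨z, rfl⟩
      exact ⟨y + z, (smul_add _ _ _).symm⟩
  · rintro ⟨y, rfl⟩
    exact Submodule.smul_mem_smul hx.mem trivial

theorem smul_mem (y : M) : x • y ∈ radSubmodule R M := hx.mem_radSubmodule_iff.2 ⟨y, rfl⟩

theorem smul_eq_zero_of_mem {a : M} (h : a ∈ radSubmodule R M) : x • a = 0 := by
  obtain ⟨y, rfl⟩ := hx.mem_radSubmodule_iff.1 h
  exact hx.smul_smul y

theorem map_mem {N : Type*} [AddCommGroup N] [Module R N] (f : M →ₗ[R] N) {a : M}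
    (h : a ∈ radSubmodule R M) : f a ∈ radSubmodule R N := by
  obtain ⟨y, rfl⟩ := hx.mem_radSubmodule_iff.1 h
  rw [map_smul]
  exact hx.smul_mem _

/-- On a projective module the annihilator of `x` is `𝔪 M`: this holds coordinatewise on a free
module, and a projective module is a retract of a free one. -/
theorem mem_of_smul_eq_zero [IsLocalRing R] [Module.Projective R M] {y : M} (h : x • y = 0) :
    y ∈ radSubmodule R M := by
  obtain ⟨s, hs⟩ := (Module.projective_def' (R := R) (P := M)).1 inferInstance
  have hy : Finsupp.linearCombination R id (s y) = y := LinearMap.congr_fun hs y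
  have hc : ∀ i, s y i ∈ maxIdeal R := fun i => by
    rw [← hx.mul_eq_zero_iff]
    have : (x • s y) i = 0 := by rw [← map_smul, h, map_zero]; rfl
    exact this
  rw [← hy, Finsupp.linearCombination_apply]
  exact Submodule.sum_mem _ fun i _ => Submodule.smul_mem_smul (hc i) trivial

theorem sub_mem_of_smul_eq [IsLocalRing R] [Module.Projective R M] {y z : M}
    (h : x • y = x • z) : y - z ∈ radSubmodule R M :=
  hx.mem_of_smul_eq_zero (by rw [smul_sub, h, sub_self])

/-- Projective modules are injective: by Baer's criterion it suffices to extend maps from the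
only nontrivial left ideal `R x`, and such a map sends `x` to a multiple `x y`. -/
theorem baer [IsLocalRing R] [Module.Projective R M] : Module.Baer R M := by
  intro I g
  by_cases hI : I = ⊤
  · subst hI
    exact ⟨LinearMap.toSpanSingleton R M (g ⟨1, trivial⟩), fun r hr => by
      rw [LinearMap.toSpanSingleton_apply, ← map_smul]
      congr 1
      ext
      exact mul_one r⟩
  have hle : I ≤ maxIdeal R := fun a ha =>
    (mem_maxIdeal_iff a).2 fun hu => hI (Ideal.eq_top_of_isUnit_mem _ ha hu)
  by_cases hxI : x ∈ I
  · have h0 : x • g ⟨x, hxI⟩ = 0 := by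
      rw [← map_smul, show x • (⟨x, hxI⟩ : I) = 0 from Subtype.ext hx.mul_self, map_zero]
    obtain ⟨y, hy⟩ := hx.mem_radSubmodule_iff.1 (hx.mem_of_smul_eq_zero h0)
    refine ⟨LinearMap.toSpanSingleton R M y, fun r hr => ?_⟩
    have hr' : r ∈ (maxIdeal R : Set R) := hle hr
    rw [hx.cond.eq_left x hx.mem hx.ne_zero] at hr'
    obtain ⟨t, rfl⟩ := hr'
    rw [LinearMap.toSpanSingleton_apply, mul_smul, ← hy, ← map_smul]
    rfl
  · have hz : ∀ r ∈ I, r = 0 := by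
      intro r hr
      by_contra hr0
      apply hxI
      have h : x ∈ (maxIdeal R : Set R) := hx.mem
      rw [hx.cond.eq_left r (hle hr) hr0] at h
      obtain ⟨t, rfl⟩ := h
      exact I.mul_mem_left t hr
    refine ⟨0, fun r hr => ?_⟩
    rw [show (⟨r, hr⟩ : I) = 0 from Subtype.ext (hz r hr), map_zero, LinearMap.zero_apply]

end IsRadicalGenerator

/-- A linear map to a Baer-injective module that vanishes on the kernel of `w` factors
through `w`. -/
theorem Module.Baer.exists_comp_eq {Q Z X : Type*} [AddCommGroup Q] [Module R Q] [AddCommGroup Z]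
    [Module R Z] [AddCommGroup X] [Module R X] (hQ : Module.Baer R Q) (w : Z →ₗ[R] X)
    (e : Z →ₗ[R] Q) (h : ∀ z, w z = 0 → e z = 0) : ∃ f : X →ₗ[R] Q, ∀ z, f (w z) = e z := by
  have hle : LinearMap.ker w ≤ LinearMap.ker e := fun z hz => h z hz
  obtain ⟨f, hf⟩ := hQ.extension_property ((LinearMap.ker w).liftQ w le_rfl)
    (LinearMap.ker_eq_bot.1 (Submodule.ker_liftQ_eq_bot _ _ _ le_rfl))
    ((LinearMap.ker w).liftQ e hle)
  exact ⟨f, fun z => LinearMap.congr_fun hf (Submodule.Quotient.mk z)⟩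

end Radical

/-! ### Bases adapted to a flag of submodules -/

section Bases

variable {R : Type u} [Ring R] {x : R} {M : Type*} [AddCommGroup M] [Module R M]

theorem exists_mem_span_of_mk_mem_span {S : Set M} {a : M}
    (h : (Submodule.Quotient.mk a : M ⧸ radSubmodule R M) ∈
      Submodule.span (ResidueSkewField R)
        ((fun m => (Submodule.Quotient.mk m : M ⧸ radSubmodule R M)) '' S)) :
    ∃ c ∈ Submodule.span R S, a - c ∈ radSubmodule R M := by
  suffices H : ∀ b : M ⧸ radSubmodule R M, b ∈ Submodule.span (ResidueSkewField R)
      ((fun m => (Submodule.Quotient.mk m : M ⧸ radSubmodule R M)) '' S) →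
      ∃ c ∈ Submodule.span R S, b = Submodule.Quotient.mk c by
    obtain ⟨c, hc, h⟩ := H _ h
    exact ⟨c, hc, (Submodule.Quotient.eq _).1 h⟩
  intro b hb
  induction hb using Submodule.span_induction with
  | mem b hb =>
    obtain ⟨c, hc, rfl⟩ := hb
    exact ⟨c, Submodule.subset_span hc, rfl⟩
  | zero => exact ⟨0, Submodule.zero_mem _, rfl⟩
  | add b b' _ _ hb hb' =>
    obtain ⟨c, hc, rfl⟩ := hb
    obtain ⟨c', hc', rfl⟩ := hb'
    exact ⟨c + c', Submodule.add_mem _ hc hc', rfl⟩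
  | smul t b _ hb =>
    obtain ⟨c, hc, rfl⟩ := hb
    obtain ⟨t, rfl⟩ := Ideal.Quotient.mk_surjective t
    exact ⟨t • c, Submodule.smul_mem _ _ hc, rfl⟩

variable [IsLocalRing R]

/-- The residue ring `d` of a local ring is a skew field. -/
noncomputable abbrev residueDivisionRing (R : Type u) [Ring R] [IsLocalRing R] :
    DivisionRing (ResidueSkewField R) :=
  haveI : Nontrivial (ResidueSkewField R) :=
    Ideal.Quotient.nontrivial_iff.2 (Ring.jacobson_lt_top R).ne
  DivisionRing.ofIsUnitOrEqZero fun a => by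
    obtain ⟨r, rfl⟩ := Ideal.Quotient.mk_surjective a
    by_cases h : r ∈ maxIdeal R
    · exact Or.inr (Ideal.Quotient.eq_zero_iff_mem.2 h)
    · rw [mem_maxIdeal_iff, not_not] at h
      exact Or.inl (h.map (toResidue R))

namespace IsRadicalGenerator

variable (hx : IsRadicalGenerator x)
include hx

/-- A map to a projective module is injective if it is so modulo the radical. -/
theorem injective_of_injective_mod {N : Type*} [AddCommGroup N] [Module R N]
    [Module.Projective R N] (φ : M →ₗ[R] N)
    (hinj : ∀ a, φ a ∈ radSubmodule R N → a ∈ radSubmodule R M) : Function.Injective φ := by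
  rw [injective_iff_map_eq_zero]
  intro a ha
  obtain ⟨b, rfl⟩ := hx.mem_radSubmodule_iff.1 (hinj a (by rw [ha]; exact Submodule.zero_mem _))
  rw [map_smul] at ha
  exact hx.smul_eq_zero_of_mem (hinj b (hx.mem_of_smul_eq_zero ha))

omit [IsLocalRing R] in
/-- Nakayama's lemma: a map is surjective if it is so modulo the radical. -/
theorem surjective_of_surjective_mod {N : Type*} [AddCommGroup N] [Module R N] (φ : M →ₗ[R] N)
    (hsurj : ∀ b, ∃ a, b - φ a ∈ radSubmodule R N) : Function.Surjective φ := by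
  intro b
  obtain ⟨a, ha⟩ := hsurj b
  obtain ⟨c, hc⟩ := hx.mem_radSubmodule_iff.1 ha
  obtain ⟨a', ha'⟩ := hsurj c
  refine ⟨a + x • a', ?_⟩
  have h := hx.smul_eq_zero_of_mem ha'
  rw [smul_sub, sub_eq_zero, ← hc] at h
  rw [map_add, map_smul, ← h]
  abel

/-- Elements that form a basis of `M / 𝔪 M` form a basis of the projective module `M`. -/
theorem exists_basis [Module.Projective R M] {S : Set M}
    (hS : LinearIndepOn (ResidueSkewField R)
      (fun m => (Submodule.Quotient.mk m : M ⧸ radSubmodule R M)) S)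
    (hspan : ∀ a : M, ∃ c ∈ Submodule.span R S, a - c ∈ radSubmodule R M) :
    ∃ b : Module.Basis S R M, ∀ i, b i = i := by
  have hbij : Function.Bijective (Finsupp.linearCombination R ((↑) : S → M)) := by
    refine ⟨hx.injective_of_injective_mod _ ?_, hx.surjective_of_surjective_mod _ ?_⟩
    · intro f hf
      have hS' := linearIndependent_iff'.1 hS f.support (fun i => toResidue R (f i)) (by
        rw [← Submodule.Quotient.mk_eq_zero, Finsupp.linearCombination_apply, Finsupp.sum,
          ← Submodule.mkQ_apply, map_sum] at hf
        exact hf)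
      choose g hg using fun i (hi : i ∈ f.support) =>
        hx.exists_eq_mul (Ideal.Quotient.eq_zero_iff_mem.1 (hS' i hi))
      have hf' : f = ∑ i ∈ f.support.attach, Finsupp.single (i : S) (f i) := by
        rw [Finset.sum_attach f.support fun i => Finsupp.single i (f i)]
        exact (Finsupp.sum_single f).symm
      rw [hf']
      refine Submodule.sum_mem _ fun i _ => ?_
      rw [hg i i.2, ← smul_eq_mul, ← Finsupp.smul_single]
      exact hx.smul_mem _
    · intro a
      obtain ⟨c, hc, h⟩ := hspan a
      obtain ⟨f, rfl⟩ := (Finsupp.mem_span_iff_linearCombination R S c).1 hc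
      exact ⟨f, h⟩
  refine ⟨Module.Basis.ofRepr (LinearEquiv.ofBijective _ hbij).symm, fun i => ?_⟩
  simp

/-- A projective module has a basis adapted, modulo `𝔪 M`, to a flag of submodules `N ≤ L`. -/
theorem exists_adapted_basis [Module.Projective R M] {N L : Submodule R M} (hNL : N ≤ L) :
    ∃ (S₀ S₁ S : Set M) (b : Module.Basis S R M), S₀ ⊆ S₁ ∧ S₁ ⊆ S ∧ S₀ ⊆ N ∧ S₁ ⊆ L ∧
      (∀ a ∈ N, ∃ c ∈ Submodule.span R S₀, a - c ∈ radSubmodule R M) ∧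
      (∀ a ∈ L, ∃ c ∈ Submodule.span R S₁, a - c ∈ radSubmodule R M) ∧
      LinearIndepOn (ResidueSkewField R)
        (fun m => (Submodule.Quotient.mk m : M ⧸ radSubmodule R M)) S ∧ ∀ i, b i = i := by
  let _ := residueDivisionRing R
  obtain ⟨S₀, h₀N, -, h₀, hi₀⟩ := exists_linearIndepOn_extension (K := ResidueSkewField R)
    (v := fun m => (Submodule.Quotient.mk m : M ⧸ radSubmodule R M))
    (linearIndepOn_empty _ _) (Set.empty_subset (N : Set M))
  obtain ⟨S₁, h₁L, h01, h₁, hi₁⟩ := exists_linearIndepOn_extension (t := (L : Set M)) hi₀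
    (h₀N.trans hNL)
  obtain ⟨S, -, h12, h₂, hi₂⟩ := exists_linearIndepOn_extension hi₁ (Set.subset_univ S₁)
  obtain ⟨b, hb⟩ := hx.exists_basis hi₂ fun a =>
    exists_mem_span_of_mk_mem_span (h₂ ⟨a, trivial, rfl⟩)
  exact ⟨S₀, S₁, S, b, h01, h12, h₀N, h₁L,
    fun a ha => exists_mem_span_of_mk_mem_span (h₀ ⟨a, ha, rfl⟩),
    fun a ha => exists_mem_span_of_mk_mem_span (h₁ ⟨a, ha, rfl⟩), hi₂, hb⟩

end IsRadicalGenerator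

end Bases

/-! ### Distinguished sequences of modules -/

section Sequences

variable {R : Type u} [Ring R]

/-- The elementwise form of the conditions on `r ∈ d` under which `Δ^r` is a triangulation, for a
lift `ρ` of `r`: `σ_x(r) = r` becomes `x ρ = ρ x`, and `r σ_x³(t) = t r` becomes `cube`. -/
structure IsAdmissiblePair (x ρ : R) : Prop where
  gen : IsRadicalGenerator x
  two_mem : (2 : R) ∈ maxIdeal R
  isUnit : IsUnit ρ
  comm : x * ρ = ρ * x
  cube : ∀ a b c : R, x * b = a * x → x * c = b * x → ρ * x * a = c * ρ * x

/-- In `t x = x t₁`, `t₁ x = x t₂`, `t₂ x = x t₃` the elements `ρ t` and `t₃ ρ` agree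
modulo `𝔪`. -/
theorem IsAdmissiblePair.exists_twists [IsLocalRing R] {x ρ : R} (h : IsAdmissiblePair x ρ)
    (t : R) : ∃ t₁ t₂ t₃ : R, t * x = x * t₁ ∧ t₁ * x = x * t₂ ∧ t₂ * x = x * t₃ ∧
      t₃ * ρ - ρ * t ∈ maxIdeal R := by
  obtain ⟨t₁, h₁⟩ := h.gen.exists_mul_comm t
  obtain ⟨t₂, h₂⟩ := h.gen.exists_mul_comm t₁
  obtain ⟨t₃, h₃⟩ := h.gen.exists_mul_comm t₂
  refine ⟨t₁, t₂, t₃, h₁, h₂, h₃, ?_⟩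
  rw [← h.gen.eq_zero_mul_iff, sub_mul, sub_eq_zero, ← h.cube t₁ t₂ t₃ h₂.symm h₃.symm,
    mul_assoc, mul_assoc, h₁]

variable {X Y Z X' Y' Z' : Type*} [AddCommGroup X] [Module R X] [AddCommGroup Y] [Module R Y]
  [AddCommGroup Z] [Module R Z] [AddCommGroup X'] [Module R X'] [AddCommGroup Y'] [Module R Y']
  [AddCommGroup Z'] [Module R Z']

/-- Exactness of the periodic sequence `X ⟶ Y ⟶ Z ⟶ X ⟶ Y`. -/
structure IsExactTriple (u : X →ₗ[R] Y) (v : Y →ₗ[R] Z) (w : Z →ₗ[R] X) : Prop where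
  uv : ∀ p, v (u p) = 0
  vw : ∀ q, w (v q) = 0
  wu : ∀ s, u (w s) = 0
  exact_X : ∀ p, u p = 0 → ∃ s, w s = p
  exact_Y : ∀ q, v q = 0 → ∃ p, u p = q
  exact_Z : ∀ s, w s = 0 → ∃ q, v q = s

theorem IsExactTriple.rotate {u : X →ₗ[R] Y} {v : Y →ₗ[R] Z} {w : Z →ₗ[R] X}
    (H : IsExactTriple u v w) : IsExactTriple v w (-u) where
  uv := H.vw
  vw s := by simp [H.wu]
  wu p := by simp [H.uv]
  exact_X q hq := by
    obtain ⟨p, rfl⟩ := H.exact_Y q hq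
    exact ⟨-p, by simp⟩
  exact_Y := H.exact_Z
  exact_Z p hp := H.exact_X p (by simpa using hp)

/-- `p ↦ q ↦ s ↦ p'` is a chain if `u p = x q`, `v q = x s` and `w s = x p'`. Lifting through
`x` in this way, a sequence `(u, v, w)` relates `p` to `p'`. -/
structure IsLiftChain (x : R) (u : X →ₗ[R] Y) (v : Y →ₗ[R] Z) (w : Z →ₗ[R] X) (p : X) (q : Y)
    (s : Z) (p' : X) : Prop where
  hu : u p = x • q
  hv : v q = x • s
  hw : w s = x • p'

/-- `p'` agrees with `ρ p` modulo `𝔪 X` and the image of `w`. -/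
def ReturnsTo (ρ : R) (w : Z →ₗ[R] X) (p p' : X) : Prop :=
  ∃ t, p' - (ρ • p + w t) ∈ radSubmodule R X

/-- The intrinsic form of membership in `Δ^r`: the sequence is exact, and every chain starting
from `p` leads to `ρ p`, up to its indeterminacy. -/
structure IsDistinguished (x ρ : R) (u : X →ₗ[R] Y) (v : Y →ₗ[R] Z) (w : Z →ₗ[R] X) : Prop
    extends IsExactTriple u v w where
  returns : ∀ p q s p', IsLiftChain x u v w p q s p' → ReturnsTo ρ w p p'

section Fill

variable {x ρ : R} {u : X →ₗ[R] Y} {v : Y →ₗ[R] Z} {w : Z →ₗ[R] X}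
  {u' : X' →ₗ[R] Y'} {v' : Y' →ₗ[R] Z'} {w' : Z' →ₗ[R] X'}

theorem IsExactTriple.exists_isLiftChain_of_snd
    (H : IsExactTriple u v w) (hx : IsRadicalGenerator x) {s : Z} {p' : X}
    (h : w s = x • p') : ∃ p q, IsLiftChain x u v w p q s p' := by
  obtain ⟨q, hq⟩ := H.exact_Z (x • s) (by rw [map_smul, h, hx.smul_smul])
  obtain ⟨p, hp⟩ := H.exact_Y (x • q) (by rw [map_smul, hq, hx.smul_smul])
  exact ⟨p, q, hp, hq, h⟩

variable [IsLocalRing R]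

theorem IsExactTriple.exists_isLiftChain [Module.Projective R X] [Module.Projective R Y]
    [Module.Projective R Z] (H : IsExactTriple u v w) (hx : IsRadicalGenerator x) {p : X} {q : Y}
    (h : u p = x • q) : ∃ s p', IsLiftChain x u v w p q s p' := by
  have h₁ : x • v q = 0 := by rw [← map_smul, ← h, H.uv]
  obtain ⟨s, hs⟩ := hx.mem_radSubmodule_iff.1 (hx.mem_of_smul_eq_zero h₁)
  have h₂ : x • w s = 0 := by rw [← map_smul, ← hs, H.vw]
  obtain ⟨p', hp'⟩ := hx.mem_radSubmodule_iff.1 (hx.mem_of_smul_eq_zero h₂)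
  exact ⟨s, p', h, hs, hp'⟩

/-- A commutative square between the first maps of two distinguished sequences extends to a
morphism. Extending along `v` by injectivity makes the second square commute; the defect `e` of
the third one factors as `ε ∘ w`. The chain conditions on both sequences say precisely that `ε` can
be lifted through `w'` on the image of `w`, which is done on an adapted basis. -/
theorem IsDistinguished.exists_fill [Module.Projective R X] [Module.Projective R Y]
    [Module.Projective R X'] [Module.Projective R Y'] [Module.Projective R Z']
    (hx : IsRadicalGenerator x) (H : IsDistinguished x ρ u v w) (H' : IsDistinguished x ρ u' v' w')
    (f : X →ₗ[R] X') (g : Y →ₗ[R] Y') (hfg : ∀ p, g (u p) = u' (f p)) :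
    ∃ h : Z →ₗ[R] Z', (∀ q, h (v q) = v' (g q)) ∧ ∀ s, w' (h s) = f (w s) := by
  obtain ⟨h₁, hh₁⟩ := (hx.baer (M := Z')).exists_comp_eq v (v' ∘ₗ g) (fun q hq => by
    obtain ⟨p, rfl⟩ := H.exact_Y q hq
    rw [LinearMap.comp_apply, hfg, H'.uv])
  obtain ⟨ε, hε⟩ := (hx.baer (M := X')).exists_comp_eq w (f ∘ₗ w - w' ∘ₗ h₁) (fun s hs => by
    obtain ⟨q, rfl⟩ := H.exact_Z s hs
    simp [H.vw, hh₁, H'.vw])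
  replace hε : ∀ s, ε (w s) = f (w s) - w' (h₁ s) := hε
  have him : ∀ s, ∃ z', w' z' = ε (w s) := fun s =>
    H'.exact_X _ (by rw [hε, map_sub, H'.wu, ← hfg, H.wu, map_zero, sub_zero])
  -- The obstruction to lifting `ε` on elements `w s` lying in `𝔪 X` vanishes.
  have key : ∀ p' : X, u p' ∈ radSubmodule R Y →
      ∃ z', w' z' - ε p' ∈ radSubmodule R X' := by
    intro p' hp'
    obtain ⟨s, hs⟩ := H.exact_X (x • p') (by rw [map_smul, hx.smul_eq_zero_of_mem hp'])
    obtain ⟨p, q, hc⟩ := H.exists_isLiftChain_of_snd hx hs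
    obtain ⟨t, ht⟩ := H.returns _ _ _ _ hc
    have hgq : x • g q = u' (f p) := by rw [← map_smul, ← hc.hu, hfg]
    have hc' : IsLiftChain x u' v' w' (f p) (g q) (h₁ s) (f p' - ε p') := by
      refine ⟨hgq.symm, ?_, ?_⟩
      · rw [← map_smul, ← hc.hv]
        exact (hh₁ q).symm
      · rw [smul_sub, ← map_smul, ← map_smul, ← hs, hε]
        abel
    obtain ⟨t', ht'⟩ := H'.returns _ _ _ _ hc'
    obtain ⟨z, hz⟩ := him t
    refine ⟨z + h₁ t - t', ?_⟩
    have hf := hx.map_mem f ht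
    have e : w' (z + h₁ t - t') - ε p' =
        (f p' - ε p' - (ρ • f p + w' t')) - f (p' - (ρ • p + w t)) := by
      simp only [map_add, map_sub, map_smul, hz, hε]
      abel
    rw [e]
    exact Submodule.sub_mem _ ht' hf
  have hle : LinearMap.range w ≤ (radSubmodule R Y).comap u := by
    rintro _ ⟨s, rfl⟩
    rw [Submodule.mem_comap, H.wu]
    exact Submodule.zero_mem _
  obtain ⟨S₀, S₁, S, b, h01, h12, h0N, h1L, hN, hL, -, hb⟩ := hx.exists_adapted_basis hle
  -- The lift `ζ` has to be exact on the image of `w`, but only modulo `𝔪` on `u⁻¹(𝔪 Y)`: an element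
  -- of the latter enters into `w s` with the factor `x`.
  have hval : ∀ i : S, ∃ z' : Z', ((i : X) ∈ S₀ → w' z' = ε i) ∧
      ((i : X) ∈ S₁ → w' z' - ε i ∈ radSubmodule R X') := by
    intro i
    by_cases h0 : (i : X) ∈ S₀
    · obtain ⟨s, hs⟩ := h0N h0
      obtain ⟨z', hz'⟩ := him s
      rw [hs] at hz'
      exact ⟨z', fun _ => hz', fun _ => by rw [hz', sub_self]; exact Submodule.zero_mem _⟩
    · by_cases h1 : (i : X) ∈ S₁
      · obtain ⟨z', hz'⟩ := key i (h1L h1)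
        exact ⟨z', fun h => absurd h h0, fun _ => hz'⟩
      · exact ⟨0, fun h => absurd h h0, fun h => absurd h h1⟩
  choose F hF0 hF1 using hval
  let ζ : X →ₗ[R] Z' := b.constr ℕ F
  have hζ : ∀ i : S, ζ i = F i := fun i => by
    rw [← hb i]
    exact b.constr_basis ℕ F i
  have hspan0 : ∀ c ∈ Submodule.span R S₀, w' (ζ c) = ε c := by
    intro c hc
    have hle : Submodule.span R S₀ ≤ LinearMap.eqLocus (w' ∘ₗ ζ) ε := by
      rw [Submodule.span_le]
      intro i hi
      change w' (ζ i) = ε i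
      rw [hζ ⟨i, h12 (h01 hi)⟩]
      exact hF0 ⟨i, h12 (h01 hi)⟩ hi
    exact hle hc
  have hspan1 : ∀ c ∈ Submodule.span R S₁, w' (ζ c) - ε c ∈ radSubmodule R X' := by
    intro c hc
    have hle : Submodule.span R S₁ ≤ (radSubmodule R X').comap (w' ∘ₗ ζ - ε) := by
      rw [Submodule.span_le]
      intro i hi
      change w' (ζ i) - ε i ∈ radSubmodule R X'
      rw [hζ ⟨i, h12 hi⟩]
      exact hF1 ⟨i, h12 hi⟩ hi
    exact hle hc
  have hfin : ∀ s, w' (ζ (w s)) = ε (w s) := by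
    intro s
    obtain ⟨c, hc, hcs⟩ := hN (w s) ⟨s, rfl⟩
    obtain ⟨y, hy⟩ := hx.mem_radSubmodule_iff.1 hcs
    have hcN : u c = 0 := by
      obtain ⟨s', rfl⟩ := (Submodule.span_le.2 h0N) hc
      exact H.wu s'
    have hyL : u y ∈ radSubmodule R Y := hx.mem_of_smul_eq_zero (by
      rw [← map_smul, ← hy, map_sub, H.wu, hcN, sub_zero])
    obtain ⟨c₁, hc₁, hyc⟩ := hL y hyL
    have e₁ : x • (w' (ζ y) - ε y) = 0 := by
      have h₁ := hx.smul_eq_zero_of_mem (hx.map_mem (w' ∘ₗ ζ - ε) hyc)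
      have h₂ := hx.smul_eq_zero_of_mem (hspan1 c₁ hc₁)
      simp only [LinearMap.sub_apply, LinearMap.comp_apply, map_sub] at h₁
      rw [show w' (ζ y) - ε y = (w' (ζ y) - ε y - (w' (ζ c₁) - ε c₁)) + (w' (ζ c₁) - ε c₁) by abel,
        smul_add, h₁, h₂, add_zero]
    rw [show w s = c + x • y by rw [← hy]; abel, map_add, map_add, map_add, hspan0 c hc, map_smul,
      map_smul, map_smul, add_right_inj]
    rwa [smul_sub, sub_eq_zero] at e₁
  refine ⟨h₁ + ζ ∘ₗ w, fun q => ?_, fun s => ?_⟩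
  · simp only [LinearMap.add_apply, LinearMap.comp_apply, H.vw, map_zero, add_zero]
    exact hh₁ q
  · simp only [LinearMap.add_apply, LinearMap.comp_apply, map_add, hfin, hε]
    abel

end Fill

end Sequences

/-! ### Mapping cones of distinguished sequences -/

section Cones

variable {R : Type u} [Ring R]

variable {X Y Z X' Y' Z' : Type*} [AddCommGroup X] [Module R X] [AddCommGroup Y] [Module R Y]
  [AddCommGroup Z] [Module R Z] [AddCommGroup X'] [Module R X'] [AddCommGroup Y'] [Module R Y']
  [AddCommGroup Z'] [Module R Z']

/-- The map `(-v 0; g u')` occurring in mapping cones. -/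
def coneMap (v : Y →ₗ[R] Z) (g : Y →ₗ[R] Y') (u' : X' →ₗ[R] Y') : Y × X' →ₗ[R] Z × Y' :=
  LinearMap.prod (-(v ∘ₗ LinearMap.fst R Y X'))
    (g ∘ₗ LinearMap.fst R Y X' + u' ∘ₗ LinearMap.snd R Y X')

theorem coneMap_apply (v : Y →ₗ[R] Z) (g : Y →ₗ[R] Y') (u' : X' →ₗ[R] Y') (y : Y) (p : X') :
    coneMap v g u' (y, p) = (-v y, g y + u' p) := rfl

theorem mem_radSubmodule_prod {x : R} (hx : IsRadicalGenerator x) {a : X} {b : Y} :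
    (a, b) ∈ radSubmodule R (X × Y) ↔ a ∈ radSubmodule R X ∧ b ∈ radSubmodule R Y := by
  constructor
  · intro h
    exact ⟨hx.map_mem (LinearMap.fst R X Y) h, hx.map_mem (LinearMap.snd R X Y) h⟩
  · rintro ⟨h, h'⟩
    obtain ⟨a', rfl⟩ := hx.mem_radSubmodule_iff.1 h
    obtain ⟨b', rfl⟩ := hx.mem_radSubmodule_iff.1 h'
    exact hx.smul_mem (a', b')

section Exact

variable {u : X →ₗ[R] Y} {v : Y →ₗ[R] Z} {w : Z →ₗ[R] X}
  {u' : X' →ₗ[R] Y'} {v' : Y' →ₗ[R] Z'} {w' : Z' →ₗ[R] X'}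

theorem exact_coneMap {g : Y →ₗ[R] Y'} {f : X →ₗ[R] X'}
    (hfg : ∀ p, g (u p) = u' (f p)) (hY : ∀ q, v q = 0 → ∃ p, u p = q)
    (hX' : ∀ p, u' p = 0 → ∃ s, w' s = p) (t : Y × X') (ht : coneMap v g u' t = 0) :
    ∃ t', coneMap u f w' t' = t := by
  obtain ⟨y, p⟩ := t
  rw [coneMap_apply, Prod.mk_eq_zero, neg_eq_zero] at ht
  obtain ⟨a, rfl⟩ := hY y ht.1
  obtain ⟨s, hs⟩ := hX' (f a + p) (by rw [map_add, ← hfg, ht.2])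
  refine ⟨(-a, s), ?_⟩
  rw [coneMap_apply, hs]
  simp

theorem IsExactTriple.cone (H : IsExactTriple u v w) (H' : IsExactTriple u' v' w')
    {f : X →ₗ[R] X'} {g : Y →ₗ[R] Y'} {h : Z →ₗ[R] Z'} (hu : ∀ p, g (u p) = u' (f p))
    (hv : ∀ q, h (v q) = v' (g q)) (hw : ∀ s, f (w s) = w' (h s)) :
    IsExactTriple (coneMap v g u') (coneMap w h v') (coneMap u f w') where
  uv := by
    rintro ⟨y, p⟩
    simp [coneMap_apply, H.vw, hv, H'.uv]
  vw := by
    rintro ⟨y, p⟩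
    simp [coneMap_apply, H.wu, hw, H'.vw]
  wu := by
    rintro ⟨y, p⟩
    simp [coneMap_apply, H.uv, hu, H'.wu]
  exact_X := exact_coneMap hu H.exact_Y H'.exact_X
  exact_Y := exact_coneMap hv H.exact_Z H'.exact_Y
  exact_Z := exact_coneMap hw H.exact_X H'.exact_Z

end Exact

section Good

variable [IsLocalRing R] {x ρ : R} {u : X →ₗ[R] Y} {v : Y →ₗ[R] Z} {w : Z →ₗ[R] X}
  {u' : X' →ₗ[R] Y'} {v' : Y' →ₗ[R] Z'} {w' : Z' →ₗ[R] X'}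

/-- The elements `p` from which some chain leads to `ρ p`. They form a submodule because of the
twisted linearity encoded in `IsAdmissiblePair`. -/
def goodSubmodule (hρ : IsAdmissiblePair x ρ) (u : X →ₗ[R] Y) (v : Y →ₗ[R] Z) (w : Z →ₗ[R] X) :
    Submodule R X where
  carrier := {p | ∃ q s p', IsLiftChain x u v w p q s p' ∧ ReturnsTo ρ w p p'}
  zero_mem' := ⟨0, 0, 0, ⟨by simp, by simp, by simp⟩, 0, by simp⟩
  add_mem' := by
    rintro p₁ p₂ ⟨q₁, s₁, p₁', h₁, t₁, ht₁⟩ ⟨q₂, s₂, p₂', h₂, t₂, ht₂⟩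
    refine ⟨q₁ + q₂, s₁ + s₂, p₁' + p₂', ⟨?_, ?_, ?_⟩, t₁ + t₂, ?_⟩
    · rw [map_add, smul_add, h₁.hu, h₂.hu]
    · rw [map_add, smul_add, h₁.hv, h₂.hv]
    · rw [map_add, smul_add, h₁.hw, h₂.hw]
    · convert Submodule.add_mem _ ht₁ ht₂ using 1
      rw [smul_add, map_add]
      abel
  smul_mem' := by
    rintro t p ⟨q, s, p', h, t', ht'⟩
    obtain ⟨t₁, t₂, t₃, h₁, h₂, h₃, hm⟩ := hρ.exists_twists t
    refine ⟨t₁ • q, t₂ • s, t₃ • p', ⟨?_, ?_, ?_⟩, t₃ • t', ?_⟩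
    · rw [map_smul, h.hu, ← mul_smul, ← mul_smul, h₁]
    · rw [map_smul, h.hv, ← mul_smul, ← mul_smul, h₂]
    · rw [map_smul, h.hw, ← mul_smul, ← mul_smul, h₃]
    · have e : t₃ • p' - (ρ • t • p + w (t₃ • t')) =
          t₃ • (p' - (ρ • p + w t')) + (t₃ * ρ - ρ * t) • p := by
        rw [map_smul, smul_sub, smul_add, sub_smul, mul_smul, mul_smul]
        abel
      rw [e]
      exact Submodule.add_mem _ (Submodule.smul_mem _ _ ht') (Submodule.smul_mem_smul hm trivial)

/-- Being distinguished is invariant under rotation: the sign does not matter as `2 ∈ 𝔪`. -/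
theorem IsDistinguished.rotate [Module.Projective R Y] (hρ : IsAdmissiblePair x ρ)
    (H : IsDistinguished x ρ u v w) : IsDistinguished x ρ v w (-u) where
  toIsExactTriple := H.toIsExactTriple.rotate
  returns q s p' q' h := by
    have hx := hρ.gen
    obtain ⟨p, hp⟩ := H.exact_Y (x • q) (by rw [map_smul, h.hu, hx.smul_smul])
    obtain ⟨t, ht⟩ := H.returns p q s p' ⟨hp, h.hu, h.hv⟩
    obtain ⟨y, hy⟩ := hx.mem_radSubmodule_iff.1 ht
    have h₁ : u p' = ρ • x • q + x • u y := by
      rw [← map_smul, ← hy, ← hp, map_sub, map_add, map_smul, H.wu]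
      abel
    have h₂ : q' + ρ • q + u y ∈ radSubmodule R Y := by
      refine hx.mem_of_smul_eq_zero ?_
      have h₃ : -u p' = x • q' := h.hw
      rw [smul_add, smul_add, ← h₃, h₁, ← mul_smul, ← mul_smul, hρ.comm]
      abel
    refine ⟨y, ?_⟩
    have h₄ : (2 : R) • ρ • q ∈ radSubmodule R Y := Submodule.smul_mem_smul hρ.two_mem trivial
    convert Submodule.sub_mem _ h₂ h₄ using 1
    rw [two_smul, LinearMap.neg_apply]
    abel

/-- The outcome of a chain does not depend on the choices, up to the stated indeterminacy. -/
theorem IsExactTriple.returnsTo_of_mem_goodSubmodule [Module.Projective R X]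
    [Module.Projective R Y] [Module.Projective R Z] (H : IsExactTriple u v w)
    (hρ : IsAdmissiblePair x ρ) {p p' : X} {q : Y} {s : Z} (hp : p ∈ goodSubmodule hρ u v w)
    (h : IsLiftChain x u v w p q s p') : ReturnsTo ρ w p p' := by
  have hx := hρ.gen
  obtain ⟨q₀, s₀, p₀, h₀, t₀, ht₀⟩ := hp
  obtain ⟨y, hy⟩ := hx.mem_radSubmodule_iff.1
    (hx.sub_mem_of_smul_eq (y := q) (z := q₀) (by rw [← h.hu, h₀.hu]))
  obtain ⟨z, hz⟩ := hx.mem_radSubmodule_iff.1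
    (hx.sub_mem_of_smul_eq (y := s) (z := s₀ + v y) (by
      rw [smul_add, ← map_smul, ← hy, ← h.hv, ← h₀.hv, map_sub, add_sub_cancel]))
  have h₃ := hx.sub_mem_of_smul_eq (y := p') (z := p₀ + w z) (by
      rw [smul_add, ← map_smul, ← hz, ← h.hw, ← h₀.hw, map_sub, map_add, H.vw, add_zero,
        add_sub_cancel])
  refine ⟨t₀ + z, ?_⟩
  convert Submodule.add_mem _ ht₀ h₃ using 1
  rw [map_add]
  abel

/-- For an exact sequence it suffices to find one chain from each `p` that leads to `ρ p`. -/
theorem IsExactTriple.isDistinguished [Module.Projective R X]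
    [Module.Projective R Y] [Module.Projective R Z] (H : IsExactTriple u v w)
    (hρ : IsAdmissiblePair x ρ)
    (h : ∀ p, u p ∈ radSubmodule R Y → p ∈ goodSubmodule hρ u v w) :
    IsDistinguished x ρ u v w where
  toIsExactTriple := H
  returns p q s p' hc := H.returnsTo_of_mem_goodSubmodule hρ
    (h p (by rw [hc.hu]; exact hρ.gen.smul_mem q)) hc

theorem IsDistinguished.mem_goodSubmodule [Module.Projective R X]
    [Module.Projective R Y] [Module.Projective R Z] (H : IsDistinguished x ρ u v w)
    (hρ : IsAdmissiblePair x ρ) {p : X} (h : u p ∈ radSubmodule R Y) :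
    p ∈ goodSubmodule hρ u v w := by
  obtain ⟨q, hq⟩ := hρ.gen.mem_radSubmodule_iff.1 h
  obtain ⟨s, p', hc⟩ := H.exists_isLiftChain hρ.gen hq
  exact ⟨q, s, p', hc, H.returns _ _ _ _ hc⟩

theorem IsExactTriple.map_mem_goodSubmodule (H : IsExactTriple u v w)
    (hρ : IsAdmissiblePair x ρ) (z : Z) : w z ∈ goodSubmodule hρ u v w :=
  ⟨0, 0, 0, ⟨by rw [H.wu, smul_zero], by simp, by simp⟩, -(ρ • z), by simp⟩

theorem IsExactTriple.smul_mem_goodSubmodule (H : IsExactTriple u v w)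
    (hρ : IsAdmissiblePair x ρ) (p : X) : x • p ∈ goodSubmodule hρ u v w :=
  ⟨u p, 0, 0, ⟨by rw [map_smul], by rw [H.uv, smul_zero], by simp⟩, 0, by
    rw [map_zero, add_zero, zero_sub, ← mul_smul, ← hρ.comm, mul_smul]
    exact Submodule.neg_mem _ (hρ.gen.smul_mem _)⟩

end Good

section Strong

variable [IsLocalRing R] {x ρ : R} {u : X →ₗ[R] Y} {v : Y →ₗ[R] Z} {w : Z →ₗ[R] X}
  {u' : X' →ₗ[R] Y'} {v' : Y' →ₗ[R] Z'} {w' : Z' →ₗ[R] X'}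
  [Module.Projective R X] [Module.Projective R Y] [Module.Projective R Z]
  [Module.Projective R X'] [Module.Projective R Y'] [Module.Projective R Z']

/-- For a morphism `(f, g, h)` of distinguished sequences, the failure of the cone to be
distinguished at `y ∈ Y` is measured by an element `D ∈ X'`. Replacing `h` by `h + ε w`, where
`w' ε = κ u`, changes this defect by `κ (ρ y)`. -/
theorem exists_cone_defect (hρ : IsAdmissiblePair x ρ) (H : IsDistinguished x ρ u v w)
    (H' : IsDistinguished x ρ u' v' w') {f : X →ₗ[R] X'} {g : Y →ₗ[R] Y'} {h : Z →ₗ[R] Z'}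
    (hu : ∀ p, g (u p) = u' (f p)) (hv : ∀ q, h (v q) = v' (g q))
    (hw : ∀ s, f (w s) = w' (h s)) {y : Y} {p : X'} (hy : v y ∈ radSubmodule R Z)
    (hp : g y + u' p ∈ radSubmodule R Y') :
    ∃ D : X', u' D ∈ radSubmodule R Y' ∧ ∀ (κ : Y →ₗ[R] X') (ε : X →ₗ[R] Z'),
      (∀ a, w' (ε a) = κ (u a)) → ρ • κ y + D = 0 →
      (y, p) ∈ goodSubmodule hρ (coneMap v g u') (coneMap w (h + ε ∘ₗ w) v') (coneMap u f w') := by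
  have hx := hρ.gen
  have hc₀ : coneMap v g u' (y, p) ∈ radSubmodule R (Z × Y') :=
    (mem_radSubmodule_prod hx).2 ⟨Submodule.neg_mem _ hy, hp⟩
  obtain ⟨⟨z, q⟩, hzq⟩ := hx.mem_radSubmodule_iff.1 hc₀
  obtain ⟨⟨a, s⟩, ⟨b, c⟩, hc⟩ :=
    (H.toIsExactTriple.cone H'.toIsExactTriple hu hv hw).exists_isLiftChain hx hzq
  have h₁ : -v y = x • z := congrArg Prod.fst hc.hu
  have h₂ : g y + u' p = x • q := congrArg Prod.snd hc.hu
  have h₃ : -w z = x • a := congrArg Prod.fst hc.hv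
  have h₄ : h z + v' q = x • s := congrArg Prod.snd hc.hv
  have h₅ : -u a = x • b := congrArg Prod.fst hc.hw
  have h₆ : f a + w' s = x • c := congrArg Prod.snd hc.hw
  obtain ⟨a₀, ha₀⟩ := (H.rotate hρ).returns y (-z) a b
    ⟨by rw [smul_neg, ← h₁, neg_neg], by rw [map_neg, h₃], h₅⟩
  rw [LinearMap.neg_apply] at ha₀
  refine ⟨c - ρ • p - f a₀, ?_, fun κ ε hε hκ => ?_⟩
  · have h₇ : u' c + g b ∈ radSubmodule R Y' := hx.mem_of_smul_eq_zero (by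
      rw [smul_add, ← map_smul, ← map_smul, ← h₆, ← h₅, map_add, H'.wu, map_neg, hu]
      abel)
    convert Submodule.sub_mem _ (Submodule.sub_mem _ h₇ (hx.map_mem g ha₀))
      (Submodule.smul_mem _ ρ hp) using 1
    simp only [map_sub, map_add, map_neg, map_smul, smul_add, hu]
    abel
  · refine ⟨(z, q), (a, s - ε a), (b, c + κ b), ⟨hzq, ?_, ?_⟩, (a₀, -ε a₀), ?_⟩
    · have h₇ : w z = x • -a := by rw [smul_neg, ← h₃, neg_neg]
      refine Prod.ext h₃ ?_
      change (h + ε ∘ₗ w) z + v' q = x • (s - ε a)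
      rw [smul_sub, ← h₄, LinearMap.add_apply, LinearMap.comp_apply, h₇, map_smul, map_neg,
        smul_neg]
      abel
    · have h₇ : u a = x • -b := by rw [smul_neg, ← h₅, neg_neg]
      refine Prod.ext h₅ ?_
      change f a + w' (s - ε a) = x • (c + κ b)
      rw [smul_add, ← h₆, map_sub, hε, h₇, map_smul, map_neg, smul_neg]
      abel
    · have h₇ : (b, c + κ b) - (ρ • (y, p) + coneMap u f w' (a₀, -ε a₀)) =
          (b - (ρ • y + -u a₀), (ρ • κ y + (c - ρ • p - f a₀)) + κ (b - (ρ • y + -u a₀))) := by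
        refine Prod.ext rfl ?_
        change c + κ b - (ρ • p + (f a₀ + w' (-ε a₀))) = _
        simp only [map_sub, map_add, map_neg, map_smul, hε]
        abel
      rw [h₇, hκ, zero_add]
      exact (mem_radSubmodule_prod hx).2 ⟨ha₀, hx.map_mem κ ha₀⟩

/-- Axiom (A.3) for distinguished sequences: the third component of a morphism can be chosen such
that the mapping cone is again distinguished. -/
theorem IsDistinguished.exists_fill_cone (hρ : IsAdmissiblePair x ρ)
    (H : IsDistinguished x ρ u v w) (H' : IsDistinguished x ρ u' v' w')
    (f : X →ₗ[R] X') (g : Y →ₗ[R] Y') (hu : ∀ p, g (u p) = u' (f p)) :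
    ∃ h : Z →ₗ[R] Z', (∀ q, h (v q) = v' (g q)) ∧ (∀ s, f (w s) = w' (h s)) ∧
      IsDistinguished x ρ (coneMap v g u') (coneMap w h v') (coneMap u f w') := by
  have hx := hρ.gen
  obtain ⟨h₀, hv₀, hw₀⟩ := H.exists_fill hx H' f g hu
  replace hw₀ : ∀ s, f (w s) = w' (h₀ s) := fun s => (hw₀ s).symm
  -- The elements `y` for which `(y, p)` starts a chain in the cone, for some `p`.
  let L : Submodule R Y := (radSubmodule R Z).comap v ⊓
    (LinearMap.range u' ⊔ radSubmodule R Y').comap g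
  have hL : ∀ y ∈ L, ∃ p, g y + u' p ∈ radSubmodule R Y' := by
    rintro y ⟨-, hy⟩
    obtain ⟨_, ⟨p, rfl⟩, m, hm, e⟩ := Submodule.mem_sup.1 hy
    exact ⟨-p, by rw [map_neg, ← e]; simpa using hm⟩
  have hle : LinearMap.range u ≤ L := by
    rintro _ ⟨p, rfl⟩
    refine ⟨?_, ?_⟩
    · change v (u p) ∈ radSubmodule R Z
      rw [H.uv]
      exact Submodule.zero_mem _
    · change g (u p) ∈ LinearMap.range u' ⊔ radSubmodule R Y'
      rw [hu]
      exact Submodule.mem_sup_left ⟨_, rfl⟩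
  obtain ⟨S₀, S₁, S, b, h01, h12, h0N, h1L, hbN, hbL, -, hb⟩ := hx.exists_adapted_basis hle
  have hdef : ∀ i : S, ∃ (p D : X'), u' D ∈ radSubmodule R Y' ∧ ((i : Y) ∈ S₁ →
      ∀ (κ : Y →ₗ[R] X') (ε : X →ₗ[R] Z'), (∀ a, w' (ε a) = κ (u a)) → ρ • κ i + D = 0 →
      ((i : Y), p) ∈
        goodSubmodule hρ (coneMap v g u') (coneMap w (h₀ + ε ∘ₗ w) v') (coneMap u f w')) := by
    intro i
    by_cases hi : (i : Y) ∈ S₁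
    · obtain ⟨p, hp⟩ := hL i (h1L hi)
      obtain ⟨D, hD, h⟩ := exists_cone_defect hρ H H' hu hv₀ hw₀ (h1L hi).1 hp
      exact ⟨p, D, hD, fun _ => h⟩
    · exact ⟨0, 0, by rw [map_zero]; exact Submodule.zero_mem _, fun h => absurd h hi⟩
  choose P D hD hgood using hdef
  obtain ⟨ρ', hρ'⟩ := hρ.isUnit.exists_right_inv
  classical
  -- `κ` cancels the defects on the basis elements of `L` outside the image of `u`. On the image of
  -- `u` it has to be zero for `κ u` to factor through `w'`; there the cone condition is automatic.
  let κ : Y →ₗ[R] X' := b.constr ℕ fun i => if (i : Y) ∈ S₀ then 0 else -(ρ' • D i)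
  have hκ : ∀ i : S, κ i = if (i : Y) ∈ S₀ then 0 else -(ρ' • D i) := fun i => by
    conv_lhs => rw [← hb i]
    exact b.constr_basis ℕ _ i
  have hu'κ : ∀ y, u' (κ y) ∈ radSubmodule R Y' := by
    intro y
    have hle : (⊤ : Submodule R Y) ≤ (radSubmodule R Y').comap (u' ∘ₗ κ) := by
      rw [← b.span_eq, Submodule.span_le]
      rintro _ ⟨i, rfl⟩
      change u' (κ (b i)) ∈ radSubmodule R Y'
      rw [hb, hκ]
      split_ifs
      · rw [map_zero]
        exact Submodule.zero_mem _
      · rw [map_neg, map_smul]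
        exact Submodule.neg_mem _ (Submodule.smul_mem _ _ (hD i))
    exact hle trivial
  have hu'κu : ∀ a, u' (κ (u a)) = 0 := by
    intro a
    obtain ⟨c, hc, hm⟩ := hbN (u a) ⟨a, rfl⟩
    obtain ⟨y, hy⟩ := hx.mem_radSubmodule_iff.1 hm
    have hκc : κ c = 0 := by
      have hle : Submodule.span R S₀ ≤ LinearMap.ker κ := by
        rw [Submodule.span_le]
        intro i hi
        change κ i = 0
        rw [hκ ⟨i, h12 (h01 hi)⟩, if_pos hi]
      exact hle hc
    rw [show u a = c + x • y by rw [← hy]; abel, map_add, hκc, zero_add, map_smul, map_smul,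
      hx.smul_eq_zero_of_mem (hu'κ y)]
  obtain ⟨ε, hε⟩ : ∃ ε : X →ₗ[R] Z', ∀ a, w' (ε a) = κ (u a) := by
    obtain ⟨ε, hε⟩ := Module.projective_lifting_property w'.rangeRestrict
      ((κ ∘ₗ u).codRestrict (LinearMap.range w') fun a => H'.exact_X _ (hu'κu a))
      w'.surjective_rangeRestrict
    exact ⟨ε, fun a => congrArg Subtype.val (LinearMap.congr_fun hε a)⟩
  have hv₁ : ∀ q, (h₀ + ε ∘ₗ w) (v q) = v' (g q) := fun q => by simp [hv₀, H.vw]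
  have hw₁ : ∀ s, f (w s) = w' ((h₀ + ε ∘ₗ w) s) := fun s => by simp [hw₀, hε, H.wu]
  refine ⟨h₀ + ε ∘ₗ w, hv₁, hw₁, ?_⟩
  have HC := H.toIsExactTriple.cone H'.toIsExactTriple hu hv₁ hw₁
  refine HC.isDistinguished hρ ?_
  set G := goodSubmodule hρ (coneMap v g u') (coneMap w (h₀ + ε ∘ₗ w) v') (coneMap u f w') with hG
  -- The elements of `X'` alone satisfy the condition because the second triangle is distinguished.
  have hG₀ : ∀ p, u' p ∈ radSubmodule R Y' → ((0 : Y), p) ∈ G := by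
    intro p hp
    obtain ⟨q, s, p', hc, t, ht⟩ := H'.mem_goodSubmodule hρ hp
    refine ⟨(0, q), (0, s), (0, p'), ⟨?_, ?_, ?_⟩, (0, t), ?_⟩
    · simp [coneMap_apply, hc.hu]
    · simp [coneMap_apply, hc.hv]
    · simp [coneMap_apply, hc.hw]
    · have h0 : ((0 : Y), p') - (ρ • ((0 : Y), p) + coneMap u f w' (0, t)) =
          (0, p' - (ρ • p + w' t)) := by
        simp [coneMap_apply]
      rw [h0]
      exact (mem_radSubmodule_prod hx).2 ⟨Submodule.zero_mem _, ht⟩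
  have hG₁ : ∀ y ∈ L, ∃ p, (y, p) ∈ G := by
    intro y hy
    obtain ⟨c, hc, hm⟩ := hbL y hy
    obtain ⟨m, hm⟩ := hx.mem_radSubmodule_iff.1 hm
    have hle : Submodule.span R S₁ ≤ G.map (LinearMap.fst R Y X') := by
      rw [Submodule.span_le]
      intro i hi
      by_cases hi0 : i ∈ S₀
      · obtain ⟨a, rfl⟩ := h0N hi0
        exact ⟨_, HC.map_mem_goodSubmodule hρ (-a, 0), by simp [coneMap_apply]⟩
      · refine ⟨_, hgood ⟨i, h12 hi⟩ hi κ ε hε ?_, rfl⟩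
        rw [hκ ⟨i, h12 hi⟩, if_neg hi0, smul_neg, ← mul_smul, hρ', one_smul, neg_add_cancel]
    obtain ⟨⟨_, p⟩, hp, rfl⟩ := hle hc
    refine ⟨p, ?_⟩
    have h := Submodule.add_mem _ hp (HC.smul_mem_goodSubmodule hρ (m, 0))
    convert h using 1
    simp [← hm]
  rintro ⟨y, p⟩ hyp
  obtain ⟨hy₁, hy₂⟩ := (mem_radSubmodule_prod hx).1 hyp
  replace hy₁ : v y ∈ radSubmodule R Z := neg_mem_iff.1 hy₁
  replace hy₂ : g y + u' p ∈ radSubmodule R Y' := hy₂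
  have hyL : y ∈ L := ⟨hy₁, Submodule.mem_sup.2
    ⟨u' (-p), ⟨_, rfl⟩, _, hy₂, by rw [map_neg]; abel⟩⟩
  obtain ⟨p₁, hp₁⟩ := hG₁ y hyL
  obtain ⟨⟨z, q⟩, s, p', hc, -⟩ := id hp₁
  have h₂ : g y + u' p₁ ∈ radSubmodule R Y' := by
    have : g y + u' p₁ = x • q := congrArg Prod.snd hc.hu
    rw [this]
    exact hx.smul_mem q
  have h₃ := hG₀ (p - p₁) (by
    convert Submodule.sub_mem _ hy₂ h₂ using 1
    rw [map_sub]
    abel)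
  convert Submodule.add_mem _ hp₁ h₃ using 1
  simp

end Strong

end Cones

/-! ### Splitting a linear map into elementary pieces -/

section Splitting

variable {R : Type u} [Ring R] {x : R}

theorem Finsupp.sumFinsuppLEquivProdFinsupp_symm_single_zero {I J : Type*} (i : I) (r : R) :
    (Finsupp.sumFinsuppLEquivProdFinsupp R).symm (Finsupp.single i r, (0 : J →₀ R)) =
      Finsupp.single (Sum.inl i) r := by
  rw [LinearEquiv.symm_apply_eq]
  ext j
  · classical
    simp [Finsupp.single_apply]
  · simp

theorem Finsupp.sumFinsuppLEquivProdFinsupp_symm_zero_single {I J : Type*} (j : J) (r : R) :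
    (Finsupp.sumFinsuppLEquivProdFinsupp R).symm ((0 : I →₀ R), Finsupp.single j r) =
      Finsupp.single (Sum.inr j) r := by
  rw [LinearEquiv.symm_apply_eq]
  ext j
  · simp
  · classical
    simp [Finsupp.single_apply]

theorem IsRadicalGenerator.exists_smul_eq_mulRightFree (hx : IsRadicalGenerator x) {J : Type u}
    (j : J →₀ R) : ∃ j', x • j = mulRightFree J x j' := by
  induction j using Finsupp.induction_linear with
  | zero => exact ⟨0, by rw [smul_zero, map_zero]⟩
  | add a b ha hb =>
    obtain ⟨a', ha'⟩ := ha
    obtain ⟨b', hb'⟩ := hb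
    exact ⟨a' + b', by rw [smul_add, map_add, ha', hb']⟩
  | single i r =>
    obtain ⟨r', hr'⟩ := hx.exists_comm_mul r
    refine ⟨Finsupp.single i r', ?_⟩
    rw [Finsupp.smul_single, smul_eq_mul, ← hr']
    simp [mulRightFree]

theorem IsRadicalGenerator.mulRightFree_eq_zero (hx : IsRadicalGenerator x) {J : Type u}
    {j : J →₀ R} (hj : j ∈ radSubmodule R (J →₀ R)) : mulRightFree J x j = 0 := by
  obtain ⟨j, rfl⟩ := hx.mem_radSubmodule_iff.1 hj
  obtain ⟨j', hj'⟩ := hx.exists_smul_eq_mulRightFree j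
  rw [hj', ← LinearMap.comp_apply, mulRightFree_comp, hx.mul_self, mulRightFree_zero,
    LinearMap.zero_apply]

variable [IsLocalRing R]

/-- A projective module splits into free modules adapted, modulo the radical, to a flag of
submodules `N ≤ L`. -/
theorem IsRadicalGenerator.exists_adapted_splitting (hx : IsRadicalGenerator x) {M : Type u}
    [AddCommGroup M] [Module R M] [Module.Projective R M] {N L : Submodule R M} (hNL : N ≤ L) :
    ∃ (I₀ J I₁ : Type u) (α : (((I₀ →₀ R) × (J →₀ R)) × (I₁ →₀ R)) ≃ₗ[R] M),
      (∀ a, α ((a, 0), 0) ∈ N) ∧ (∀ a, α (a, 0) ∈ L) ∧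
      (∀ m ∈ N, (α.symm m).1.2 ∈ radSubmodule R (J →₀ R)) ∧
      (∀ m ∈ L, (α.symm m).2 ∈ radSubmodule R (I₁ →₀ R)) := by
  classical
  obtain ⟨S₀, S₁, S, b, h01, h12, h0N, h1L, hN, hL, -, hb⟩ := hx.exists_adapted_basis hNL
  let e : (S₀ ⊕ (S₁ \ S₀ : Set M)) ⊕ (S \ S₁ : Set M) ≃ S :=
    (Equiv.sumCongr (Equiv.Set.sumDiffSubset h01) (Equiv.refl _)).trans
      (Equiv.Set.sumDiffSubset h12)
  let α : (((S₀ →₀ R) × ((S₁ \ S₀ : Set M) →₀ R)) × ((S \ S₁ : Set M) →₀ R)) ≃ₗ[R] M :=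
    ((LinearEquiv.prodCongr (Finsupp.sumFinsuppLEquivProdFinsupp R).symm
      (LinearEquiv.refl R _)).trans (Finsupp.sumFinsuppLEquivProdFinsupp R).symm).trans
      (b.reindex e.symm).repr.symm
  have hα₀ : ∀ i : S₀, α ((Finsupp.single i 1, 0), 0) = i := by
    intro i
    change (b.reindex e.symm).repr.symm ((Finsupp.sumFinsuppLEquivProdFinsupp R).symm
      ((Finsupp.sumFinsuppLEquivProdFinsupp R).symm (Finsupp.single i 1, 0), 0)) = _
    rw [Finsupp.sumFinsuppLEquivProdFinsupp_symm_single_zero,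
      Finsupp.sumFinsuppLEquivProdFinsupp_symm_single_zero, Module.Basis.repr_symm_single_one,
      Module.Basis.reindex_apply, hb]
    rfl
  have hαJ : ∀ i : (S₁ \ S₀ : Set M), α ((0, Finsupp.single i 1), 0) = i := by
    intro i
    change (b.reindex e.symm).repr.symm ((Finsupp.sumFinsuppLEquivProdFinsupp R).symm
      ((Finsupp.sumFinsuppLEquivProdFinsupp R).symm (0, Finsupp.single i 1), 0)) = _
    rw [Finsupp.sumFinsuppLEquivProdFinsupp_symm_zero_single,
      Finsupp.sumFinsuppLEquivProdFinsupp_symm_single_zero, Module.Basis.repr_symm_single_one,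
      Module.Basis.reindex_apply, hb]
    rfl
  have hα₀' : ∀ a, α ((a, 0), 0) ∈ Submodule.span R S₀ := by
    intro a
    induction a using Finsupp.induction_linear with
    | zero => exact (map_zero α).symm ▸ Submodule.zero_mem _
    | add a a' h h' => simpa [← map_add] using Submodule.add_mem _ h h'
    | single i r =>
      have h := Submodule.smul_mem _ r (Submodule.subset_span (R := R) i.2)
      rw [← hα₀ i, ← map_smul] at h
      simpa using h
  have hαJ' : ∀ a, α ((0, a), 0) ∈ Submodule.span R S₁ := by
    intro a
    induction a using Finsupp.induction_linear with
    | zero => exact (map_zero α).symm ▸ Submodule.zero_mem _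
    | add a a' h h' => simpa [← map_add] using Submodule.add_mem _ h h'
    | single i r =>
      have h := Submodule.smul_mem _ r (Submodule.subset_span (R := R) i.2.1)
      rw [← hαJ i, ← map_smul] at h
      simpa using h
  refine ⟨S₀, (S₁ \ S₀ : Set M), (S \ S₁ : Set M), α, ?_, ?_, ?_, ?_⟩
  · exact fun a => Submodule.span_le.2 h0N (hα₀' a)
  · rintro ⟨a, a'⟩
    have h := Submodule.add_mem _ (Submodule.span_mono h01 (hα₀' a)) (hαJ' a')
    rw [← map_add] at h
    exact Submodule.span_le.2 h1L (by simpa using h)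
  · intro m hm
    obtain ⟨c, hc, hmc⟩ := hN m hm
    have hle : Submodule.span R S₀ ≤ LinearMap.ker
        (LinearMap.snd R _ _ ∘ₗ LinearMap.fst R _ _ ∘ₗ α.symm.toLinearMap) := by
      rw [Submodule.span_le]
      intro i hi
      change (α.symm i).1.2 = 0
      rw [← (show α _ = i from hα₀ ⟨i, hi⟩), LinearEquiv.symm_apply_apply]
    have h₁ : (α.symm c).1.2 = 0 := hle hc
    have h₂ := hx.map_mem (LinearMap.snd R _ _ ∘ₗ LinearMap.fst R _ _ ∘ₗ α.symm.toLinearMap) hmc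
    rw [map_sub] at h₂
    change (α.symm m).1.2 - (α.symm c).1.2 ∈ _ at h₂
    rwa [h₁, sub_zero] at h₂
  · intro m hm
    obtain ⟨c, hc, hmc⟩ := hL m hm
    have hle : Submodule.span R S₁ ≤ LinearMap.ker (LinearMap.snd R _ _ ∘ₗ α.symm.toLinearMap) := by
      rw [Submodule.span_le]
      intro i hi
      change (α.symm i).2 = 0
      by_cases hi' : i ∈ S₀
      · rw [← (show α _ = i from hα₀ ⟨i, hi'⟩), LinearEquiv.symm_apply_apply]
      · rw [← (show α _ = i from hαJ ⟨i, hi, hi'⟩), LinearEquiv.symm_apply_apply]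
    have h₁ : (α.symm c).2 = 0 := hle hc
    have h₂ := hx.map_mem (LinearMap.snd R _ _ ∘ₗ α.symm.toLinearMap) hmc
    rw [map_sub] at h₂
    change (α.symm m).2 - (α.symm c).2 ∈ _ at h₂
    rwa [h₁, sub_zero] at h₂

/-- Every map between projective modules is isomorphic to a direct sum of a zero map, an identity
map, a map from zero, and a map `x : R^(J) ⟶ R^(J)`. -/
theorem IsRadicalGenerator.exists_normal_form (hx : IsRadicalGenerator x) {X Y : Type u}
    [AddCommGroup X] [Module R X] [Module.Projective R X] [AddCommGroup Y] [Module R Y]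
    [Module.Projective R Y] (u : X →ₗ[R] Y) :
    ∃ (I₀ I₁ J : Type u) (K : Submodule R Y)
      (α : (((I₀ →₀ R) × (I₁ →₀ R)) × (J →₀ R)) ≃ₗ[R] X)
      (β : (((I₁ →₀ R) × K) × (J →₀ R)) ≃ₗ[R] Y),
      Module.Projective R K ∧
      ∀ a b j, u (α ((a, b), j)) = β ((b, 0), mulRightFree J x j) := by
  have hle : LinearMap.ker u ≤ (radSubmodule R Y).comap u := by
    intro p hp
    rw [Submodule.mem_comap, LinearMap.mem_ker.1 hp]
    exact Submodule.zero_mem _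
  obtain ⟨I₀, J, I₁, α, hN, hL, hN', hL'⟩ := hx.exists_adapted_splitting hle
  have hQ : ∀ i : J, ∃ q, u (α ((0, Finsupp.single i 1), 0)) = x • q := fun i =>
    hx.mem_radSubmodule_iff.1 (hL (0, Finsupp.single i 1))
  choose Q hQ using hQ
  let q : (J →₀ R) →ₗ[R] Y := Finsupp.linearCombination R Q
  have hq : ∀ j, u (α ((0, j), 0)) = q (mulRightFree J x j) := by
    intro j
    have h : u ∘ₗ α.toLinearMap ∘ₗ LinearMap.inl R _ _ ∘ₗ LinearMap.inr R _ _ =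
        q ∘ₗ mulRightFree J x := by
      ext i
      change u (α ((0, Finsupp.single i 1), 0)) = q (mulRightFree J x (Finsupp.single i 1))
      rw [hQ]
      simp [mulRightFree, q]
    exact LinearMap.congr_fun h j
  -- `θ` is injective, because modulo the radical `I₁` indexes a complement of `u⁻¹(𝔪 Y)`, and `J` a
  -- complement of the kernel of `u` in `u⁻¹(𝔪 Y)`.
  let θ : (I₁ →₀ R) × (J →₀ R) →ₗ[R] Y :=
    LinearMap.coprod (u ∘ₗ α.toLinearMap ∘ₗ LinearMap.inr R _ _) q
  have hθ : ∀ b j, θ (b, j) = u (α (0, b)) + q j := fun b j => rfl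
  have hinj : Function.Injective θ := by
    refine hx.injective_of_injective_mod θ ?_
    rintro ⟨b, j⟩ h
    rw [hθ] at h
    obtain ⟨j', hj'⟩ := hx.exists_smul_eq_mulRightFree j
    have h₁ : α ((0, j'), x • b) ∈ LinearMap.ker u := by
      have h₂ := hx.smul_eq_zero_of_mem h
      rw [smul_add, ← map_smul, ← map_smul, ← map_smul, hj', ← hq, ← map_add, ← map_add] at h₂
      simpa using h₂
    have h₂ := hN' _ h₁
    rw [LinearEquiv.symm_apply_apply] at h₂
    have hj : j ∈ radSubmodule R (J →₀ R) := hx.mem_of_smul_eq_zero (by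
      rw [hj', hx.mulRightFree_eq_zero h₂])
    have h₃ : α (0, b) ∈ (radSubmodule R Y).comap u := by
      rw [Submodule.mem_comap]
      simpa using Submodule.sub_mem _ h (hx.map_mem q hj)
    have h₄ := hL' _ h₃
    rw [LinearEquiv.symm_apply_apply] at h₄
    exact (mem_radSubmodule_prod hx).2 ⟨h₄, hj⟩
  -- The source of `θ` is injective, so `θ` splits; the kernel of a retraction is a complement.
  obtain ⟨π, hπ⟩ := (hx.baer (M := (I₁ →₀ R) × (J →₀ R))).extension_property θ hinj LinearMap.id
  replace hπ : ∀ t, π (θ t) = t := fun t => LinearMap.congr_fun hπ t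
  let K := LinearMap.ker π
  let κ : Y →ₗ[R] K := (LinearMap.id - θ ∘ₗ π).codRestrict K fun y => by
    change π (y - θ (π y)) = 0
    rw [map_sub, hπ, sub_self]
  have hκ : ∀ y, (κ y : Y) = y - θ (π y) := fun y => rfl
  let β₀ : ((I₁ →₀ R) × K) × (J →₀ R) →ₗ[R] Y :=
    θ ∘ₗ LinearMap.prod (LinearMap.fst R _ _ ∘ₗ LinearMap.fst R _ _) (LinearMap.snd R _ _) +
      K.subtype ∘ₗ LinearMap.snd R _ _ ∘ₗ LinearMap.fst R _ _
  have hβ₀ : ∀ b c j, β₀ ((b, c), j) = θ (b, j) + c := fun b c j => rfl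
  have hβ : Function.Bijective β₀ := by
    constructor
    · rw [injective_iff_map_eq_zero]
      rintro ⟨⟨b, c⟩, j⟩ h
      rw [hβ₀] at h
      have h₁ : π (θ (b, j) + c) = (b, j) := by
        rw [map_add, hπ, LinearMap.mem_ker.1 c.2, add_zero]
      rw [h, map_zero, eq_comm, Prod.mk_eq_zero] at h₁
      obtain ⟨rfl, rfl⟩ := h₁
      rw [Prod.mk_zero_zero, map_zero, zero_add, ZeroMemClass.coe_eq_zero] at h
      rw [h]
      rfl
    · intro y
      refine ⟨(((π y).1, κ y), (π y).2), ?_⟩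
      rw [hβ₀, hκ]
      exact add_sub_cancel _ _
  refine ⟨I₀, I₁, J, K, (LinearEquiv.prodAssoc R _ _ _).trans
    (((LinearEquiv.refl R _).prodCongr (LinearEquiv.prodComm R _ _)).trans
    ((LinearEquiv.prodAssoc R _ _ _).symm.trans α)), LinearEquiv.ofBijective β₀ hβ,
    Module.Projective.of_split K.subtype κ ?_, ?_⟩
  · ext c
    change ((c : Y) - θ (π c)) = c
    rw [LinearMap.mem_ker.1 c.2, map_zero, sub_zero]
  · intro a b j
    change u (α ((a, j), b)) = θ (b, mulRightFree J x j) + ((0 : K) : Y)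
    have h₀ : u (α ((a, 0), 0)) = 0 := hN a
    rw [hθ, ← hq, Submodule.coe_zero, add_zero,
      show (((a, j), b) : ((I₀ →₀ R) × (J →₀ R)) × (I₁ →₀ R)) =
        ((a, 0), 0) + ((0, b) + ((0, j), 0)) by simp, map_add, map_add, h₀, zero_add, map_add,
      map_add]

end Splitting

/-! ### Closure properties of distinguished sequences -/

section Closure

variable {R : Type u} [Ring R]

variable {X Y Z X' Y' Z' : Type*} [AddCommGroup X] [Module R X] [AddCommGroup Y] [Module R Y]
  [AddCommGroup Z] [Module R Z] [AddCommGroup X'] [Module R X'] [AddCommGroup Y'] [Module R Y']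
  [AddCommGroup Z'] [Module R Z'] {x ρ : R}
  {u : X →ₗ[R] Y} {v : Y →ₗ[R] Z} {w : Z →ₗ[R] X}
  {u' : X' →ₗ[R] Y'} {v' : Y' →ₗ[R] Z'} {w' : Z' →ₗ[R] X'}

theorem IsDistinguished.of_equiv (hx : IsRadicalGenerator x) (H : IsDistinguished x ρ u v w)
    (eX : X ≃ₗ[R] X') (eY : Y ≃ₗ[R] Y') (eZ : Z ≃ₗ[R] Z') (hu : ∀ p, eY (u p) = u' (eX p))
    (hv : ∀ q, eZ (v q) = v' (eY q)) (hw : ∀ s, eX (w s) = w' (eZ s)) :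
    IsDistinguished x ρ u' v' w' where
  uv := eX.surjective.forall.2 fun p => by rw [← hu, ← hv, H.uv, map_zero]
  vw := eY.surjective.forall.2 fun q => by rw [← hv, ← hw, H.vw, map_zero]
  wu := eZ.surjective.forall.2 fun s => by rw [← hw, ← hu, H.wu, map_zero]
  exact_X := eX.surjective.forall.2 fun p hp => by
    obtain ⟨s, rfl⟩ := H.exact_X p (eY.injective (by rw [hu, hp, map_zero]))
    exact ⟨eZ s, (hw s).symm⟩
  exact_Y := eY.surjective.forall.2 fun q hq => by
    obtain ⟨p, rfl⟩ := H.exact_Y q (eZ.injective (by rw [hv, hq, map_zero]))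
    exact ⟨eX p, (hu p).symm⟩
  exact_Z := eZ.surjective.forall.2 fun s hs => by
    obtain ⟨q, rfl⟩ := H.exact_Z s (eX.injective (by rw [hw, hs, map_zero]))
    exact ⟨eY q, (hv q).symm⟩
  returns := eX.surjective.forall.2 fun p => eY.surjective.forall.2 fun q =>
    eZ.surjective.forall.2 fun s => eX.surjective.forall.2 fun p' h => by
    obtain ⟨t, ht⟩ := H.returns p q s p' ⟨eY.injective (by rw [hu, h.hu, map_smul]),
      eZ.injective (by rw [hv, h.hv, map_smul]), eX.injective (by rw [hw, h.hw, map_smul])⟩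
    refine ⟨eZ t, ?_⟩
    have h₁ := hx.map_mem eX.toLinearMap ht
    simpa [hw] using h₁

theorem IsDistinguished.neg (hx : (2 : R) ∈ maxIdeal R) (H : IsDistinguished x ρ u v w) :
    IsDistinguished x ρ (-u) (-v) (-w) where
  uv p := by simp [H.uv]
  vw q := by simp [H.vw]
  wu s := by simp [H.wu]
  exact_X p hp := by
    obtain ⟨s, rfl⟩ := H.exact_X p (by simpa using hp)
    exact ⟨-s, by simp⟩
  exact_Y q hq := by
    obtain ⟨p, rfl⟩ := H.exact_Y q (by simpa using hq)
    exact ⟨-p, by simp⟩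
  exact_Z s hs := by
    obtain ⟨q, rfl⟩ := H.exact_Z s (by simpa using hs)
    exact ⟨-q, by simp⟩
  returns p q s p' h := by
    have h₁ : -u p = x • q := h.hu
    have h₂ : -v q = x • s := h.hv
    have h₃ : -w s = x • p' := h.hw
    obtain ⟨t, ht⟩ := H.returns p (-q) s (-p') ⟨by rw [smul_neg, ← h₁, neg_neg],
      by rw [map_neg, h₂], by rw [smul_neg, ← h₃, neg_neg]⟩
    refine ⟨t, ?_⟩
    have h₄ : (2 : R) • ρ • p ∈ radSubmodule R X := Submodule.smul_mem_smul hx trivial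
    convert Submodule.neg_mem _ (Submodule.add_mem _ ht h₄) using 1
    rw [two_smul, LinearMap.neg_apply]
    abel

theorem IsDistinguished.of_rotate [IsLocalRing R] [Module.Projective R X] [Module.Projective R Z]
    (hρ : IsAdmissiblePair x ρ) (H : IsDistinguished x ρ v w (-u)) :
    IsDistinguished x ρ u v w := by
  have h := ((H.rotate hρ).rotate hρ).neg hρ.two_mem
  simpa using h

/-- A sequence whose identity is null-homotopic is distinguished: the target of every chain is
already in the image of `w`, modulo the radical. -/
theorem isDistinguished_of_contraction [IsLocalRing R] [Module.Projective R Y]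
    (hx : IsRadicalGenerator x) (uv : ∀ p, v (u p) = 0) (vw : ∀ q, w (v q) = 0)
    (wu : ∀ s, u (w s) = 0)
    (Θ : Y →ₗ[R] X) (Φ : Z →ₗ[R] Y) (Ψ : X →ₗ[R] Z) (hY : ∀ q, q = Φ (v q) + u (Θ q))
    (hZ : ∀ s, s = Ψ (w s) + v (Φ s)) (hX : ∀ p, p = Θ (u p) + w (Ψ p)) :
    IsDistinguished x ρ u v w where
  uv := uv
  vw := vw
  wu := wu
  exact_X p hp := ⟨Ψ p, by conv_rhs => rw [hX p, hp, map_zero, zero_add]⟩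
  exact_Y q hq := ⟨Θ q, by conv_rhs => rw [hY q, hq, map_zero, zero_add]⟩
  exact_Z s hs := ⟨Φ s, by conv_rhs => rw [hZ s, hs, map_zero, zero_add]⟩
  returns p q s p' h := by
    have key : ∀ p, u p ∈ radSubmodule R Y → ∃ t, p - w t ∈ radSubmodule R X := fun p hp =>
      ⟨Ψ p, by
        have h := hx.map_mem Θ hp
        rwa [show Θ (u p) = p - w (Ψ p) from eq_sub_of_add_eq (hX p).symm] at h⟩
    obtain ⟨t, ht⟩ := key p (by rw [h.hu]; exact hx.smul_mem q)
    obtain ⟨t', ht'⟩ := key p' (hx.mem_of_smul_eq_zero (by rw [← map_smul, ← h.hw, wu]))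
    refine ⟨t' - ρ • t, ?_⟩
    convert Submodule.sub_mem _ ht' (Submodule.smul_mem _ ρ ht) using 1
    rw [map_sub, map_smul, smul_sub]
    abel

theorem IsDistinguished.prodMap (hx : IsRadicalGenerator x) (H : IsDistinguished x ρ u v w)
    (H' : IsDistinguished x ρ u' v' w') :
    IsDistinguished x ρ (u.prodMap u') (v.prodMap v') (w.prodMap w') where
  uv p := Prod.ext (H.uv p.1) (H'.uv p.2)
  vw p := Prod.ext (H.vw p.1) (H'.vw p.2)
  wu p := Prod.ext (H.wu p.1) (H'.wu p.2)
  exact_X p hp := by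
    obtain ⟨a, ha⟩ := H.exact_X p.1 (congrArg Prod.fst hp)
    obtain ⟨b, hb⟩ := H'.exact_X p.2 (congrArg Prod.snd hp)
    exact ⟨(a, b), Prod.ext ha hb⟩
  exact_Y p hp := by
    obtain ⟨a, ha⟩ := H.exact_Y p.1 (congrArg Prod.fst hp)
    obtain ⟨b, hb⟩ := H'.exact_Y p.2 (congrArg Prod.snd hp)
    exact ⟨(a, b), Prod.ext ha hb⟩
  exact_Z p hp := by
    obtain ⟨a, ha⟩ := H.exact_Z p.1 (congrArg Prod.fst hp)
    obtain ⟨b, hb⟩ := H'.exact_Z p.2 (congrArg Prod.snd hp)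
    exact ⟨(a, b), Prod.ext ha hb⟩
  returns p q s p' h := by
    obtain ⟨a, ha⟩ := H.returns p.1 q.1 s.1 p'.1
      ⟨congrArg Prod.fst h.hu, congrArg Prod.fst h.hv, congrArg Prod.fst h.hw⟩
    obtain ⟨b, hb⟩ := H'.returns p.2 q.2 s.2 p'.2
      ⟨congrArg Prod.snd h.hu, congrArg Prod.snd h.hv, congrArg Prod.snd h.hw⟩
    exact ⟨(a, b), (mem_radSubmodule_prod hx).2 ⟨ha, hb⟩⟩

theorem mem_radSubmodule_finsupp {J : Type u} {j : J →₀ R} (h : ∀ i, j i ∈ maxIdeal R) :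
    j ∈ radSubmodule R (J →₀ R) := by
  rw [← Finsupp.sum_single j]
  refine Submodule.sum_mem _ fun i _ => ?_
  rw [← mul_one (j i), ← smul_eq_mul, ← Finsupp.smul_single]
  exact Submodule.smul_mem_smul (h i) trivial

theorem isDistinguished_mulRightFree [IsLocalRing R] (hρ : IsAdmissiblePair x ρ) (J : Type u) :
    IsDistinguished x ρ (mulRightFree J x) (mulRightFree J x) (mulRightFree J (ρ * x)) := by
  have hx := hρ.gen
  have hz : ∀ a b : R, a * b = 0 → ∀ j, mulRightFree J b (mulRightFree J a j) = 0 := by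
    intro a b hab j
    rw [← LinearMap.comp_apply, mulRightFree_comp, hab, mulRightFree_zero, LinearMap.zero_apply]
  have h₁ : x * (ρ * x) = 0 := by rw [← hρ.comm, ← mul_assoc, hx.mul_self, zero_mul]
  have h₂ : ρ * x * x = 0 := by rw [mul_assoc, hx.mul_self, mul_zero]
  -- An element annihilated by `x` from the right is divisible by `x` from the right.
  have hex : ∀ j, mulRightFree J x j = 0 → ∃ j', mulRightFree J x j' = j := by
    intro j hj
    obtain ⟨y, hy⟩ := hx.mem_radSubmodule_iff.1 (mem_radSubmodule_finsupp (j := j) fun i =>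
      (hx.eq_zero_mul_iff _).1 (DFunLike.congr_fun hj i))
    obtain ⟨j', hj'⟩ := hx.exists_smul_eq_mulRightFree y
    exact ⟨j', by rw [← hj', hy]⟩
  obtain ⟨ρ', hρ'⟩ := hρ.isUnit.exists_left_inv
  refine ⟨⟨hz _ _ hx.mul_self, hz _ _ h₁, hz _ _ h₂, ?_, hex, ?_⟩, ?_⟩
  · intro j hj
    obtain ⟨j', hj'⟩ := hex j hj
    refine ⟨mulRightFree J ρ' j', ?_⟩
    rw [← LinearMap.comp_apply, mulRightFree_comp, ← mul_assoc, hρ', one_mul, hj']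
  · intro j hj
    refine hex j ?_
    ext i
    have h : j i * (ρ * x) = 0 := DFunLike.congr_fun hj i
    rw [← hρ.comm, ← mul_assoc, hρ.isUnit.mul_left_eq_zero] at h
    exact h
  · intro p q s p' h
    refine ⟨0, ?_⟩
    rw [map_zero, add_zero]
    refine mem_radSubmodule_finsupp fun i => ?_
    have e₁ : p i * x = x * q i := DFunLike.congr_fun h.hu i
    have e₂ : q i * x = x * s i := DFunLike.congr_fun h.hv i
    have e₃ : s i * (ρ * x) = x * p' i := DFunLike.congr_fun h.hw i
    have e₄ := hρ.cube (p i) (q i) (s i) e₁.symm e₂.symm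
    rw [← hx.mul_eq_zero_iff]
    change x * (p' i - ρ * p i) = 0
    rw [mul_sub, ← e₃, ← mul_assoc x, hρ.comm, e₄, mul_assoc, sub_self]

/-- The five lemma for exact triangles. -/
theorem IsExactTriple.bijective (H : IsExactTriple u v w) (H' : IsExactTriple u' v' w')
    {f : X →ₗ[R] X'} {g : Y →ₗ[R] Y'} {h : Z →ₗ[R] Z'} (hu : ∀ p, g (u p) = u' (f p))
    (hv : ∀ q, h (v q) = v' (g q)) (hw : ∀ s, f (w s) = w' (h s))
    (hf : Function.Bijective f) (hg : Function.Bijective g) : Function.Bijective h := by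
  constructor
  · rw [injective_iff_map_eq_zero]
    intro s hs
    obtain ⟨q, rfl⟩ := H.exact_Z s (hf.1 (by rw [hw, hs, map_zero, map_zero]))
    obtain ⟨p', hp'⟩ := H'.exact_Y (g q) (by rw [← hv, hs])
    obtain ⟨p, rfl⟩ := hf.2 p'
    rw [← hu] at hp'
    rw [← hg.1 hp', H.uv]
  · intro s'
    obtain ⟨p, hp⟩ := hf.2 (w' s')
    obtain ⟨s, rfl⟩ := H.exact_X p (hg.1 (by rw [hu, hp, H'.wu, map_zero]))
    obtain ⟨q', hq'⟩ := H'.exact_Z (s' - h s) (by rw [map_sub, ← hw, hp, sub_self])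
    obtain ⟨q, rfl⟩ := hg.2 q'
    exact ⟨s + v q, by rw [map_add, hv, hq', add_sub_cancel]⟩

end Closure

/-! ### Linear maps underlying morphisms of projective modules -/

section Interface

variable {R : Type u} [Ring R] {k : ProjKind}

/-- The linear map underlying a morphism of projective modules. -/
abbrev toLin {M N : ProjCat R k} (f : M ⟶ N) : M.obj →ₗ[R] N.obj := f.hom.hom

/-- A linear map between projective modules as a morphism. -/
abbrev ofLin {M N : ProjCat R k} (f : M.obj →ₗ[R] N.obj) : M ⟶ N :=
  ObjectProperty.homMk (ModuleCat.ofHom f)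

theorem toLin_ext {M N : ProjCat R k} {f g : M ⟶ N} (h : ∀ m, toLin f m = toLin g m) : f = g :=
  ObjectProperty.hom_ext _ (ModuleCat.hom_ext (LinearMap.ext h))

theorem toLin_comp {M N P : ProjCat R k} (f : M ⟶ N) (g : N ⟶ P) (m : M.obj) :
    toLin (f ≫ g) m = toLin g (toLin f m) := rfl

theorem toLin_congr {M N : ProjCat R k} {f g : M ⟶ N} (h : f = g) (m : M.obj) :
    toLin f m = toLin g m := by rw [h]

instance projective_obj (M : ProjCat R k) : Module.Projective R M.obj := by
  cases k with
  | all => exact M.property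
  | finitelyGenerated => exact M.property.1

theorem projProperty_of_split {M : ProjCat R k} {N : Type u} [AddCommGroup N] [Module R N]
    [hN : Module.Projective R N] (f : M.obj →ₗ[R] N) (hf : Function.Surjective f) :
    projProperty R k (ModuleCat.of R N) := by
  cases k with
  | all => exact hN
  | finitelyGenerated =>
    have : Module.Finite R M.obj := M.property.2
    exact ⟨hN, Module.Finite.of_surjective f hf⟩

theorem isIso_of_bijective {M N : ProjCat R k} (f : M ⟶ N) (hf : Function.Bijective (toLin f)) :
    IsIso f := by
  let e := LinearEquiv.ofBijective (toLin f) hf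
  refine ⟨ofLin e.symm.toLinearMap, toLin_ext fun m => e.symm_apply_apply m,
    toLin_ext fun m => e.apply_symm_apply m⟩

/-- The linear equivalence underlying an isomorphism of projective modules. -/
noncomputable def linEquivOfIsIso {M N : ProjCat R k} (f : M ⟶ N) [IsIso f] : M.obj ≃ₗ[R] N.obj :=
  LinearEquiv.ofLinearMap (toLin f) (toLin (inv f))
    (LinearMap.ext fun m => by
      rw [LinearMap.comp_apply, ← toLin_comp, IsIso.inv_hom_id]; rfl)
    (LinearMap.ext fun m => by
      rw [LinearMap.comp_apply, ← toLin_comp, IsIso.hom_inv_id]; rfl)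

/-- The biproduct of projective modules is their product. -/
noncomputable def biprodLinEquiv (M N : ProjCat R k) : (M ⊞ N).obj ≃ₗ[R] M.obj × N.obj :=
  LinearEquiv.ofLinearMap (LinearMap.prod (toLin biprod.fst) (toLin biprod.snd))
    (LinearMap.coprod (toLin biprod.inl) (toLin biprod.inr))
    (LinearMap.ext fun m => by
      obtain ⟨a, b⟩ := m
      have h₁ := toLin_congr (biprod.inl_fst (X := M) (Y := N)) a
      have h₂ := toLin_congr (biprod.inl_snd (X := M) (Y := N)) a
      have h₃ := toLin_congr (biprod.inr_fst (X := M) (Y := N)) b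
      have h₄ := toLin_congr (biprod.inr_snd (X := M) (Y := N)) b
      rw [toLin_comp] at h₁ h₂ h₃ h₄
      refine Prod.ext ?_ ?_
      · change toLin biprod.fst (toLin biprod.inl a + toLin biprod.inr b) = a
        rw [map_add, h₁, h₃]
        exact add_zero a
      · change toLin biprod.snd (toLin biprod.inl a + toLin biprod.inr b) = b
        rw [map_add, h₂, h₄]
        exact zero_add b)
    (LinearMap.ext fun m => toLin_congr (biprod.total (X := M) (Y := N)) m)

theorem biprodLinEquiv_desc_lift {M N M' N' : ProjCat R k} (a : M ⟶ M') (b : M ⟶ N') (c : N ⟶ M')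
    (d : N ⟶ N') (m : (M ⊞ N).obj) :
    biprodLinEquiv M' N' (toLin (biprod.desc (biprod.lift a b) (biprod.lift c d)) m) =
      (toLin a (biprodLinEquiv M N m).1 + toLin c (biprodLinEquiv M N m).2,
        toLin b (biprodLinEquiv M N m).1 + toLin d (biprodLinEquiv M N m).2) := by
  rw [biprod.desc_eq]
  have h₁ := toLin_congr (biprod.lift_fst a b) (toLin biprod.fst m)
  have h₂ := toLin_congr (biprod.lift_snd a b) (toLin biprod.fst m)
  have h₃ := toLin_congr (biprod.lift_fst c d) (toLin biprod.snd m)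
  have h₄ := toLin_congr (biprod.lift_snd c d) (toLin biprod.snd m)
  rw [toLin_comp] at h₁ h₂ h₃ h₄
  refine Prod.ext ?_ ?_
  · change toLin biprod.fst (toLin (biprod.lift a b) (toLin biprod.fst m) +
      toLin (biprod.lift c d) (toLin biprod.snd m)) = _
    rw [map_add, h₁, h₃]
    rfl
  · change toLin biprod.snd (toLin (biprod.lift a b) (toLin biprod.fst m) +
      toLin (biprod.lift c d) (toLin biprod.snd m)) = _
    rw [map_add, h₂, h₄]
    rfl

theorem biprodLinEquiv_map {M N M' N' : ProjCat R k} (a : M ⟶ M') (d : N ⟶ N') (m : (M ⊞ N).obj) :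
    biprodLinEquiv M' N' (toLin (biprod.map a d) m) =
      (toLin a (biprodLinEquiv M N m).1, toLin d (biprodLinEquiv M N m).2) :=
  Prod.ext (toLin_congr (biprod.map_fst a d) m) (toLin_congr (biprod.map_snd a d) m)

theorem biprodLinEquiv_symm_map {M N M' N' : ProjCat R k} (a : M ⟶ M') (d : N ⟶ N')
    (t : M.obj × N.obj) : (biprodLinEquiv M' N').symm (toLin a t.1, toLin d t.2) =
      toLin (biprod.map a d) ((biprodLinEquiv M N).symm t) := by
  rw [LinearEquiv.symm_apply_eq, biprodLinEquiv_map, LinearEquiv.apply_symm_apply]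

theorem biprodLinEquiv_symm_desc_lift {M N M' N' : ProjCat R k} (a : M ⟶ M') (b : M ⟶ N')
    (c : N ⟶ M') (d : N ⟶ N') (t : M.obj × N.obj) :
    (biprodLinEquiv M' N').symm (toLin a t.1 + toLin c t.2, toLin b t.1 + toLin d t.2) =
      toLin (biprod.desc (biprod.lift a b) (biprod.lift c d)) ((biprodLinEquiv M N).symm t) := by
  rw [LinearEquiv.symm_apply_eq, biprodLinEquiv_desc_lift, LinearEquiv.apply_symm_apply]

end Interface

/-! ### The triangulation `Δ^r` -/

section DeltaTriangulation

variable {R : Type u} [Ring R] {k : ProjKind} {x ρ : R}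

/-- The class of triangles of projective modules satisfying the intrinsic description of `Δ^r`,
for `ρ` a lift of `r`. -/
def distinguishedClass (k : ProjKind) (x ρ : R) : Set (Tri (ProjCat R k)) :=
  {A | IsDistinguished x ρ (toLin A.u) (toLin A.v) (toLin A.w)}

theorem Tri.Isomorphic.symm {C : Type*} [Category C] [Preadditive C] {A B : Tri C}
    (h : A.Isomorphic B) : B.Isomorphic A := by
  obtain ⟨φ, hf, hg, hh⟩ := h
  exact ⟨⟨inv φ.f, inv φ.g, inv φ.h, by
      rw [IsIso.comp_inv_eq, Category.assoc, φ.comm_u, IsIso.inv_hom_id_assoc], by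
      rw [IsIso.comp_inv_eq, Category.assoc, φ.comm_v, IsIso.inv_hom_id_assoc], by
      rw [IsIso.comp_inv_eq, Category.assoc, φ.comm_w, IsIso.inv_hom_id_assoc]⟩,
    inferInstance, inferInstance, inferInstance⟩

theorem distinguishedClass_of_isomorphic (hx : IsRadicalGenerator x) {A B : Tri (ProjCat R k)}
    (h : A.Isomorphic B) (hA : A ∈ distinguishedClass k x ρ) : B ∈ distinguishedClass k x ρ := by
  obtain ⟨φ, hf, hg, hh⟩ := h
  exact hA.of_equiv hx (linEquivOfIsIso φ.f) (linEquivOfIsIso φ.g) (linEquivOfIsIso φ.h)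
    (toLin_congr φ.comm_u) (toLin_congr φ.comm_v) (toLin_congr φ.comm_w)

theorem distinguishedClass_of_contractible [IsLocalRing R] (hx : IsRadicalGenerator x)
    {A : Tri (ProjCat R k)} (h : A.Contractible) : A ∈ distinguishedClass k x ρ := by
  obtain ⟨Θ, Φ, Ψ, hY, hZ, hX⟩ := h
  exact isDistinguished_of_contraction hx (toLin_congr A.uv) (toLin_congr A.vw)
    (toLin_congr A.wu) (toLin Θ) (toLin Φ) (toLin Ψ) (toLin_congr hY) (toLin_congr hZ)
    (toLin_congr hX)

theorem distinguishedClass_sum (hx : IsRadicalGenerator x) {A B : Tri (ProjCat R k)}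
    (hA : A ∈ distinguishedClass k x ρ) (hB : B ∈ distinguishedClass k x ρ) :
    A.sum B ∈ distinguishedClass k x ρ := by
  refine (IsDistinguished.prodMap hx hA hB).of_equiv hx (biprodLinEquiv A.X B.X).symm
    (biprodLinEquiv A.Y B.Y).symm (biprodLinEquiv A.Z B.Z).symm ?_ ?_ ?_
  all_goals exact biprodLinEquiv_symm_map _ _

theorem contractible_ofId (X : ProjCat R k) : (Tri.ofId X).Contractible := by
  refine ⟨𝟙 X, 0, 0, ?_, (isZero_zero _).eq_of_src _ _, ?_⟩
  · change 𝟙 X = (0 : X ⟶ 0) ≫ (0 : (0 : ProjCat R k) ⟶ X) + 𝟙 X ≫ 𝟙 X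
    simp
  · change 𝟙 X = 𝟙 X ≫ 𝟙 X + (0 : X ⟶ 0) ≫ (0 : (0 : ProjCat R k) ⟶ X)
    simp

/-- The contractible triangle `(F₀ × F₁ ⟶ F₁ × F₂ ⟶ F₂ × F₀ ⟶ F₀ × F₁)`. -/
theorem exists_contractible (F₀ F₁ F₂ : ProjCat R k) :
    ∃ C : Tri (ProjCat R k), C.Contractible ∧
      ∃ (eX : C.X.obj ≃ₗ[R] F₀.obj × F₁.obj) (eY : C.Y.obj ≃ₗ[R] F₁.obj × F₂.obj),
        ∀ p, eY (toLin C.u p) = ((eX p).2, 0) := by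
  let P (M N : ProjCat R k) : ProjCat R k :=
    ⟨ModuleCat.of R (M.obj × N.obj), projProperty_prod R k _ _ M.property N.property⟩
  let s (M N K : ProjCat R k) : P M N ⟶ P N K :=
    ofLin (M := P M N) (N := P N K) (LinearMap.inl R N.obj K.obj ∘ₗ LinearMap.snd R M.obj N.obj)
  let t (M N K : ProjCat R k) : P N K ⟶ P M N :=
    ofLin (M := P N K) (N := P M N) (LinearMap.inr R M.obj N.obj ∘ₗ LinearMap.fst R N.obj K.obj)
  have hs : ∀ L M N K, s L M N ≫ s M N K = 0 := fun L M N K => rfl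
  have ht : ∀ L M N K : ProjCat R k, 𝟙 (P M N) = s M N K ≫ t M N K + t L M N ≫ s L M N := by
    intro L M N K
    refine toLin_ext fun (p : M.obj × N.obj) => ?_
    change p = ((0, p.2) : M.obj × N.obj) + (p.1, 0)
    simp
  refine ⟨⟨P F₀ F₁, P F₁ F₂, P F₂ F₀, s _ _ _, s _ _ _, s _ _ _, hs _ _ _ _, hs _ _ _ _,
    hs _ _ _ _⟩, ⟨t _ _ _, t _ _ _, t _ _ _, ht _ _ _ _, ht _ _ _ _, ht _ _ _ _⟩,
    LinearEquiv.refl R _, LinearEquiv.refl R _, fun p => rfl⟩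

variable [IsLocalRing R]

theorem deltaTri_mem_distinguishedClass (hρ : IsAdmissiblePair x ρ) (ι : Type u)
    (hι : projProperty R k (ModuleCat.of R (ι →₀ R))) :
    deltaTri hρ.gen.cond k hρ.gen.mem ρ ι hι ∈ distinguishedClass k x ρ :=
  isDistinguished_mulRightFree hρ ι

theorem deltaClass_subset (hρ : IsAdmissiblePair x ρ) :
    deltaClass hρ.gen.cond k hρ.gen.mem ρ ⊆ distinguishedClass k x ρ := by
  rintro A ⟨B, ι, hι, hB, hA⟩
  exact distinguishedClass_of_isomorphic hρ.gen hA (distinguishedClass_sum hρ.gen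
    (distinguishedClass_of_contractible hρ.gen hB) (deltaTri_mem_distinguishedClass hρ ι hι))

/-- Every morphism is isomorphic to the first map of a direct sum of a contractible triangle and
copies of the triangle `R ⟶ R ⟶ R ⟶ R`. -/
theorem exists_deltaTri_sum (hx : IsRadicalGenerator x) (ρ : R) {X Y : ProjCat R k} (u : X ⟶ Y) :
    ∃ (B : Tri (ProjCat R k)) (ι : Type u) (hι : projProperty R k (ModuleCat.of R (ι →₀ R))),
      B.Contractible ∧
      ∃ (f : (B.sum (deltaTri hx.cond k hx.mem ρ ι hι)).X ⟶ X)
        (g : (B.sum (deltaTri hx.cond k hx.mem ρ ι hι)).Y ⟶ Y),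
        IsIso f ∧ IsIso g ∧ (B.sum (deltaTri hx.cond k hx.mem ρ ι hι)).u ≫ g = f ≫ u := by
  obtain ⟨I₀, I₁, J, K, α, β, hK, h⟩ := hx.exists_normal_form (toLin u)
  have hα : ∀ {N : Type u} [AddCommGroup N] [Module R N] [Module.Projective R N]
      (f : (((I₀ →₀ R) × (I₁ →₀ R)) × (J →₀ R)) →ₗ[R] N), Function.Surjective f →
      projProperty R k (ModuleCat.of R N) := fun f hf =>
    projProperty_of_split (M := X) (f ∘ₗ α.symm.toLinearMap) (hf.comp α.symm.surjective)
  have hI₀ : projProperty R k (ModuleCat.of R (I₀ →₀ R)) :=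
    hα (LinearMap.fst R _ _ ∘ₗ LinearMap.fst R _ _)
      fun a => ⟨((a, 0), 0), rfl⟩
  have hI₁ : projProperty R k (ModuleCat.of R (I₁ →₀ R)) :=
    hα (LinearMap.snd R _ _ ∘ₗ LinearMap.fst R _ _)
      fun a => ⟨((0, a), 0), rfl⟩
  have hJ : projProperty R k (ModuleCat.of R (J →₀ R)) :=
    hα (LinearMap.snd R _ _) fun a => ⟨(0, a), rfl⟩
  have hK : projProperty R k (ModuleCat.of R K) :=
    projProperty_of_split (M := Y)
      ((LinearMap.snd R _ _ ∘ₗ LinearMap.fst R _ _ :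
        (((I₁ →₀ R) × K) × (J →₀ R)) →ₗ[R] K) ∘ₗ β.symm.toLinearMap)
      fun a => ⟨β ((0, a), 0), by simp⟩
  obtain ⟨C, hC, eX, eY, he⟩ := exists_contractible (R := R) (k := k) ⟨_, hI₀⟩ ⟨_, hI₁⟩ ⟨_, hK⟩
  let D := deltaTri hx.cond k hx.mem ρ J hJ
  let eX' : (C.X ⊞ D.X).obj ≃ₗ[R] X.obj := (biprodLinEquiv C.X D.X).trans
    ((eX.prodCongr (LinearEquiv.refl R _)).trans α)
  let eY' : (C.Y ⊞ D.Y).obj ≃ₗ[R] Y.obj := (biprodLinEquiv C.Y D.Y).trans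
    ((eY.prodCongr (LinearEquiv.refl R _)).trans β)
  refine ⟨C, J, hJ, hC, ofLin eX'.toLinearMap, ofLin eY'.toLinearMap,
    isIso_of_bijective _ eX'.bijective, isIso_of_bijective _ eY'.bijective, toLin_ext fun m => ?_⟩
  let p := biprodLinEquiv C.X D.X m
  have h₁ : biprodLinEquiv C.Y D.Y (toLin (biprod.map C.u D.u) m) =
    (toLin C.u p.1, mulRightFree J x p.2) := biprodLinEquiv_map C.u D.u m
  have h₂ : eY'.toLinearMap (toLin (biprod.map C.u D.u) m) =
      β (eY (toLin C.u p.1), mulRightFree J x p.2) :=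
    congrArg (fun t : C.Y.obj × D.Y.obj => β (eY t.1, t.2)) h₁
  rw [he] at h₂
  exact h₂.trans (h (eX p.1).1 (eX p.1).2 p.2).symm

/-- Distinguished triangles with isomorphic first maps are isomorphic. -/
theorem isomorphic_of_distinguishedClass (hx : IsRadicalGenerator x) {A B : Tri (ProjCat R k)}
    (hA : A ∈ distinguishedClass k x ρ) (hB : B ∈ distinguishedClass k x ρ) {f : A.X ⟶ B.X}
    {g : A.Y ⟶ B.Y} [IsIso f] [IsIso g] (hfg : A.u ≫ g = f ≫ B.u) : A.Isomorphic B := by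
  obtain ⟨h, hv, hw⟩ := IsDistinguished.exists_fill hx hA hB (toLin f) (toLin g) (toLin_congr hfg)
  exact ⟨⟨f, g, ofLin h, hfg, toLin_ext hv, toLin_ext fun s => (hw s).symm⟩, ‹_›, ‹_›,
    isIso_of_bijective _ (hA.toIsExactTriple.bijective hB.toIsExactTriple (toLin_congr hfg) hv
      (fun s => (hw s).symm) (linEquivOfIsIso f).bijective (linEquivOfIsIso g).bijective)⟩

/-- The class generated by `(x, x, ρ x)` is the intrinsically described one. -/
theorem deltaClass_eq (hρ : IsAdmissiblePair x ρ) :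
    deltaClass hρ.gen.cond k hρ.gen.mem ρ = distinguishedClass k x ρ := by
  refine (deltaClass_subset hρ).antisymm fun A hA => ?_
  obtain ⟨B, ι, hι, hB, f, g, hf, hg, hfg⟩ := exists_deltaTri_sum hρ.gen ρ A.u
  exact ⟨B, ι, hι, hB, isomorphic_of_distinguishedClass hρ.gen (distinguishedClass_sum hρ.gen
    (distinguishedClass_of_contractible hρ.gen hB) (deltaTri_mem_distinguishedClass hρ ι hι))
    hA hfg⟩

theorem exists_mem_distinguishedClass (hρ : IsAdmissiblePair x ρ) {X Y : ProjCat R k} (u : X ⟶ Y) :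
    ∃ D ∈ distinguishedClass k x ρ, ∃ (f : D.X ⟶ X) (g : D.Y ⟶ Y),
      IsIso f ∧ IsIso g ∧ D.u ≫ g = f ≫ u := by
  obtain ⟨B, ι, hι, hB, h⟩ := exists_deltaTri_sum hρ.gen ρ u
  exact ⟨_, distinguishedClass_sum hρ.gen (distinguishedClass_of_contractible hρ.gen hB)
    (deltaTri_mem_distinguishedClass hρ ι hι), h⟩

/-- For an admissible pair, the class `Δ^r` is a triangulation. -/
noncomputable def deltaTriangulation (k : ProjKind) (hρ : IsAdmissiblePair x ρ) :
    Triangulation (ProjCat R k) where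
  dist := distinguishedClass k x ρ
  iso_mem _ _ h hA := distinguishedClass_of_isomorphic hρ.gen h hA
  id_mem X := distinguishedClass_of_contractible hρ.gen (contractible_ofId X)
  exists_mem {X Y} u := by
    obtain ⟨D, hD, f, g, hf, hg, hfg⟩ := exists_mem_distinguishedClass hρ u
    have hu : u = inv f ≫ D.u ≫ g := by rw [hfg, IsIso.inv_hom_id_assoc]
    refine ⟨D.Z, inv g ≫ D.v, D.w ≫ f, ?_, ?_, ?_, ?_⟩
    · simp [hu, D.uv]
    · have := D.vw
      simp [reassoc_of% this]
    · have := D.wu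
      simp [hu, reassoc_of% this]
    · exact distinguishedClass_of_isomorphic hρ.gen
        ⟨⟨f, g, 𝟙 _, hfg, by simp, by simp⟩, hf, hg, inferInstance⟩ hD
  translate_mem_iff A := ⟨fun h => IsDistinguished.rotate hρ h,
    fun h => IsDistinguished.of_rotate hρ h⟩
  exists_mor A B hA hB f g hfg := by
    obtain ⟨h, hv, hw, hc⟩ := IsDistinguished.exists_fill_cone hρ hA hB (toLin f) (toLin g)
      (toLin_congr hfg)
    refine ⟨⟨f, g, ofLin h, hfg, toLin_ext hv, toLin_ext hw⟩, rfl, rfl, ?_⟩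
    have key : ∀ {M N M' N' : ProjCat R k} (a : M ⟶ M') (b : M ⟶ N') (d : N ⟶ N')
        (t : M.obj × N.obj), (biprodLinEquiv M' N').symm (coneMap (toLin a) (toLin b) (toLin d) t) =
          toLin (biprod.desc (biprod.lift (-a) b) (biprod.lift 0 d))
            ((biprodLinEquiv M N).symm t) := by
      intro M N M' N' a b d t
      rw [← biprodLinEquiv_symm_desc_lift]
      refine congrArg _ (Prod.ext ?_ rfl)
      exact (add_zero _).symm
    exact hc.of_equiv hρ.gen (biprodLinEquiv A.Y B.X).symm
      (biprodLinEquiv A.Z B.Y).symm (biprodLinEquiv A.X B.Z).symm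
      (key A.v g B.u) (key A.w (ofLin h) B.v) (key A.u f B.w)

end DeltaTriangulation

/-! ### Arbitrary triangulations -/

section Arbitrary

variable {R : Type u} [Ring R] {k : ProjKind} {x ρ : R}

/-- The ring `R` as a projective left module. -/
abbrev regObj (R : Type u) [Ring R] (k : ProjKind) : ProjCat R k :=
  ⟨ModuleCat.of R R, by
    have h : Module.Projective R R := inferInstance
    cases k with
    | all => exact h
    | finitelyGenerated => exact ⟨h, (inferInstance : Module.Finite R R)⟩⟩

/-- The morphism `R ⟶ M` sending `1` to `m`. -/
def regHom {M : ProjCat R k} (m : M.obj) : regObj R k ⟶ M :=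
  ofLin (M := regObj R k) (LinearMap.toSpanSingleton R M.obj m)

theorem regHom_apply {M : ProjCat R k} (m : M.obj) (r : R) : toLin (regHom m) r = r • m := rfl

theorem toLin_apply_eq_smul {M : ProjCat R k} (f : regObj R k ⟶ M) (r : R) :
    toLin f r = r • toLin f (1 : R) := by
  refine Eq.trans ?_ ((toLin f).map_smul r (1 : R))
  exact congrArg (toLin f) (mul_one r).symm

theorem regHom_ext {M : ProjCat R k} {f g : regObj R k ⟶ M}
    (h : toLin f (1 : R) = toLin g (1 : R)) : f = g := by
  refine toLin_ext fun (r : R) => ?_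
  rw [toLin_apply_eq_smul f r, toLin_apply_eq_smul g r, h]

namespace Triangulation

variable (T : Triangulation (ProjCat R k))

theorem exact_Y {A : Tri (ProjCat R k)} (hA : A ∈ T.dist) {q : A.Y.obj} (hq : toLin A.v q = 0) :
    ∃ p, toLin A.u p = q := by
  have h : regHom q ≫ A.v = 0 := regHom_ext (by
    change toLin A.v ((1 : R) • q) = 0
    rw [one_smul, hq])
  obtain ⟨φ, hf, -, -⟩ := T.exists_mor (Tri.ofId (regObj R k)).translate A.translate
    ((T.translate_mem_iff _).1 (T.id_mem _)) ((T.translate_mem_iff _).1 hA) (regHom q) 0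
    (h.symm ▸ comp_zero)
  have hw := toLin_congr φ.comm_w (1 : R)
  rw [hf] at hw
  have hw' : toLin (regHom q) (-1 : R) = -toLin A.u (toLin φ.h (1 : R)) := hw
  rw [regHom_apply, neg_smul, one_smul, neg_inj] at hw'
  exact ⟨_, hw'.symm⟩

/-- Distinguished triangles are exact, because `R` corepresents the underlying set of a module. -/
theorem isExactTriple {A : Tri (ProjCat R k)} (hA : A ∈ T.dist) :
    IsExactTriple (toLin A.u) (toLin A.v) (toLin A.w) where
  uv := toLin_congr A.uv
  vw := toLin_congr A.vw
  wu := toLin_congr A.wu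
  exact_X p hp := by
    refine T.exact_Y (A := A.translate.translate) ((T.translate_mem_iff _).1
      ((T.translate_mem_iff _).1 hA)) (q := p) ?_
    change -toLin A.u p = 0
    rw [hp, neg_zero]
  exact_Y q hq := T.exact_Y hA hq
  exact_Z s hs := T.exact_Y (A := A.translate) ((T.translate_mem_iff _).1 hA) hs

end Triangulation

/-- The triangle `R ⟶ R ⟶ R ⟶ R` with maps right multiplication by `x`, `x`, `ρ x`. -/
def regTri (k : ProjKind) (hx : IsRadicalGenerator x) (ρ : R) : Tri (ProjCat R k) where
  X := regObj R k
  Y := regObj R k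
  Z := regObj R k
  u := regHom (M := regObj R k) x
  v := regHom (M := regObj R k) x
  w := regHom (M := regObj R k) (ρ * x)
  uv := regHom_ext (by
    change (1 * x) * x = 0
    rw [mul_assoc, hx.mul_self, mul_zero])
  vw := regHom_ext (by
    change (1 * x) * (ρ * x) = 0
    rw [one_mul, hx.cond.mul_eq_zero x hx.mem _ (Ideal.mul_mem_left _ ρ hx.mem)])
  wu := regHom_ext (by
    change (1 * (ρ * x)) * x = 0
    rw [one_mul, mul_assoc, hx.mul_self, mul_zero])

theorem isomorphic_regTri (hx : IsRadicalGenerator x)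
    (hι : projProperty R k (ModuleCat.of R (PUnit.{u + 1} →₀ R))) :
    (deltaTri hx.cond k hx.mem ρ PUnit hι).Isomorphic (regTri k hx ρ) := by
  let e : (PUnit.{u + 1} →₀ R) ≃ₗ[R] R := Finsupp.uniqueLinearEquiv R R PUnit.unit
  let f : (⟨ModuleCat.of R (PUnit.{u + 1} →₀ R), hι⟩ : ProjCat R k) ⟶ regObj R k :=
    ofLin (M := ⟨ModuleCat.of R (PUnit.{u + 1} →₀ R), hι⟩) (N := regObj R k) e.toLinearMap
  have hf : IsIso f := isIso_of_bijective f e.bijective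
  exact ⟨⟨f, f, f, rfl, rfl, rfl⟩, hf, hf, hf⟩

theorem projProperty_punit_finsupp (R : Type u) [Ring R] (k : ProjKind) :
    projProperty R k (ModuleCat.of R (PUnit.{u + 1} →₀ R)) :=
  projProperty_of_split (M := regObj R k)
    (Finsupp.uniqueLinearEquiv R R PUnit.unit).symm.toLinearMap
    (Finsupp.uniqueLinearEquiv R R PUnit.unit.{u + 1}).symm.surjective

theorem deltaTri_mem_deltaClass (hx : IsRadicalGenerator x) (ι : Type u)
    (hι : projProperty R k (ModuleCat.of R (ι →₀ R))) :
    deltaTri hx.cond k hx.mem ρ ι hι ∈ deltaClass hx.cond k hx.mem ρ := by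
  have key : ∀ M : ProjCat R k, IsIso (biprod.snd : (0 : ProjCat R k) ⊞ M ⟶ M) := fun M =>
    ⟨biprod.inr, by
      refine biprod.hom_ext' _ _ ((isZero_zero (ProjCat R k)).eq_of_src _ _) ?_
      simp, biprod.inr_snd⟩
  exact ⟨Tri.ofId 0, ι, hι, contractible_ofId 0,
    ⟨biprod.snd, biprod.snd, biprod.snd, biprod.map_snd _ _, biprod.map_snd _ _,
      biprod.map_snd _ _⟩, key _, key _, key _⟩

variable [IsLocalRing R]

theorem isExactTriple_regTri (hx : IsRadicalGenerator x) (hρ : IsUnit ρ) :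
    IsExactTriple (toLin (regTri k hx ρ).u) (toLin (regTri k hx ρ).v)
      (toLin (regTri k hx ρ).w) := by
  have hex : ∀ r : R, r * x = 0 → ∃ s : R, s * x = r := by
    intro r hr
    have h : r ∈ (maxIdeal R : Set R) := (hx.eq_zero_mul_iff r).1 hr
    rwa [hx.cond.eq_left x hx.mem hx.ne_zero] at h
  obtain ⟨ρ', hρ'⟩ := hρ.exists_left_inv
  refine ⟨toLin_congr (regTri k hx ρ).uv, toLin_congr (regTri k hx ρ).vw,
    toLin_congr (regTri k hx ρ).wu, ?_, hex, ?_⟩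
  · intro (r : R) (hr : r * x = 0)
    obtain ⟨s, rfl⟩ := hex r hr
    refine ⟨s * ρ', ?_⟩
    change s * ρ' * (ρ * x) = s * x
    rw [mul_assoc, ← mul_assoc ρ', hρ', one_mul]
  · intro (r : R) (hr : r * (ρ * x) = 0)
    refine hex r ?_
    rw [← mul_assoc, hx.eq_zero_mul_iff, mem_maxIdeal_iff] at hr
    rw [hx.eq_zero_mul_iff, mem_maxIdeal_iff]
    exact fun h => hr (h.mul hρ)

namespace Triangulation

variable (T : Triangulation (ProjCat R k))

/-- In any triangulation, the cone of `x : R ⟶ R` is `R`, and the resulting triangle has the form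
`(x, x, ρ x)` with `ρ` a unit. -/
theorem exists_regTri_mem (hx : IsRadicalGenerator x) :
    ∃ ρ : R, IsUnit ρ ∧ regTri k hx ρ ∈ T.dist := by
  obtain ⟨Z, v, w, uv, vw, wu, hT⟩ := T.exists_mem (regHom (M := regObj R k) x)
  have H := T.isExactTriple hT
  set A : Tri (ProjCat R k) := ⟨_, _, Z, regHom (M := regObj R k) x, v, w, uv, vw, wu⟩
  have h₁ : x • toLin v (1 : R) = 0 := by
    rw [← toLin_apply_eq_smul]
    exact (congrArg (toLin v) (one_mul x).symm).trans (H.uv (1 : R))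
  obtain ⟨z, hz⟩ := hx.mem_radSubmodule_iff.1 (hx.mem_of_smul_eq_zero h₁)
  have h₂ : x • z ≠ 0 := by
    intro h
    obtain ⟨r, hr⟩ := H.exact_Y (1 : R) (hz.trans h)
    have h1 : (1 : R) ∈ maxIdeal R := hr ▸ Ideal.mul_mem_left _ (r : R) hx.mem
    exact (mem_maxIdeal_iff _).1 h1 isUnit_one
  have h₃ : toLin w z ∈ (maxIdeal R : Set R) := (hx.eq_zero_mul_iff _).1 (H.wu z)
  rw [hx.cond.eq_left x hx.mem hx.ne_zero] at h₃
  obtain ⟨ρ, hρ⟩ := h₃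
  have hρu : IsUnit ρ := by
    by_contra hρu
    have h₄ : toLin w z = 0 :=
      hρ.symm.trans ((hx.eq_zero_mul_iff ρ).2 ((mem_maxIdeal_iff ρ).2 hρu))
    obtain ⟨t, ht⟩ := H.exact_Z z h₄
    have h₅ : z = (t : R) • toLin v (1 : R) := ht.symm.trans (toLin_apply_eq_smul v t)
    obtain ⟨t', ht'⟩ := hx.exists_smul_comm (M := Z.obj) t
    rw [hz, ht'] at h₅
    exact h₂ (by rw [h₅, hx.smul_smul])
  have hv : (regTri k hx ρ).v ≫ regHom z = 𝟙 _ ≫ v := regHom_ext (by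
    change ((1 : R) * x) • z = toLin v (1 : R)
    rw [one_mul, hz])
  have hw : (regTri k hx ρ).w ≫ 𝟙 _ = regHom z ≫ w := regHom_ext (by
    change (1 : R) * (ρ * x) = toLin w ((1 : R) • z)
    rw [one_mul, one_smul]
    exact hρ)
  let φ : Tri.Mor (regTri k hx ρ) A := ⟨𝟙 _, 𝟙 _, regHom z, rfl, hv, hw⟩
  have hφ : IsIso φ.h := isIso_of_bijective _ ((isExactTriple_regTri hx hρu).bijective H
    (f := toLin (𝟙 (regObj R k))) (g := toLin (𝟙 (regObj R k))) (fun p => rfl)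
    (toLin_congr hv) (toLin_congr hw) Function.bijective_id Function.bijective_id)
  exact ⟨ρ, hρu, T.iso_mem _ _ (Tri.Isomorphic.symm
    ⟨φ, (inferInstance : IsIso (𝟙 _)), (inferInstance : IsIso (𝟙 _)), hφ⟩) hT⟩

variable {T}

/-- Comparing `(x, x, ρ x)` with its translate `(x, ρ x, -x)`. -/
theorem mul_comm_neg_of_regTri_mem (hx : IsRadicalGenerator x) (hT : regTri k hx ρ ∈ T.dist) :
    x * ρ = -(ρ * x) := by
  obtain ⟨φ, hf, hg, -⟩ := T.exists_mor (regTri k hx ρ) (regTri k hx ρ).translate hT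
    ((T.translate_mem_iff _).1 hT) (𝟙 (regObj R k)) (𝟙 (regObj R k)) rfl
  let c : R := toLin φ.h (1 : R)
  have hv : x * c = ρ * x := by
    have h := toLin_congr φ.comm_v (1 : R)
    rw [hg] at h
    have h' : toLin φ.h ((1 : R) * x) = (1 : R) * (ρ * x) := h
    rw [one_mul, one_mul] at h'
    exact (toLin_apply_eq_smul φ.h x).symm.trans h'
  have hw : ρ * x = -(c * x) := by
    have h := toLin_congr φ.comm_w (1 : R)
    rw [hf] at h
    have h' : (1 : R) * (ρ * x) = -(c * x) := h
    rwa [one_mul] at h'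
  have h : c + ρ ∈ maxIdeal R := (hx.eq_zero_mul_iff _).1 (by rw [add_mul, hw, add_neg_cancel])
  have h' := (hx.mul_eq_zero_iff _).2 h
  rw [mul_add, hv] at h'
  exact eq_neg_of_add_eq_zero_right h'

/-- Extending the square given by right multiplication by `a` and `b` to an endomorphism of
`(x, x, ρ x)`. -/
theorem cube_of_regTri_mem (hx : IsRadicalGenerator x) (hT : regTri k hx ρ ∈ T.dist) (a b c : R)
    (hab : x * b = a * x) (hbc : x * c = b * x) : ρ * x * a = c * ρ * x := by
  obtain ⟨φ, hf, hg, -⟩ := T.exists_mor (regTri k hx ρ) (regTri k hx ρ) hT hT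
    (regHom (M := regObj R k) a) (regHom (M := regObj R k) b) (regHom_ext (by
      change ((1 : R) * x) * b = ((1 : R) * a) * x
      rw [one_mul, one_mul, hab]))
  let c' : R := toLin φ.h (1 : R)
  have hv : x * c' = b * x := by
    have h := toLin_congr φ.comm_v (1 : R)
    rw [hg] at h
    have h' : toLin φ.h ((1 : R) * x) = ((1 : R) * b) * x := h
    rw [one_mul, one_mul] at h'
    exact (toLin_apply_eq_smul φ.h x).symm.trans h'
  have hw : ρ * x * a = c' * (ρ * x) := by
    have h := toLin_congr φ.comm_w (1 : R)
    rw [hf] at h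
    have h' : (1 : R) * (ρ * x) * a = c' * (ρ * x) := h
    rwa [one_mul] at h'
  have h : c' - c ∈ maxIdeal R := (hx.mul_eq_zero_iff _).1 (by rw [mul_sub, hv, hbc, sub_self])
  rw [hw, mul_assoc, ← sub_eq_zero, ← sub_mul]
  exact hx.cond.mul_eq_zero _ h _ (Ideal.mul_mem_left _ ρ hx.mem)

theorem isAdmissiblePair_of_regTri_mem (hx : IsRadicalGenerator x) (h2 : (2 : R) ∈ maxIdeal R)
    (hρ : IsUnit ρ) (hT : regTri k hx ρ ∈ T.dist) : IsAdmissiblePair x ρ where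
  gen := hx
  two_mem := h2
  isUnit := hρ
  comm := by
    have h : (2 : R) * (ρ * x) = 0 :=
      hx.cond.mul_eq_zero _ h2 _ (Ideal.mul_mem_left _ ρ hx.mem)
    rw [mul_comm_neg_of_regTri_mem hx hT, neg_eq_iff_add_eq_zero, ← two_mul, h]
  cube := cube_of_regTri_mem hx hT

/-- A triangulation containing `(x, x, ρ x)` consists of the triangles with the intrinsic
properties of `Δ^r`. Mapping `R` into a distinguished triangle gives one inclusion; as the cone of a
morphism is unique up to isomorphism in the larger class, the other one follows. -/
theorem dist_eq_distinguishedClass (hρ : IsAdmissiblePair x ρ)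
    (hT : regTri k hρ.gen ρ ∈ T.dist) : T.dist = distinguishedClass k x ρ := by
  have hx := hρ.gen
  have hle : T.dist ⊆ distinguishedClass k x ρ := by
    intro A hA
    refine ⟨T.isExactTriple hA, fun p q s p' hc => ?_⟩
    obtain ⟨φ, hf, hg, -⟩ := T.exists_mor (regTri k hx ρ) A hT hA (regHom p) (regHom q)
      (regHom_ext (by
        change ((1 : R) * x) • q = toLin A.u ((1 : R) • p)
        rw [one_mul, one_smul, hc.hu]))
    let s₀ : A.Z.obj := toLin φ.h (1 : R)
    have hv : x • s₀ = x • s := by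
      have h := toLin_congr φ.comm_v (1 : R)
      rw [hg] at h
      have h' : toLin φ.h ((1 : R) * x) = toLin A.v ((1 : R) • q) := h
      rw [one_mul, one_smul, hc.hv] at h'
      exact (toLin_apply_eq_smul φ.h x).symm.trans h'
    have hw : (ρ * x) • p = toLin A.w s₀ := by
      have h := toLin_congr φ.comm_w (1 : R)
      rw [hf] at h
      have h' : ((1 : R) * (ρ * x)) • p = toLin A.w s₀ := h
      rwa [one_mul] at h'
    obtain ⟨y, hy⟩ := hx.mem_radSubmodule_iff.1 (hx.sub_mem_of_smul_eq hv.symm)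
    refine ⟨y, hx.sub_mem_of_smul_eq ?_⟩
    rw [← hc.hw, show s = s₀ + x • y by rw [← hy]; abel, map_add, ← hw, map_smul, smul_add,
      ← mul_smul, hρ.comm]
  refine hle.antisymm fun A hA => ?_
  obtain ⟨Z, v, w, uv, vw, wu, hB⟩ := T.exists_mem A.u
  exact T.iso_mem _ _ (isomorphic_of_distinguishedClass hx (hle hB) hA (f := 𝟙 A.X) (g := 𝟙 A.Y)
    rfl) hB

/-- With respect to `x`, every triangulation is the one of an admissible pair. -/
theorem exists_isAdmissiblePair (T : Triangulation (ProjCat R k)) (hx : IsRadicalGenerator x)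
    (h2 : (2 : R) ∈ maxIdeal R) :
    ∃ ρ, IsAdmissiblePair x ρ ∧ T.dist = distinguishedClass k x ρ := by
  obtain ⟨ρ, hρ, hT⟩ := T.exists_regTri_mem hx
  have h := isAdmissiblePair_of_regTri_mem hx h2 hρ hT
  exact ⟨ρ, h, dist_eq_distinguishedClass h hT⟩

theorem isAdmissiblePair_of_dist_eq_deltaClass (hx : IsRadicalGenerator x)
    (h2 : (2 : R) ∈ maxIdeal R) (hρ : IsUnit ρ) (hT : T.dist = deltaClass hx.cond k hx.mem ρ) :
    IsAdmissiblePair x ρ :=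
  isAdmissiblePair_of_regTri_mem hx h2 hρ (T.iso_mem _ _
    (isomorphic_regTri hx (projProperty_punit_finsupp R k))
    (hT ▸ deltaTri_mem_deltaClass hx _ _))

end Triangulation

end Arbitrary

/-! ### Equivalences of triangulations -/

section Equivalences

variable {R : Type u} [Ring R] {k : ProjKind} {x ρ ρ' : R}

/-- Multiplication by a central element, as an endomorphism of the identity functor. -/
def centralNatTrans (k : ProjKind) (c : R) (hc : ∀ r, r * c = c * r) :
    𝟭 (ProjCat R k) ⟶ 𝟭 (ProjCat R k) where
  app M := ofLin (M := M) (N := M)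
    { toFun := fun m => c • m
      map_add' := smul_add c
      map_smul' := fun r m => by rw [← mul_smul, ← hc, mul_smul, RingHom.id_apply] }
  naturality _ _ f := toLin_ext fun m => ((toLin f).map_smul c m).symm

/-- Multiplication by a central unit, as an automorphism of the identity functor. -/
def centralNatIso (k : ProjKind) (c c' : R) (hc : ∀ r, r * c = c * r) (hc' : ∀ r, r * c' = c' * r)
    (h : c * c' = 1) : 𝟭 (ProjCat R k) ≅ 𝟭 (ProjCat R k) where
  hom := centralNatTrans k c hc
  inv := centralNatTrans k c' hc'
  hom_inv_id := by
    refine NatTrans.ext (funext fun M => toLin_ext fun m => ?_)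
    change c' • c • m = m
    rw [← mul_smul, hc, h, one_smul]
  inv_hom_id := by
    refine NatTrans.ext (funext fun M => toLin_ext fun m => ?_)
    change c • c' • m = m
    rw [← mul_smul, h, one_smul]

/-- The value at `1 ∈ R` of an endomorphism of the identity functor. -/
def natTransScalar (η : 𝟭 (ProjCat R k) ⟶ 𝟭 (ProjCat R k)) : R :=
  toLin (η.app (regObj R k)) (1 : R)

/-- An endomorphism of the identity functor is multiplication by its value at `1 ∈ R`. -/
theorem natTrans_app_apply (η : 𝟭 (ProjCat R k) ⟶ 𝟭 (ProjCat R k)) (M : ProjCat R k) (m : M.obj) :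
    toLin (η.app M) m = natTransScalar η • m := by
  have h := toLin_congr (η.naturality (regHom m)) (1 : R)
  have h' : toLin (η.app M) ((1 : R) • m) = natTransScalar η • m := h
  rwa [one_smul] at h'

theorem natTrans_app_one_central (η : 𝟭 (ProjCat R k) ⟶ 𝟭 (ProjCat R k)) (r : R) :
    r * natTransScalar η = natTransScalar η * r :=
  (toLin_apply_eq_smul (η.app (regObj R k)) r).symm.trans
    (natTrans_app_apply η (regObj R k) r)

theorem natIso_app_one_isUnit (η : 𝟭 (ProjCat R k) ≅ 𝟭 (ProjCat R k)) :
    IsUnit (natTransScalar η.hom) := by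
  have h₁ : natTransScalar η.inv * natTransScalar η.hom = 1 :=
    (natTrans_app_apply η.inv (regObj R k) _).symm.trans
      (toLin_congr (Iso.hom_inv_id_app η (regObj R k)) (1 : R))
  exact ⟨⟨_, _, (natTrans_app_one_central _ _).symm.trans h₁, h₁⟩, rfl⟩

section

variable {X Y Z : Type*} [AddCommGroup X] [Module R X] [AddCommGroup Y] [Module R Y]
  [AddCommGroup Z] [Module R Z]

theorem IsDistinguished.smul_central {u : X →ₗ[R] Y} {v : Y →ₗ[R] Z} {w w' : Z →ₗ[R] X}
    (H : IsDistinguished x ρ u v w) {c : R} (hc : ∀ r, r * c = c * r) (hcu : IsUnit c)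
    (hw : ∀ s, w' s = c • w s) : IsDistinguished x (c * ρ) u v w' where
  uv := H.uv
  vw q := by rw [hw, H.vw, smul_zero]
  wu s := by rw [hw, map_smul, H.wu, smul_zero]
  exact_X p hp := by
    obtain ⟨s, rfl⟩ := H.exact_X p hp
    obtain ⟨c', hc'⟩ := hcu.exists_right_inv
    exact ⟨c' • s, by rw [hw, map_smul, ← mul_smul, hc', one_smul]⟩
  exact_Y := H.exact_Y
  exact_Z s hs := H.exact_Z s (by rwa [hw, hcu.smul_eq_zero] at hs)
  returns p q s p' h := by
    obtain ⟨c', hc'⟩ := hcu.exists_right_inv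
    have h₁ : c' * c = 1 := by rw [hc, hc']
    have h₂ : ∀ r, c' * r = r * c' := fun r => by
      calc c' * r = c' * r * (c * c') := by rw [hc', mul_one]
        _ = c' * (r * c) * c' := by simp only [mul_assoc]
        _ = r * c' := by rw [hc, ← mul_assoc, h₁, one_mul]
    obtain ⟨t, ht⟩ := H.returns p q s (c' • p') ⟨h.hu, h.hv, by
      have h₃ := h.hw
      rw [hw] at h₃
      rw [← mul_smul, ← h₂, mul_smul, ← h₃, ← mul_smul, h₁, one_smul]⟩
    refine ⟨t, ?_⟩
    have h₄ := Submodule.smul_mem _ c ht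
    rwa [smul_sub, smul_add, ← mul_smul, hc', one_smul, ← mul_smul, ← hw] at h₄

theorem IsDistinguished.congr {u : X →ₗ[R] Y} {v : Y →ₗ[R] Z} {w : Z →ₗ[R] X}
    (H : IsDistinguished x ρ u v w) (h : ρ - ρ' ∈ maxIdeal R) : IsDistinguished x ρ' u v w where
  toIsExactTriple := H.toIsExactTriple
  returns p q s p' hc := by
    obtain ⟨t, ht⟩ := H.returns p q s p' hc
    refine ⟨t, ?_⟩
    have h' : (ρ - ρ') • p ∈ radSubmodule R X := Submodule.smul_mem_smul h trivial
    convert Submodule.add_mem _ ht h' using 1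
    rw [sub_smul]
    abel

end

theorem distinguishedClass_congr (h : ρ - ρ' ∈ maxIdeal R) :
    distinguishedClass k x ρ = distinguishedClass k x ρ' :=
  Set.ext fun _ => ⟨fun H => IsDistinguished.congr H h,
    fun H => IsDistinguished.congr H (by rw [← neg_sub]; exact Submodule.neg_mem _ h)⟩

theorem twist_mem_distinguishedClass {A : Tri (ProjCat R k)} (hA : A ∈ distinguishedClass k x ρ)
    (η : 𝟭 (ProjCat R k) ≅ 𝟭 (ProjCat R k)) : A.twist η.hom ∈ distinguishedClass k x
      (natTransScalar η.hom * ρ) :=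
  IsDistinguished.smul_central (w' := toLin (A.twist η.hom).w) hA (natTrans_app_one_central _)
    (natIso_app_one_isUnit η) fun s => natTrans_app_apply η.hom A.X (toLin A.w s)

/-- The residue class of `ρ` can be read off from `(x, x, ρ x)`, by the chain `1, 1, 1, ρ`. -/
theorem sub_mem_of_twist_mem (hρ : IsAdmissiblePair x ρ) (η : 𝟭 (ProjCat R k) ⟶ 𝟭 (ProjCat R k))
    (h : (regTri k hρ.gen ρ).twist η ∈ distinguishedClass k x ρ') :
    natTransScalar η * ρ - ρ' ∈ maxIdeal R := by
  set c : R := natTransScalar η with hc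
  let w : R → R := toLin ((regTri k hρ.gen ρ).twist η).w
  have hw : ∀ s : R, w s = c * (s * (ρ * x)) := fun s =>
    natTrans_app_apply η (regObj R k) (s * (ρ * x))
  obtain ⟨(t : R), ht⟩ := IsDistinguished.returns h (1 : R) (1 : R) (1 : R) (c * ρ : R)
    ⟨(one_mul x).trans (mul_one x).symm, (one_mul x).trans (mul_one x).symm, by
      refine (hw 1).trans ?_
      change _ = x * (c * ρ)
      rw [one_mul, ← hρ.comm, ← mul_assoc, ← mul_assoc, natTrans_app_one_central]⟩
  have hle : radSubmodule R R ≤ maxIdeal R := Submodule.smul_le.2 fun r hr n _ =>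
    Ideal.mul_mem_right n _ hr
  have h₁ : c * ρ - (ρ' * 1 + w t) ∈ maxIdeal R := hle ht
  have h₂ : w t ∈ maxIdeal R := by
    rw [hw]
    exact Ideal.mul_mem_left _ _ (Ideal.mul_mem_left _ _ (Ideal.mul_mem_left _ _ hρ.gen.mem))
  have h₃ := Submodule.add_mem _ h₁ h₂
  rw [mul_one] at h₃
  convert h₃ using 1
  abel

variable [IsLocalRing R]

theorem regTri_mem_distinguishedClass (hρ : IsAdmissiblePair x ρ) :
    regTri k hρ.gen ρ ∈ distinguishedClass k x ρ :=
  distinguishedClass_of_isomorphic hρ.gen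
    (isomorphic_regTri hρ.gen (projProperty_punit_finsupp R k))
    (deltaTri_mem_distinguishedClass hρ _ _)

theorem sub_mem_of_distinguishedClass_eq (hρ : IsAdmissiblePair x ρ)
    (h : distinguishedClass k x ρ = distinguishedClass k x ρ') : ρ - ρ' ∈ maxIdeal R := by
  have h₁ := regTri_mem_distinguishedClass (k := k) hρ
  rw [h, ← Tri.twist_id (regTri k hρ.gen ρ)] at h₁
  have h₂ := sub_mem_of_twist_mem hρ _ h₁
  have h₃ : natTransScalar (𝟙 (𝟭 (ProjCat R k))) = 1 := rfl
  rwa [h₃, one_mul] at h₂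

/-- `Δ^r` and `Δ^{r'}` are equivalent iff `r` and `r'` differ by the class of a central unit. -/
theorem Triangulation.equivalent_iff {T T' : Triangulation (ProjCat R k)}
    (hρ : IsAdmissiblePair x ρ) (hT : T.dist = distinguishedClass k x ρ)
    (hT' : T'.dist = distinguishedClass k x ρ') :
    T.Equivalent T' ↔ ∃ c ∈ Subring.center R, IsUnit c ∧ c * ρ - ρ' ∈ maxIdeal R := by
  constructor
  · rintro ⟨η, h⟩
    refine ⟨natTransScalar η.hom,
      Subring.mem_center_iff.2 (natTrans_app_one_central _), natIso_app_one_isUnit η, ?_⟩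
    refine sub_mem_of_twist_mem hρ η.hom ?_
    rw [← hT', ← h, hT]
    exact regTri_mem_distinguishedClass hρ
  · rintro ⟨c, hc, ⟨c, rfl⟩, h⟩
    have hc₁ := Subring.mem_center_iff.1 hc
    have hc₂ : ∀ r : R, r * ((c⁻¹ : Rˣ) : R) = (c⁻¹ : Rˣ) * r := fun r => by
      rw [Units.mul_inv_eq_iff_eq_mul, mul_assoc, hc₁, Units.inv_mul_cancel_left]
    let η := centralNatIso k (c : R) ((c⁻¹ : Rˣ) : R) hc₁ hc₂ c.mul_inv
    have h₁ : natTransScalar η.hom = c := mul_one (c : R)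
    have h₂ : natTransScalar η.symm.hom = ((c⁻¹ : Rˣ) : R) :=
      mul_one ((c⁻¹ : Rˣ) : R)
    refine ⟨η, fun A => ?_⟩
    rw [hT, hT']
    constructor
    · intro hA
      have := twist_mem_distinguishedClass hA η
      rwa [h₁, distinguishedClass_congr h] at this
    · intro hA
      rw [← distinguishedClass_congr h] at hA
      have := twist_mem_distinguishedClass hA η.symm
      rwa [h₂, Units.inv_mul_cancel_left, Tri.twist_twist, Iso.symm_hom, Iso.hom_inv_id,
        Tri.twist_id] at this

end Equivalences

/-! ### Semisimple rings -/

section Semisimple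

variable {R : Type u} [Ring R] {k : ProjKind}

theorem isSemisimpleRing_of_maxIdeal_eq_bot [IsLocalRing R] (h : maxIdeal R = ⊥) :
    IsSemisimpleRing R := by
  have : IsSimpleOrder (Ideal R) :=
    { eq_bot_or_eq_top := fun I => by
        by_cases hI : I = ⊤
        · exact Or.inr hI
        · refine Or.inl (le_bot_iff.1 ?_)
          rw [← h]
          exact fun a ha =>
            (mem_maxIdeal_iff a).2 fun hu => hI (Ideal.eq_top_of_isUnit_mem _ ha hu) }
  have : IsSimpleModule R R := ⟨⟩
  exact (inferInstance : IsSemisimpleModule R R)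

/-- Over a semisimple ring any morphism between the first maps of exact triangles extends to the
triangles. -/
theorem IsExactTriple.exists_fill [IsSemisimpleRing R] {X Y Z X' Y' Z' : Type u} [AddCommGroup X]
    [Module R X] [AddCommGroup Y] [Module R Y] [AddCommGroup Z] [Module R Z] [AddCommGroup X']
    [Module R X'] [AddCommGroup Y'] [Module R Y'] [AddCommGroup Z'] [Module R Z']
    {u : X →ₗ[R] Y} {v : Y →ₗ[R] Z} {w : Z →ₗ[R] X}
    {u' : X' →ₗ[R] Y'} {v' : Y' →ₗ[R] Z'} {w' : Z' →ₗ[R] X'}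
    (H : IsExactTriple u v w) (H' : IsExactTriple u' v' w') (f : X →ₗ[R] X') (g : Y →ₗ[R] Y')
    (hfg : ∀ p, g (u p) = u' (f p)) :
    ∃ h : Z →ₗ[R] Z', (∀ q, h (v q) = v' (g q)) ∧ ∀ s, f (w s) = w' (h s) := by
  have hB : ∀ (M : Type u) [AddCommGroup M] [Module R M], Module.Baer R M := fun M _ _ =>
    Module.Baer.of_injective (Module.injective_of_isSemisimpleRing R M)
  have := Module.projective_of_isSemisimpleRing R X
  obtain ⟨h₁, hh₁⟩ := (hB Z').exists_comp_eq v (v' ∘ₗ g) (fun q hq => by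
    obtain ⟨p, rfl⟩ := H.exact_Y q hq
    rw [LinearMap.comp_apply, hfg, H'.uv])
  replace hh₁ : ∀ q, h₁ (v q) = v' (g q) := hh₁
  let e : Z →ₗ[R] LinearMap.range w' := (f ∘ₗ w - w' ∘ₗ h₁).codRestrict _ fun s =>
    H'.exact_X _ (by simp [← hfg, H.wu, H'.wu])
  have he : ∀ s, (e s : X') = f (w s) - w' (h₁ s) := fun s => rfl
  obtain ⟨ε, hε⟩ := (hB (LinearMap.range w')).exists_comp_eq w e (fun s hs => by
    obtain ⟨q, rfl⟩ := H.exact_Z s hs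
    exact Subtype.ext (by simp [he, H.vw, hh₁, H'.vw]))
  obtain ⟨ζ, hζ⟩ := Module.projective_lifting_property w'.rangeRestrict ε
    w'.surjective_rangeRestrict
  refine ⟨h₁ + ζ ∘ₗ w, fun q => by simp [H.vw, hh₁], fun s => ?_⟩
  have h₂ : w' (ζ (w s)) = e s := by
    rw [← hε]
    exact congrArg Subtype.val (LinearMap.congr_fun hζ (w s))
  rw [LinearMap.add_apply, LinearMap.comp_apply, map_add, h₂, he, add_sub_cancel]

theorem Triangulation.dist_subset_of_isSemisimpleRing [IsSemisimpleRing R]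
    (T T' : Triangulation (ProjCat R k)) : T.dist ⊆ T'.dist := by
  intro A hA
  obtain ⟨Z, v, w, uv, vw, wu, hB⟩ := T'.exists_mem A.u
  obtain ⟨h, hv, hw⟩ := (T'.isExactTriple hB).exists_fill (T.isExactTriple hA) LinearMap.id
    LinearMap.id (fun p => rfl)
  exact T'.iso_mem ⟨A.X, A.Y, Z, A.u, v, w, uv, vw, wu⟩ A
    ⟨⟨𝟙 A.X, 𝟙 A.Y, ofLin h, rfl, toLin_ext hv, toLin_ext hw⟩,
    (inferInstance : IsIso (𝟙 A.X)), (inferInstance : IsIso (𝟙 A.Y)),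
    isIso_of_bijective _ ((T'.isExactTriple hB).bijective (T.isExactTriple hA)
      (f := LinearMap.id) (g := LinearMap.id) (fun p => rfl) hv hw Function.bijective_id
      Function.bijective_id)⟩ hB

end Semisimple

/-! ### Classification -/

section Classification

variable {R : Type u} [Ring R] {k : ProjKind} {x : R}

theorem sub_mem_maxIdeal_iff {a b : R} : a - b ∈ maxIdeal R ↔ toResidue R a = toResidue R b :=
  Ideal.Quotient.eq.symm

variable [IsLocalRing R]

theorem isUnit_of_toResidue_ne_zero {ρ : R} (h : toResidue R ρ ≠ 0) : IsUnit ρ := by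
  by_contra hu
  exact h (Ideal.Quotient.eq_zero_iff_mem.2 ((mem_maxIdeal_iff ρ).2 hu))

theorem nontrivial_residueSkewField (R : Type u) [Ring R] [IsLocalRing R] :
    Nontrivial (ResidueSkewField R) :=
  Ideal.Quotient.nontrivial_iff.2 (Ring.jacobson_lt_top R).ne

theorem isUnit_of_toResidue_eq {ρ : R} {r : (ResidueSkewField R)ˣ} (h : toResidue R ρ = r) :
    IsUnit ρ := by
  have := nontrivial_residueSkewField R
  exact isUnit_of_toResidue_ne_zero (by rw [h]; exact r.ne_zero)

/-- The conditions on `r ∈ d^×` and on a lift of `r` agree. -/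
theorem isAdmissible_iff (hx : IsRadicalGenerator x) (h2 : (2 : R) ∈ maxIdeal R) {ρ : R}
    {r : (ResidueSkewField R)ˣ} (hρ : toResidue R ρ = r) :
    hx.cond.IsAdmissible hx.mem hx.ne_zero r ↔ IsAdmissiblePair x ρ := by
  have hσ := hx.cond.sigma_eq_iff hx.mem hx.ne_zero
  constructor
  · intro h
    refine ⟨hx, h2, isUnit_of_toResidue_eq hρ, ?_, fun a b c hab hbc => ?_⟩
    · rw [← hσ, hρ, h.fixed]
    · obtain ⟨a', ha'⟩ := hx.exists_comm_mul a
      have h₃ := h.cube (toResidue R c)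
      rw [(hσ b c).2 hbc, (hσ a b).2 hab, (hσ a' a).2 ha'.symm, mul_assoc,
        Units.eq_inv_mul_iff_mul_eq, ← hρ, ← map_mul, ← map_mul,
        ← hx.cond.mul_left_eq_iff hx.mem hx.ne_zero] at h₃
      rw [mul_assoc, ← ha', ← mul_assoc, h₃]
  · intro h
    refine ⟨?_, fun t => ?_⟩
    · rw [← hρ, hσ, h.comm]
    · obtain ⟨c, rfl⟩ := Ideal.Quotient.mk_surjective t
      obtain ⟨b, hb⟩ := hx.exists_comm_mul c
      obtain ⟨a, ha⟩ := hx.exists_comm_mul b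
      obtain ⟨a', ha'⟩ := hx.exists_comm_mul a
      change hx.cond.sigma hx.mem hx.ne_zero (hx.cond.sigma hx.mem hx.ne_zero
        (hx.cond.sigma hx.mem hx.ne_zero (toResidue R c))) = _ * toResidue R c * _
      rw [(hσ b c).2 hb.symm, (hσ a b).2 ha.symm, (hσ a' a).2 ha'.symm, mul_assoc,
        Units.eq_inv_mul_iff_mul_eq, ← hρ, ← map_mul, ← map_mul,
        ← hx.cond.mul_left_eq_iff hx.mem hx.ne_zero]
      have h₃ := h.cube a b c ha.symm hb.symm
      rwa [mul_assoc, ← ha', ← mul_assoc] at h₃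

/-- For `r` the class of `ρ` in an admissible pair, `Δ^r` is the triangulation described
intrinsically. -/
theorem isDelta_iff (hx : IsRadicalGenerator x) {ρ : R} (hρ : IsAdmissiblePair x ρ)
    {T : Triangulation (ProjCat R k)} :
    IsDelta hx.cond k hx.mem (toResidue R ρ) T ↔ T.dist = distinguishedClass k x ρ := by
  constructor
  · rintro ⟨ρ', h, hT⟩
    rw [hT, ← deltaClass_eq hρ]
    have e : ρ' * x = ρ * x := (hx.cond.mul_left_eq_iff hx.mem hx.ne_zero _ _).2 h
    simp only [deltaClass, deltaTri, e]
  · intro hT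
    exact ⟨ρ, rfl, by rw [hT, deltaClass_eq hρ]⟩

theorem isAdmissible_of_isDelta (hx : IsRadicalGenerator x) (h2 : (2 : R) ∈ maxIdeal R)
    {r : (ResidueSkewField R)ˣ} {T : Triangulation (ProjCat R k)}
    (h : IsDelta hx.cond k hx.mem r T) : hx.cond.IsAdmissible hx.mem hx.ne_zero r := by
  obtain ⟨ρ, hρ, hT⟩ := h
  rw [isAdmissible_iff hx h2 hρ]
  exact Triangulation.isAdmissiblePair_of_dist_eq_deltaClass hx h2 (isUnit_of_toResidue_eq hρ) hT

theorem existsUnique_isDelta (hx : IsRadicalGenerator x) (h2 : (2 : R) ∈ maxIdeal R)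
    {r : (ResidueSkewField R)ˣ} (h : hx.cond.IsAdmissible hx.mem hx.ne_zero r) :
    ∃! T : Triangulation (ProjCat R k), IsDelta hx.cond k hx.mem r T := by
  obtain ⟨ρ, hρ⟩ := Ideal.Quotient.mk_surjective (r : ResidueSkewField R)
  have hρ' := (isAdmissible_iff hx h2 hρ).1 h
  rw [← hρ]
  refine ⟨deltaTriangulation k hρ', (isDelta_iff hx hρ').2 rfl, fun T hT => ?_⟩
  exact Triangulation.ext ((isDelta_iff hx hρ').1 hT)

theorem existsUnique_of_triangulation (hx : IsRadicalGenerator x) (h2 : (2 : R) ∈ maxIdeal R)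
    (T : Triangulation (ProjCat R k)) : ∃! r : (ResidueSkewField R)ˣ,
      hx.cond.IsAdmissible hx.mem hx.ne_zero r ∧ IsDelta hx.cond k hx.mem r T := by
  obtain ⟨ρ, hρ, hT⟩ := T.exists_isAdmissiblePair hx h2
  obtain ⟨r, hr⟩ := hρ.isUnit.map (toResidue R)
  refine ⟨r, ⟨(isAdmissible_iff hx h2 hr.symm).2 hρ, ?_⟩, ?_⟩
  · rw [hr]
    exact (isDelta_iff hx hρ).2 hT
  · rintro r' ⟨h, h'⟩
    obtain ⟨ρ', hρ'⟩ := Ideal.Quotient.mk_surjective (r' : ResidueSkewField R)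
    have hp := (isAdmissible_iff hx h2 hρ').1 h
    rw [← hρ'] at h'
    have h₁ := (isDelta_iff hx hp).1 h'
    ext
    rw [hr, ← hρ']
    exact sub_mem_maxIdeal_iff.1 (sub_mem_of_distinguishedClass_eq hp (h₁.symm.trans hT))

/-- The criterion for equivalence in terms of residue classes. -/
theorem equivalent_iff_of_isDelta (hx : IsRadicalGenerator x) (h2 : (2 : R) ∈ maxIdeal R)
    {r r' : (ResidueSkewField R)ˣ} {T T' : Triangulation (ProjCat R k)}
    (hT : IsDelta hx.cond k hx.mem r T) (hT' : IsDelta hx.cond k hx.mem r' T') :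
    T.Equivalent T' ↔ ∃ c ∈ Subring.center R, IsUnit c ∧
      toResidue R c * (r : ResidueSkewField R) = r' := by
  have h := isAdmissible_of_isDelta hx h2 hT
  have h' := isAdmissible_of_isDelta hx h2 hT'
  obtain ⟨ρ, hρ⟩ := Ideal.Quotient.mk_surjective (r : ResidueSkewField R)
  obtain ⟨ρ', hρ'⟩ := Ideal.Quotient.mk_surjective (r' : ResidueSkewField R)
  have hp := (isAdmissible_iff hx h2 hρ).1 h
  have hp' := (isAdmissible_iff hx h2 hρ').1 h'
  rw [← hρ] at hT
  rw [← hρ'] at hT'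
  rw [Triangulation.equivalent_iff hp ((isDelta_iff hx hp).1 hT) ((isDelta_iff hx hp').1 hT'),
    ← hρ, ← hρ']
  refine exists_congr fun c => and_congr_right fun _ => and_congr_right fun _ => ?_
  rw [← map_mul]
  exact sub_mem_maxIdeal_iff

/-- A surjective relation from a setoid to a group that identifies the equivalence relation with
congruence modulo a subgroup induces a bijection on the quotients. -/
theorem exists_quotient_equiv {α : Type*} (s : Setoid α) {G : Type*} [Group G] (H : Subgroup G)
    (Rel : α → G → Prop) (htotal : ∀ a, ∃ g, Rel a g) (hsurj : ∀ g, ∃ a, Rel a g)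
    (hrel : ∀ a a' g g', Rel a g → Rel a' g' → (s a a' ↔ g⁻¹ * g' ∈ H)) :
    ∃ Φ : Quotient s ≃ G ⧸ H, ∀ a g, Rel a g → Φ (Quotient.mk _ a) = QuotientGroup.mk g := by
  choose F hF using htotal
  let φ : Quotient s → G ⧸ H := Quotient.lift (fun a => QuotientGroup.mk (F a)) fun a a' h =>
    QuotientGroup.eq.2 ((hrel _ _ _ _ (hF a) (hF a')).1 h)
  have hφ : ∀ a g, Rel a g → φ (Quotient.mk _ a) = QuotientGroup.mk g := fun a g h =>
    QuotientGroup.eq.2 ((hrel _ _ _ _ (hF a) h).1 (s.refl a))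
  refine ⟨Equiv.ofBijective φ ⟨?_, ?_⟩, hφ⟩
  · rintro ⟨a⟩ ⟨a'⟩ h
    exact Quotient.sound ((hrel _ _ _ _ (hF a) (hF a')).2 (QuotientGroup.eq.1 h))
  · intro g
    obtain ⟨g, rfl⟩ := QuotientGroup.mk_surjective g
    obtain ⟨a, ha⟩ := hsurj g
    exact ⟨Quotient.mk _ a, hφ a g ha⟩

/-- The residue classes of units of the center are the units of `d'`. -/
theorem mem_range_centerResidueMap_iff (z : (Subring.center (ResidueSkewField R))ˣ) :
    z ∈ (Units.map (centerResidueMap R : CenterResidueField R →* _)).range ↔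
      ∃ c ∈ Subring.center R, IsUnit c ∧
        toResidue R c = (z : Subring.center (ResidueSkewField R)) := by
  have := nontrivial_residueSkewField R
  constructor
  · rintro ⟨c, rfl⟩
    obtain ⟨c', hc'⟩ := Ideal.Quotient.mk_surjective (c : CenterResidueField R)
    have h : toResidue R c' = (centerResidueMap R c : Subring.center (ResidueSkewField R)) := by
      rw [← hc']
      rfl
    refine ⟨c', c'.2, isUnit_of_toResidue_ne_zero ?_, h⟩
    have hu : IsUnit (centerResidueMap R c) := c.isUnit.map (centerResidueMap R)
    rw [h]
    exact (hu.map (Subring.center (ResidueSkewField R)).subtype).ne_zero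
  · rintro ⟨c, hc, hu, h⟩
    have hu' : IsUnit (⟨c, hc⟩ : Subring.center R) := isUnit_center_of_isUnit _ hu
    obtain ⟨c', hc'⟩ := hu'.map (IsLocalRing.residue (Subring.center R))
    refine ⟨c', Units.ext (Subtype.ext ?_)⟩
    change ((centerResidueMap R c' : Subring.center (ResidueSkewField R)) : ResidueSkewField R) = _
    rw [hc', ← h]
    rfl

theorem mem_range_centerResidueMapFixed_iff (hx : IsRadicalGenerator x)
    (z : (hx.cond.fixedCenter hx.mem hx.ne_zero)ˣ) :
    z ∈ (Units.map
      (hx.cond.centerResidueMapFixed hx.mem hx.ne_zero : CenterResidueField R →* _)).range ↔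
      ∃ c ∈ Subring.center R, IsUnit c ∧ toResidue R c =
        ((z : hx.cond.fixedCenter hx.mem hx.ne_zero) : Subring.center (ResidueSkewField R)) := by
  let ι := Units.map ((hx.cond.fixedCenter hx.mem hx.ne_zero).subtype :
    hx.cond.fixedCenter hx.mem hx.ne_zero →* Subring.center (ResidueSkewField R))
  refine Iff.trans ?_ (mem_range_centerResidueMap_iff (ι z))
  constructor
  · rintro ⟨c, rfl⟩
    exact ⟨c, rfl⟩
  · rintro ⟨c, hc⟩
    refine ⟨c, Units.ext (Subtype.ext ?_)⟩
    exact congrArg Units.val hc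

/-- For `x = 2` the automorphism `σ_x` is trivial, so that admissible means central. -/
theorem isAdmissible_two_iff (hx : IsRadicalGenerator (2 : R)) (r : (ResidueSkewField R)ˣ) :
    hx.cond.IsAdmissible hx.mem hx.ne_zero r ↔
      (r : ResidueSkewField R) ∈ Subring.center (ResidueSkewField R) := by
  have hσ : ∀ t, hx.cond.sigma hx.mem hx.ne_zero t = t := fun t => by
    obtain ⟨t, rfl⟩ := Ideal.Quotient.mk_surjective t
    exact (hx.cond.sigma_eq_iff hx.mem hx.ne_zero t t).2 (by rw [two_mul, mul_two])
  rw [Subring.mem_center_iff]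
  constructor
  · intro h t
    have := h.cube t
    rw [hσ, hσ, hσ, mul_assoc, Units.eq_inv_mul_iff_mul_eq] at this
    exact this.symm
  · intro h
    refine ⟨hσ _, fun t => ?_⟩
    rw [hσ, hσ, hσ, mul_assoc, Units.eq_inv_mul_iff_mul_eq, h]

end Classification

/-! ### The mixed-characteristic, equicharacteristic and commutative cases -/

section Cases

variable {R : Type u} [Ring R] [IsLocalRing R]

theorem MixedCharacteristic.isRadicalGenerator_two (hR : RadicalConditions R)
    (h : MixedCharacteristic R) : IsRadicalGenerator (2 : R) where
  cond := hR
  mem := h.two_mem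
  ne_zero h0 := h.ne_bot (by
    refine SetLike.coe_injective ?_
    rw [h.eq_two_mul]
    ext a
    simp [h0])

/-- A central unit of a ring is a unit of the center. -/
theorem Subring.exists_units_center {S : Type*} [Ring S] {r : Sˣ} (h : (r : S) ∈ Subring.center S) :
    ∃ z : (Subring.center S)ˣ, ((z : Subring.center S) : S) = r := by
  obtain ⟨z, hz⟩ := isUnit_center_of_isUnit ⟨(r : S), h⟩ r.isUnit
  exact ⟨z, congrArg Subtype.val hz⟩

theorem mixedCharacteristic_classification (hx : IsRadicalGenerator (2 : R)) (k : ProjKind) :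
    (∀ r : (Subring.center (ResidueSkewField R))ˣ,
      ∃! T : Triangulation (ProjCat R k),
        IsDelta hx.cond k hx.mem (r : Subring.center (ResidueSkewField R)) T) ∧
    (∀ T : Triangulation (ProjCat R k),
      ∃! r : (Subring.center (ResidueSkewField R))ˣ,
        IsDelta hx.cond k hx.mem (r : Subring.center (ResidueSkewField R)) T) ∧
    ∃ Φ : TriangulationClasses (ProjCat R k) ≃ CenterUnitsQuotient R,
      ∀ (T : Triangulation (ProjCat R k)) (r : (Subring.center (ResidueSkewField R))ˣ),
        IsDelta hx.cond k hx.mem (r : Subring.center (ResidueSkewField R)) T →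
          Φ (Quotient.mk _ T) = QuotientGroup.mk r := by
  let ι : (Subring.center (ResidueSkewField R))ˣ →* (ResidueSkewField R)ˣ :=
    Units.map ((Subring.center (ResidueSkewField R)).subtype :
      Subring.center (ResidueSkewField R) →* ResidueSkewField R)
  have hsurj : ∀ r : (Subring.center (ResidueSkewField R))ˣ,
      ∃! T : Triangulation (ProjCat R k),
        IsDelta hx.cond k hx.mem (r : Subring.center (ResidueSkewField R)) T := fun r =>
    existsUnique_isDelta hx hx.mem (r := ι r)
      ((isAdmissible_two_iff hx _).2 (r : Subring.center (ResidueSkewField R)).2)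
  have htotal : ∀ T : Triangulation (ProjCat R k),
      ∃! r : (Subring.center (ResidueSkewField R))ˣ,
        IsDelta hx.cond k hx.mem (r : Subring.center (ResidueSkewField R)) T := by
    intro T
    obtain ⟨r, ⟨hr, hT⟩, huniq⟩ := existsUnique_of_triangulation hx hx.mem T
    obtain ⟨z, hz⟩ := Subring.exists_units_center ((isAdmissible_two_iff hx r).1 hr)
    refine ⟨z, ?_, fun z' hz' => ?_⟩
    · change IsDelta _ _ _ _ _
      rwa [hz]
    · have h := huniq (ι z')
        ⟨(isAdmissible_two_iff hx _).2 (z' : Subring.center (ResidueSkewField R)).2, hz'⟩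
      refine Units.ext (Subtype.ext ?_)
      rw [hz, ← h]
      rfl
  refine ⟨hsurj, htotal, ?_⟩
  refine exists_quotient_equiv (G := (Subring.center (ResidueSkewField R))ˣ) _ _
    (fun T r => IsDelta hx.cond k hx.mem
    (r : Subring.center (ResidueSkewField R)) T) (fun T => (htotal T).exists)
    (fun r => (hsurj r).exists) fun T T' r r' hT hT' => ?_
  refine (equivalent_iff_of_isDelta hx hx.mem (r := ι r) (r' := ι r') hT hT').trans
    (Iff.trans ?_ (mem_range_centerResidueMap_iff (r⁻¹ * r')).symm)
  refine exists_congr fun c => and_congr_right fun _ => and_congr_right fun _ => ?_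
  have h₁ : (((r⁻¹ * r' : (Subring.center (ResidueSkewField R))ˣ) :
      Subring.center (ResidueSkewField R)) : ResidueSkewField R) = ((ι r' * (ι r)⁻¹ :
      (ResidueSkewField R)ˣ) : ResidueSkewField R) := by
    rw [mul_comm, ← map_inv, ← map_mul]
    rfl
  rw [h₁, Units.val_mul, Units.eq_mul_inv_iff_mul_eq]

variable {x : R} {r r' : (ResidueSkewField R)ˣ}

theorem Units.map_inv_eq_of_map_eq {S : Type*} [Ring S] (σ : S ≃+* S) {u : Sˣ}
    (h : σ (u : S) = u) : σ (u⁻¹ : Sˣ) = (u⁻¹ : Sˣ) :=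
  (Units.inv_eq_of_mul_eq_one_right (by
    nth_rw 1 [← h]
    rw [← map_mul, Units.mul_inv, map_one])).symm

theorem IsRadicalGenerator.exists_units_fixedCenter (hx : IsRadicalGenerator x)
    (hc : (r : ResidueSkewField R) ∈ Subring.center (ResidueSkewField R))
    (hs : hx.cond.sigma hx.mem hx.ne_zero (r : ResidueSkewField R) = r) :
    ∃ z : (hx.cond.fixedCenter hx.mem hx.ne_zero)ˣ,
      (((z : hx.cond.fixedCenter hx.mem hx.ne_zero) : Subring.center (ResidueSkewField R)) :
        ResidueSkewField R) = r := by
  obtain ⟨z, hz⟩ := Subring.exists_units_center hc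
  have hz' : (z : Subring.center (ResidueSkewField R)) ∈
      hx.cond.fixedCenter hx.mem hx.ne_zero := by
    change hx.cond.sigma hx.mem hx.ne_zero ((z : Subring.center (ResidueSkewField R)) :
      ResidueSkewField R) = (z : Subring.center (ResidueSkewField R))
    rw [hz, hs]
  have hi : ((z⁻¹ : (Subring.center (ResidueSkewField R))ˣ) :
      Subring.center (ResidueSkewField R)) ∈ hx.cond.fixedCenter hx.mem hx.ne_zero :=
    Units.map_inv_eq_of_map_eq (hx.cond.sigma hx.mem hx.ne_zero)
      (u := z.map ((Subring.center (ResidueSkewField R)).subtype :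
        Subring.center (ResidueSkewField R) →* ResidueSkewField R)) hz'
  exact ⟨⟨⟨_, hz'⟩, ⟨_, hi⟩, Subtype.ext z.mul_inv, Subtype.ext z.inv_mul⟩, hz⟩

theorem IsRadicalGenerator.isAdmissible_mul (hx : IsRadicalGenerator x)
    (hr : hx.cond.IsAdmissible hx.mem hx.ne_zero r)
    (z : (hx.cond.fixedCenter hx.mem hx.ne_zero)ˣ)
    (hz : (r' : ResidueSkewField R) = r *
      ((z : hx.cond.fixedCenter hx.mem hx.ne_zero) : Subring.center (ResidueSkewField R))) :
    hx.cond.IsAdmissible hx.mem hx.ne_zero r' := by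
  have hs : hx.cond.sigma hx.mem hx.ne_zero ((z : hx.cond.fixedCenter hx.mem hx.ne_zero) :
      Subring.center (ResidueSkewField R)) = ((z : hx.cond.fixedCenter hx.mem hx.ne_zero) :
      Subring.center (ResidueSkewField R)) := (z : hx.cond.fixedCenter hx.mem hx.ne_zero).2
  have hc := Subring.mem_center_iff.1
    ((z : hx.cond.fixedCenter hx.mem hx.ne_zero) : Subring.center (ResidueSkewField R)).2
  refine ⟨by rw [hz, map_mul, hr.fixed, hs], fun t => ?_⟩
  rw [hr.cube, mul_assoc _ t, mul_assoc _ t, Units.eq_inv_mul_iff_mul_eq, hz, hc,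
    mul_assoc, Units.mul_inv_cancel_left, ← mul_assoc, ← mul_assoc, hc t]

/-- Two admissible elements define the same inner automorphism of `d` and are both fixed by `σ_x`,
so their quotient lies in `Z(d)^{σ_x}`. -/
theorem IsRadicalGenerator.exists_units_fixedCenter_eq (hx : IsRadicalGenerator x)
    (hr : hx.cond.IsAdmissible hx.mem hx.ne_zero r)
    (hr' : hx.cond.IsAdmissible hx.mem hx.ne_zero r') :
    ∃ z : (hx.cond.fixedCenter hx.mem hx.ne_zero)ˣ,
      (((z : hx.cond.fixedCenter hx.mem hx.ne_zero) : Subring.center (ResidueSkewField R)) :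
        ResidueSkewField R) = (r⁻¹ : (ResidueSkewField R)ˣ) * r' := by
  refine hx.exists_units_fixedCenter (r := r⁻¹ * r') ?_ ?_
  · rw [Subring.mem_center_iff]
    intro t
    have h := (hr.cube (r * t * (r⁻¹ : (ResidueSkewField R)ˣ))).symm.trans (hr'.cube _)
    rw [← mul_assoc, ← mul_assoc, Units.inv_mul, one_mul, mul_assoc, Units.inv_mul, mul_one,
      mul_assoc, Units.eq_inv_mul_iff_mul_eq] at h
    rw [Units.val_mul, mul_assoc, h, mul_assoc, mul_assoc, Units.inv_mul_cancel_left]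
  · rw [Units.val_mul, map_mul, Units.map_inv_eq_of_map_eq _ hr.fixed, hr'.fixed]

theorem equicharacteristic_classification (hx : IsRadicalGenerator x) (h2 : (2 : R) = 0)
    (k : ProjKind) (hr : hx.cond.IsAdmissible hx.mem hx.ne_zero r) :
    (∀ r' : (ResidueSkewField R)ˣ, hx.cond.IsAdmissible hx.mem hx.ne_zero r' →
      ∃! T : Triangulation (ProjCat R k), IsDelta hx.cond k hx.mem r' T) ∧
    (∀ T : Triangulation (ProjCat R k), ∃! r' : (ResidueSkewField R)ˣ,
      hx.cond.IsAdmissible hx.mem hx.ne_zero r' ∧ IsDelta hx.cond k hx.mem r' T) ∧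
    ∃ Φ : TriangulationClasses (ProjCat R k) ≃
        hx.cond.FixedCenterUnitsQuotient hx.mem hx.ne_zero,
      ∀ (T : Triangulation (ProjCat R k)) (r' : (ResidueSkewField R)ˣ),
        IsDelta hx.cond k hx.mem r' T →
        ∃ z : (hx.cond.fixedCenter hx.mem hx.ne_zero)ˣ,
          (((z : hx.cond.fixedCenter hx.mem hx.ne_zero) : Subring.center (ResidueSkewField R)) :
            ResidueSkewField R) = (r⁻¹ : (ResidueSkewField R)ˣ) * r' ∧
          Φ (Quotient.mk _ T) = QuotientGroup.mk z := by
  have h2' : (2 : R) ∈ maxIdeal R := h2 ▸ zero_mem _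
  let ι : (hx.cond.fixedCenter hx.mem hx.ne_zero)ˣ →* (ResidueSkewField R)ˣ :=
    Units.map (((Subring.center (ResidueSkewField R)).subtype.comp
      (hx.cond.fixedCenter hx.mem hx.ne_zero).subtype :
      hx.cond.fixedCenter hx.mem hx.ne_zero →+* ResidueSkewField R) :
      hx.cond.fixedCenter hx.mem hx.ne_zero →* ResidueSkewField R)
  have hι : ∀ (z : (hx.cond.fixedCenter hx.mem hx.ne_zero)ˣ) (t : ResidueSkewField R),
      t * ι z = ι z * t := fun z => Subring.mem_center_iff.1
    ((z : hx.cond.fixedCenter hx.mem hx.ne_zero) : Subring.center (ResidueSkewField R)).2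
  have hquot : ∀ {T : Triangulation (ProjCat R k)} {r' : (ResidueSkewField R)ˣ},
      IsDelta hx.cond k hx.mem r' T → ∃ z, (ι z : ResidueSkewField R) =
        (r⁻¹ : (ResidueSkewField R)ˣ) * r' := fun hT =>
    hx.exists_units_fixedCenter_eq hr (isAdmissible_of_isDelta hx h2' hT)
  obtain ⟨Φ, hΦ⟩ := exists_quotient_equiv (G := (hx.cond.fixedCenter hx.mem hx.ne_zero)ˣ)
    (Triangulation.setoid (C := ProjCat R k))
    (Units.map (hx.cond.centerResidueMapFixed hx.mem hx.ne_zero : CenterResidueField R →* _)).range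
    (fun T z => IsDelta hx.cond k hx.mem (r * ι z : (ResidueSkewField R)ˣ) T)
    (fun T => by
      obtain ⟨r', ⟨-, hT⟩, -⟩ := existsUnique_of_triangulation hx h2' T
      obtain ⟨z, hz⟩ := hquot hT
      refine ⟨z, ?_⟩
      rwa [Units.val_mul, hz, Units.mul_inv_cancel_left])
    (fun z => (existsUnique_isDelta hx h2' (hx.isAdmissible_mul hr z rfl)).exists)
    (fun T T' z z' hT hT' => by
      refine (equivalent_iff_of_isDelta hx h2' hT hT').trans
        (Iff.trans ?_ (mem_range_centerResidueMapFixed_iff hx (z⁻¹ * z')).symm)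
      refine exists_congr fun c => and_congr_right fun _ => and_congr_right fun _ => ?_
      have h₁ : (((z⁻¹ * z' : (hx.cond.fixedCenter hx.mem hx.ne_zero)ˣ) :
          hx.cond.fixedCenter hx.mem hx.ne_zero) : Subring.center (ResidueSkewField R)) =
          ((ι z' * (ι z)⁻¹ : (ResidueSkewField R)ˣ) : ResidueSkewField R) := by
        rw [mul_comm, ← map_inv, ← map_mul]
        rfl
      rw [h₁, Units.val_mul (ι z'), Units.eq_mul_inv_iff_mul_eq, Units.val_mul, Units.val_mul,
        hι, hι, ← mul_assoc, Units.mul_left_inj])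
  refine ⟨fun r' hr' => existsUnique_isDelta hx h2' hr', existsUnique_of_triangulation hx h2',
    Φ, fun T r' hT => ?_⟩
  obtain ⟨z, hz⟩ := hquot hT
  refine ⟨z, hz, hΦ T z ?_⟩
  rwa [Units.val_mul, hz, Units.mul_inv_cancel_left]

/-- Over a commutative ring the unit relating the triangulations of `ρ` and `ρ'` is the central
unit `ρ' ρ⁻¹`. -/
theorem Triangulation.equivalent_of_comm (hR : RadicalConditions R)
    (hcomm : ∀ a b : R, a * b = b * a) {k : ProjKind} (T T' : Triangulation (ProjCat R k)) :
    T.Equivalent T' := by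
  by_cases h0 : maxIdeal R = ⊥
  · have := isSemisimpleRing_of_maxIdeal_eq_bot h0
    have h : T = T' := Triangulation.ext
      ((T.dist_subset_of_isSemisimpleRing T').antisymm (T'.dist_subset_of_isSemisimpleRing T))
    exact h ▸ Triangulation.setoid.refl T
  obtain ⟨x, hx, hx0⟩ := Submodule.exists_mem_ne_zero_of_ne_bot h0
  have hg : IsRadicalGenerator x := ⟨hR, hx, hx0⟩
  have h2 : (2 : R) ∈ maxIdeal R := by
    obtain ⟨ρ, hρ, hT⟩ := T.exists_regTri_mem hg
    rw [← hg.eq_zero_mul_iff, ← hρ.mul_right_eq_zero, two_mul, mul_add]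
    nth_rw 1 [hcomm ρ x, mul_comm_neg_of_regTri_mem hg hT]
    exact neg_add_cancel _
  obtain ⟨ρ, hρ, hT⟩ := T.exists_isAdmissiblePair hg h2
  obtain ⟨ρ', hρ', hT'⟩ := T'.exists_isAdmissiblePair hg h2
  obtain ⟨u, rfl⟩ := hρ.isUnit
  refine (Triangulation.equivalent_iff hρ hT hT').2 ⟨ρ' * (u⁻¹ : Rˣ),
    Subring.mem_center_iff.2 fun _ => hcomm _ _, hρ'.isUnit.mul (Units.isUnit _), ?_⟩
  rw [Units.inv_mul_cancel_right, sub_self]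
  exact zero_mem _

end Cases

theorem mainTheorem4 {R : Type u} [Ring R] [IsLocalRing R] (hR : RadicalConditions R)
    (k : ProjKind) :
    -- mixed-characteristic case, with respect to the generator `2` of the maximal ideal
    (∀ hmix : MixedCharacteristic R,
      (∀ r : (Subring.center (ResidueSkewField R))ˣ,
        ∃! T : Triangulation (ProjCat R k),
          IsDelta hR k hmix.two_mem (r : Subring.center (ResidueSkewField R)) T) ∧
      (∀ T : Triangulation (ProjCat R k),
        ∃! r : (Subring.center (ResidueSkewField R))ˣ,
          IsDelta hR k hmix.two_mem (r : Subring.center (ResidueSkewField R)) T) ∧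
      ∃ Φ : TriangulationClasses (ProjCat R k) ≃ CenterUnitsQuotient R,
        ∀ (T : Triangulation (ProjCat R k)) (r : (Subring.center (ResidueSkewField R))ˣ),
          IsDelta hR k hmix.two_mem (r : Subring.center (ResidueSkewField R)) T →
            Φ (Quotient.mk _ T) = QuotientGroup.mk r) ∧
    -- equicharacteristic case, with respect to a generator `x` of the maximal ideal and `r`
    (∀ (x : R) (hx : x ∈ maxIdeal R) (hx0 : x ≠ 0) (r : (ResidueSkewField R)ˣ),
      (2 : R) = 0 → hR.IsAdmissible hx hx0 r →
      (∀ r' : (ResidueSkewField R)ˣ, hR.IsAdmissible hx hx0 r' →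
        ∃! T : Triangulation (ProjCat R k), IsDelta hR k hx r' T) ∧
      (∀ T : Triangulation (ProjCat R k),
        ∃! r' : (ResidueSkewField R)ˣ, hR.IsAdmissible hx hx0 r' ∧ IsDelta hR k hx r' T) ∧
      ∃ Φ : TriangulationClasses (ProjCat R k) ≃ hR.FixedCenterUnitsQuotient hx hx0,
        ∀ (T : Triangulation (ProjCat R k)) (r' : (ResidueSkewField R)ˣ),
          IsDelta hR k hx r' T →
          ∃ z : (hR.fixedCenter hx hx0)ˣ,
            (((z : hR.fixedCenter hx hx0) : Subring.center (ResidueSkewField R)) :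
              ResidueSkewField R) = (r⁻¹ : (ResidueSkewField R)ˣ) * r' ∧
            Φ (Quotient.mk _ T) = QuotientGroup.mk z) ∧
    -- if `R` is commutative, all triangulations are isomorphic
    ((∀ a b : R, a * b = b * a) →
      ∀ T T' : Triangulation (ProjCat R k), Triangulation.Equivalent T T') := by
  refine ⟨fun hmix => mixedCharacteristic_classification (hmix.isRadicalGenerator_two hR) k,
    fun x hx hx0 r h2 hr => equicharacteristic_classification ⟨hR, hx, hx0⟩ h2 k hr,
    fun hcomm T T' => Triangulation.equivalent_of_comm hR hcomm T T'⟩
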